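/- **Notation.** Let $K=U_2$ act naturally on $\mathbb C^2$. For $n\ge 0$ let $V_n$ be the space of homogeneous holomorphic polynomials of degree $n$ on $\mathbb C^2$, with the representation $[\tau_n(k)p](z)=p(k^{-1}z)$ of $K$, the derived representation $d\tau_n$, and the inner product for which the monomials $\binom nj^{1/2}z_1^jz_2^{n-j}$, $0\le j\le n$, form an orthonormal basis. Let $\mathcal S(\mathbb C^2,\mathrm{End}(V_n))^K$ be the space of Schwartz functions $F:\mathbb C^2\to\mathrm{End}(V_n)$ that are $K$-equivariant, i.e. $F(kz)=\tau_n(k)F(z)\tau_n(k)^{-1}$ for all $k\in K$, $z\in\mathbb C^2$. On $\mathrm{End}(V_n)$-valued functions on $\mathbb C^2$ consider $\Delta_z=\Delta_{z_1}+\Delta_{z_2}$, where $\Delta_{z_j}=-4\partial_{z_j}\partial_{\bar z_j}$ (so $\Delta_z$ is minus the Euclidean Laplacian of $\mathbb C^2=\mathbb R^4$), and $$\mathbf D_n=i(\Delta_{z_2}-\Delta_{z_1})\otimes d\tau_n(X_1)-4(\partial_{\bar z_1}\partial_{z_2}-\partial_{z_1}\partial_{\bar z_2})\otimes d\tau_n(X_2)+4i(\partial_{z_1}\partial_{\bar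 z_2}+\partial_{\bar z_1}\partial_{z_2})\otimes d\tau_n(X_3),$$ where $X_1=\begin{bmatrix}i&0\\0&-i\end{bmatrix}$, $X_2=\begin{bmatrix}0&1\\-1&0\end{bmatrix}$, $X_3=\begin{bmatrix}0&i\\i&0\end{bmatrix}$, and where $d\tau_n(X_j)$ acts by composition on the left. A bounded spherical function with eigenvalues $\xi=(\xi_1,\xi_2)\in\mathbb R^2$ is a bounded smooth $K$-equivariant function $\Phi:\mathbb C^2\to\mathrm{End}(V_n)$ with $\Phi(0)=I$, $\Delta_z\Phi=\xi_1\Phi$ and $\mathbf D_n\Phi=\xi_2\Phi$. Let $\Sigma^n_{\mathcal D}\subset\mathbb R^2$ be the set of all pairs $\xi$ that occur; the spherical function with eigenvalues $\xi\in\Sigma^n_{\mathcal D}$ is denoted by $\Phi_\xi$. The spherical transform of $F\in\mathcal S(\mathbb C^2,\mathrm{End}(V_n))^K$ is the function on $\Sigma^n_{\mathcal D}$ $$\mathcal G_nF(\xi)=\frac1{n+1}\int_{\mathbb C^2}\mathrm{tr}\big(F(z)\Phi_\xi(-z)\big)\,dz .$$ For Schwartz functions $f$ on $\mathbb C^2$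 with values in $\mathrm{End}(V_n)$ (with its Hilbert--Schmidt norm), or on $\mathbb R^2$ with values in $\mathbb C$, and for $M\in\mathbb N$, put $$\|f\|_{(M)}=\max_{0\le q\le M}\big\|(1+|\cdot|^2)^M\Delta^qf\big\|_{L^2},$$ where $\Delta$ is minus the Euclidean Laplacian of $\mathbb C^2=\mathbb R^4$, respectively of $\mathbb R^2$. **Proposition.** For every $M\in\mathbb N$ there exist $N_M,Q_M\in\mathbb N$ and a constant $A_M$ such that, for every $n\ge0$ and every $g\in\mathcal S(\mathbb R^2)$, there is exactly one $F\in\mathcal S(\mathbb C^2,\mathrm{End}(V_n))^K$ with $\mathcal G_nF=g|_{\Sigma^n_{\mathcal D}}$, denoted by $\mathcal G_n^{-1}(g|_{\Sigma^n_{\mathcal D}})$, and $$\big\|\mathcal G_n^{-1}(g|_{\Sigma^n_{\mathcal D}})\big\|_{(M)}\le A_M\,(n+1)^{Q_M}\,\|g\|_{(N_M)} .$$ -/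

import Mathlib

open MeasureTheory
open scoped SchwartzMap ContDiff Matrix Laplacian

-- The norm on matrices is the Hilbert-Schmidt (Frobenius) norm.
attribute [local instance] Matrix.frobeniusNormedAddCommGroup Matrix.frobeniusNormedSpace

namespace MotionGroup

/-- The space `ℂ²`, with its Hermitian norm and Lebesgue measure. -/
abbrev C2 : Type := EuclideanSpace ℂ (Fin 2)

/-- The space `ℝ²`, with its Euclidean norm. -/
abbrev R2 : Type := EuclideanSpace ℝ (Fin 2)

/-- The group `K = U₂`. -/
abbrev U2 : Type := Matrix.unitaryGroup (Fin 2) ℂ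

/-- `End(Vₙ)`, where `Vₙ` is the space of homogeneous polynomials of degree `n` on `ℂ²`, written
in matrix form with respect to the orthonormal basis `basisVec n 0, …, basisVec n n` of `Vₙ`. -/
abbrev EndV (n : ℕ) : Type := Matrix (Fin (n + 1)) (Fin (n + 1)) ℂ

/-- The natural action of `U₂` on `ℂ²`. -/
noncomputable def act (k : U2) (z : C2) : C2 := WithLp.toLp 2 ((k : Matrix (Fin 2) (Fin 2) ℂ) *ᵥ z.ofLp)

/-! ### The irreducible representations -/

/-- The exponent of the monomial `z₁ʲ z₂ⁿ⁻ʲ`. -/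
noncomputable def expo (n : ℕ) (j : Fin (n + 1)) : Fin 2 →₀ ℕ :=
  Finsupp.single 0 (j : ℕ) + Finsupp.single 1 (n - (j : ℕ))

/-- The normalized monomial `eₙʲ(z) = (n choose j)^{1/2} z₁ʲ z₂ⁿ⁻ʲ`; for `j = 0, …, n` these form
an orthonormal basis of `Vₙ` for the `U₂`-invariant Fischer inner product. -/
noncomputable def basisVec (n : ℕ) (j : Fin (n + 1)) : MvPolynomial (Fin 2) ℂ :=
  MvPolynomial.monomial (expo n j) ((√(n.choose j : ℝ) : ℝ) : ℂ)

/-- The matrix, in the basis `basisVec n`, of a map of polynomials that is linear and preserves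
`Vₙ`: the `(i, j)` entry is the `i`-th coordinate of the image of the `j`-th basis vector. -/
noncomputable def toMat (n : ℕ) (L : MvPolynomial (Fin 2) ℂ → MvPolynomial (Fin 2) ℂ) : EndV n :=
  Matrix.of fun i j => (L (basisVec n j)).coeff (expo n i) / ((√(n.choose i : ℝ) : ℝ) : ℂ)

/-- The linear forms `z ↦ (A z)ᵢ`. -/
noncomputable def linForm (A : Matrix (Fin 2) (Fin 2) ℂ) (i : Fin 2) : MvPolynomial (Fin 2) ℂ :=
  ∑ j, MvPolynomial.C (A i j) * MvPolynomial.X j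

/-- The representation `τₙ` of `U₂` on `Vₙ`: `(τₙ(k) p)(z) = p(k⁻¹ z)`. -/
noncomputable def tau (n : ℕ) (k : U2) : EndV n :=
  toMat n fun p => MvPolynomial.aeval (linForm ((k⁻¹ : U2) : Matrix (Fin 2) (Fin 2) ℂ)) p

/-- The derived representation `dτₙ` on `Vₙ`:
`(dτₙ(X) p)(z) = d/dt p(exp(-tX) z) at t = 0`, that is `-∑ᵢ (X z)ᵢ ∂p/∂zᵢ`. -/
noncomputable def dtau (n : ℕ) (X : Matrix (Fin 2) (Fin 2) ℂ) : EndV n :=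
  toMat n fun p => -∑ i, linForm X i * MvPolynomial.pderiv i p

/-- The first element of the basis `X₁, X₂, X₃` of `su₂`. -/
noncomputable def X₁ : Matrix (Fin 2) (Fin 2) ℂ := !![Complex.I, 0; 0, -Complex.I]

/-- The second element of the basis of `su₂`. -/
noncomputable def X₂ : Matrix (Fin 2) (Fin 2) ℂ := !![0, 1; -1, 0]

/-- The third element of the basis of `su₂`. -/
noncomputable def X₃ : Matrix (Fin 2) (Fin 2) ℂ := !![0, Complex.I; Complex.I, 0]

/-- An `End(Vₙ)`-valued function is `K`-equivariant if `F(kz) = τₙ(k) F(z) τₙ(k)⁻¹`, `k ∈ U₂`. -/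
def IsEquivariant (n : ℕ) (F : C2 → EndV n) : Prop :=
  ∀ (k : U2) (z : C2), F (act k z) = tau n k * F z * tau n k⁻¹

/-- The space `𝓢(ℂ², End(Vₙ))ᴷ` of `K`-equivariant Schwartz functions. -/
abbrev EquivSchwartz (n : ℕ) : Type := {F : 𝓢(C2, EndV n) // IsEquivariant n F}

/-! ### Differential operators -/

/-- The Wirtinger derivative `∂/∂zⱼ = (∂/∂xⱼ - i ∂/∂yⱼ)/2`. -/
noncomputable def dz {n : ℕ} (j : Fin 2) (F : C2 → EndV n) (z : C2) : EndV n :=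
  (1 / 2 : ℂ) • (fderiv ℝ F z (EuclideanSpace.single j 1)
    - Complex.I • fderiv ℝ F z (EuclideanSpace.single j Complex.I))

/-- The Wirtinger derivative `∂/∂z̄ⱼ = (∂/∂xⱼ + i ∂/∂yⱼ)/2`. -/
noncomputable def dzbar {n : ℕ} (j : Fin 2) (F : C2 → EndV n) (z : C2) : EndV n :=
  (1 / 2 : ℂ) • (fderiv ℝ F z (EuclideanSpace.single j 1)
    + Complex.I • fderiv ℝ F z (EuclideanSpace.single j Complex.I))

/-- The nonnegative Laplacian `Δ_{zⱼ} = -4 ∂_{zⱼ} ∂_{z̄ⱼ}` in the single variable `zⱼ`. -/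
noncomputable def lapz {n : ℕ} (j : Fin 2) (F : C2 → EndV n) (z : C2) : EndV n :=
  (-4 : ℂ) • dz j (dzbar j F) z

/-- The nonnegative Laplacian: minus the sum of the second derivatives along an orthonormal
basis of the real Euclidean space `E`. -/
noncomputable def posLap {E W : Type*} [NormedAddCommGroup E] [InnerProductSpace ℝ E]
    [FiniteDimensional ℝ E] [NormedAddCommGroup W] [NormedSpace ℝ W] (f : E → W) (x : E) : W :=
  -(Δ f) x

/-- The operator
`𝐃ₙ = i(Δ_{z₂} - Δ_{z₁}) ⊗ dτₙ(X₁) - 4(∂_{z̄₁}∂_{z₂} - ∂_{z₁}∂_{z̄₂}) ⊗ dτₙ(X₂)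
  + 4i(∂_{z₁}∂_{z̄₂} + ∂_{z̄₁}∂_{z₂}) ⊗ dτₙ(X₃)`. -/
noncomputable def opD (n : ℕ) (F : C2 → EndV n) (z : C2) : EndV n :=
  Complex.I • (dtau n X₁ * (lapz 1 F z - lapz 0 F z))
    - (4 : ℂ) • (dtau n X₂ * (dzbar 0 (dz 1 F) z - dz 0 (dzbar 1 F) z))
    + (4 * Complex.I) • (dtau n X₃ * (dz 0 (dzbar 1 F) z + dzbar 0 (dz 1 F) z))

/-! ### Spherical functions, embedded spectrum, spherical transform -/

/-- `Φ` is a bounded `End(Vₙ)`-valued spherical function with eigenvalues `ξ = (ξ₁, ξ₂)`: a bounded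
smooth `K`-equivariant function with `Φ(0) = I`, `Δ_z Φ = ξ₁ Φ` and `𝐃ₙ Φ = ξ₂ Φ`. -/
structure IsBoundedSpherical (n : ℕ) (ξ : R2) (Φ : C2 → EndV n) : Prop where
  smooth : ContDiff ℝ ∞ Φ
  bounded : ∃ C : ℝ, ∀ z, ‖Φ z‖ ≤ C
  equivariant : IsEquivariant n Φ
  normalized : Φ 0 = 1
  eigen_lap : ∀ z, posLap Φ z = ξ 0 • Φ z
  eigen_opD : ∀ z, opD n Φ z = ξ 1 • Φ z

/-- The embedded spectrum `Σⁿ_𝓓 ⊂ ℝ²`: the pairs of eigenvalues of the bounded spherical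
functions. -/
def spectrumD (n : ℕ) : Set R2 := {ξ | ∃ Φ, IsBoundedSpherical n ξ Φ}

/-- The spherical transform of `F` at the spherical function `Φ`:
`(n+1)⁻¹ ∫ tr(F(z) Φ(-z)) dz`. -/
noncomputable def sphericalTransform (n : ℕ) (F Φ : C2 → EndV n) : ℂ :=
  (1 / ((n : ℂ) + 1)) * ∫ z, (F z * Φ (-z)).trace

/-- `𝒢ₙ F = u`, where the spherical transform `𝒢ₙ F` is regarded as a function on the embedded
spectrum: its value at `ξ ∈ Σⁿ_𝓓` is the transform of `F` at the bounded spherical function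
with eigenvalues `ξ`. -/
def HasSphericalTransform (n : ℕ) (F : C2 → EndV n) (u : spectrumD n → ℂ) : Prop :=
  ∀ (ξ : spectrumD n) (Φ : C2 → EndV n), IsBoundedSpherical n ξ Φ →
    sphericalTransform n F Φ = u ξ

/-! ### Schwartz norms -/

/-- The Schwartz norms `‖f‖_(M) = max_{0 ≤ q ≤ M} ‖(1 + |·|²)ᴹ Δ^q f‖_{L²}`. For `W = EndV n` the
pointwise norm is the Hilbert-Schmidt norm. -/
noncomputable def schwartzNorm {E W : Type*} [NormedAddCommGroup E] [InnerProductSpace ℝ E]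
    [FiniteDimensional ℝ E] [MeasurableSpace E] [BorelSpace E] [NormedAddCommGroup W]
    [NormedSpace ℝ W] (M : ℕ) (f : 𝓢(E, W)) : ℝ :=
  (Finset.range (M + 1)).sup' Finset.nonempty_range_add_one fun q =>
    √(∫ x, ((1 + ‖x‖ ^ 2) ^ M * ‖(posLap^[q] f) x‖) ^ 2)

end MotionGroup

/-!
The matrix-valued symbols of `Δ_z` and `𝐃ₙ` at `w ∈ ℂ²` are `4π²|w|²` and `4π² dτₙ(2ww* - |w|²)`.
They are commuting Hermitian matrices, and at `w = k (r, 0)`, `k ∈ U₂`, they are diagonal in the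
basis of `Vₙ` translated by `k`, with the pairs of eigenvalues `spec n r j`, `0 ≤ j ≤ n`. The inverse
transform of `g` is the inverse Fourier transform `invTransform n g` of
`w ↦ g(σ(Δ_z)(w), σ(𝐃ₙ)(w))`, a joint functional calculus that makes sense for every `n` and that is
written as `symCalc n g w = ∫ 𝓕g(τ) exp(2πi(τ₀ σ(Δ_z)(w) + τ₁ σ(𝐃ₙ)(w))) dτ`.

*Estimate.* The exponentials are unitary, and Duhamel's formula bounds their derivatives in `w` by
polynomials in `n`, `|τ|`, `|w|` (`polyBounded_expGen`). Since multiplication of `g` by the first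
coordinate is multiplication of `symCalc n g` by `4π²|w|²`, decay in `w` can be bought at the expense
of `g` (`exists_decay_symCalc`). This makes `symCalc n g` a Schwartz function whose seminorms are
bounded by a power of `n + 1` times moments of `𝓕g`, hence by the norms `‖g‖_(N)`
(`exists_fourierMoment_iterate_le`). The Laplacian of `invTransform n g` is again an inverse
transform, so that decay estimates for `invTransform` are enough
(`exists_schwartzNorm_invTransform_le`).

*Existence.* Let `Φ` be a bounded spherical function with eigenvalues `ξ`. The functional
`g ↦ ∫ tr(invTransform n g · Φ)` takes `xᵢ g` to `ξᵢ` times its value at `g`, by an integration by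
parts; by Hadamard's lemma it is therefore a multiple of the evaluation at `ξ` (`pairing_eq_mul`). The
constant is found by dilation, from `Φ(0) = I` (`pairing_eq`). No classification of the bounded
spherical functions is needed.

*Uniqueness.* If `F` is equivariant, so is `𝓕F`, and `𝓕F(r, 0)` commutes with the stabilizer of
`(r, 0)` in `U₂`, hence is diagonal. Its `j`-th diagonal entry is the spherical transform of `F` at a
bounded spherical function that is a superposition of the plane waves with frequencies on the sphere
of radius `r`, the coefficients being multiples of spectral projections of the symbol of `𝐃ₙ`
(`isBoundedSpherical_waveIntegral`, `sphericalTransform_waveIntegral`). If the spherical transform of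
`F` vanishes, so does `𝓕F` (`eq_zero_of_sphericalTransform`).
-/

attribute [local instance] Matrix.frobeniusNormedRing Matrix.frobeniusNormedAlgebra
set_option maxSynthPendingDepth 3

namespace MotionGroup

open scoped FourierTransform

/-! ### The representations `τₙ` -/

/-- The coordinates of a polynomial in the basis `basisVec n`. -/
noncomputable def coords (n : ℕ) (p : MvPolynomial (Fin 2) ℂ) (i : Fin (n + 1)) : ℂ :=
  p.coeff (expo n i) / ((√(n.choose i : ℝ) : ℝ) : ℂ)

lemma sqrt_choose_ne_zero (n : ℕ) (i : Fin (n + 1)) : ((√(n.choose i : ℝ) : ℝ) : ℂ) ≠ 0 := by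
  have : 0 < n.choose i := Nat.choose_pos (Nat.lt_succ_iff.mp i.2)
  have : (0 : ℝ) < √(n.choose i : ℝ) := Real.sqrt_pos.mpr (by exact_mod_cast this)
  exact_mod_cast this.ne'

lemma sqrt_choose_mul_self (n : ℕ) (i : Fin (n + 1)) :
    ((√(n.choose i : ℝ) : ℝ) : ℂ) * ((√(n.choose i : ℝ) : ℝ) : ℂ) = (n.choose i : ℂ) := by
  rw [← Complex.ofReal_mul, Real.mul_self_sqrt (Nat.cast_nonneg _)]; simp

lemma expo_injective (n : ℕ) : Function.Injective (expo n) := by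
  intro i j h
  have := DFunLike.congr_fun h 0
  simp [expo] at this
  exact Fin.ext this

lemma exists_expo_eq {n : ℕ} {d : Fin 2 →₀ ℕ} (hd : d.degree = n) : ∃ i, expo n i = d := by
  have h : d 0 + d 1 = n := by rw [← hd, Finsupp.degree_eq_sum]; simp
  refine ⟨⟨d 0, by omega⟩, ?_⟩
  ext i
  fin_cases i
  · simp [expo]
  · simp [expo]; omega

lemma coords_basisVec (n : ℕ) (j : Fin (n + 1)) : coords n (basisVec n j) = Pi.single j 1 := by
  ext i
  by_cases h : i = j
  · subst h
    simp only [coords, basisVec, MvPolynomial.coeff_monomial, if_true, Pi.single_eq_same]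
    exact div_self (sqrt_choose_ne_zero n i)
  · have : expo n j ≠ expo n i := fun h' => h (expo_injective n h').symm
    simp [coords, basisVec, MvPolynomial.coeff_monomial, this, h]

lemma isHomogeneous_basisVec (n : ℕ) (j : Fin (n + 1)) : (basisVec n j).IsHomogeneous n := by
  refine MvPolynomial.isHomogeneous_monomial _ ?_
  rw [Finsupp.degree_eq_sum]
  simp [expo]; omega

lemma sum_coords_smul_basisVec {n : ℕ} {p : MvPolynomial (Fin 2) ℂ} (hp : p.IsHomogeneous n) :
    ∑ j, coords n p j • basisVec n j = p := by
  ext d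
  rw [MvPolynomial.coeff_sum]
  by_cases hd : d.degree = n
  · obtain ⟨i, rfl⟩ := exists_expo_eq hd
    rw [Finset.sum_eq_single i]
    · simp [coords, basisVec, div_mul_cancel₀ _ (sqrt_choose_ne_zero n i)]
    · intro j _ hj
      have : expo n j ≠ expo n i := fun h' => hj (expo_injective n h')
      simp [basisVec, MvPolynomial.coeff_monomial, this]
    · simp
  · rw [hp.coeff_eq_zero hd]
    refine Finset.sum_eq_zero fun j _ => ?_
    rw [MvPolynomial.coeff_smul, (isHomogeneous_basisVec n j).coeff_eq_zero hd, smul_zero]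

/-- `toMat n L` is the matrix of `L` on homogeneous polynomials of degree `n`. -/
lemma toMat_mulVec_coords {n : ℕ} (L : MvPolynomial (Fin 2) ℂ →ₗ[ℂ] MvPolynomial (Fin 2) ℂ)
    {p : MvPolynomial (Fin 2) ℂ} (hp : p.IsHomogeneous n) :
    toMat n L *ᵥ coords n p = coords n (L p) := by
  ext i
  conv_rhs => rw [← sum_coords_smul_basisVec hp]
  simp only [map_sum, map_smul, coords, MvPolynomial.coeff_sum, MvPolynomial.coeff_smul,
    Matrix.mulVec, dotProduct, toMat, Matrix.of_apply, Finset.sum_div, smul_eq_mul]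
  exact Finset.sum_congr rfl fun j _ => by ring

/-- The linear form `z ↦ b₀ z₁ + b₁ z₂`. -/
noncomputable def lform (b : Fin 2 → ℂ) : MvPolynomial (Fin 2) ℂ :=
  ∑ j, MvPolynomial.C (b j) * MvPolynomial.X j

lemma isHomogeneous_lform (b : Fin 2 → ℂ) : (lform b).IsHomogeneous 1 := by
  refine MvPolynomial.IsHomogeneous.sum _ _ _ fun j _ => ?_
  simpa using (MvPolynomial.isHomogeneous_C (Fin 2) (b j)).mul (MvPolynomial.isHomogeneous_X ℂ j)

lemma isHomogeneous_lform_pow (n : ℕ) (b : Fin 2 → ℂ) : (lform b ^ n).IsHomogeneous n := by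
  simpa using (isHomogeneous_lform b).pow n

/-- The coordinates of the `n`-th power of a linear form. -/
noncomputable def powVec (n : ℕ) (b : Fin 2 → ℂ) (j : Fin (n + 1)) : ℂ :=
  ((√(n.choose j : ℝ) : ℝ) : ℂ) * (b 0 ^ (j : ℕ) * b 1 ^ (n - (j : ℕ)))

lemma lform_pow (n : ℕ) (b : Fin 2 → ℂ) : lform b ^ n = ∑ j, powVec n b j • basisVec n j := by
  rw [lform, Fin.sum_univ_two, add_pow, ← Fin.sum_univ_eq_sum_range
    (fun m => (MvPolynomial.C (b 0) * MvPolynomial.X 0) ^ m *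
      (MvPolynomial.C (b 1) * MvPolynomial.X 1) ^ (n - m) *
        ((n.choose m : ℕ) : MvPolynomial (Fin 2) ℂ))]
  refine Finset.sum_congr rfl fun j _ => ?_
  have h1 : basisVec n j = MvPolynomial.C ((√(n.choose j : ℝ) : ℝ) : ℂ) *
      (MvPolynomial.X 0 ^ (j : ℕ) * MvPolynomial.X 1 ^ (n - (j : ℕ))) := by
    rw [basisVec, expo, MvPolynomial.X_pow_eq_monomial, MvPolynomial.X_pow_eq_monomial,
      MvPolynomial.monomial_mul, MvPolynomial.C_mul_monomial]
    simp
  rw [h1, powVec, MvPolynomial.smul_eq_C_mul, ← map_natCast (MvPolynomial.C (σ := Fin 2) (R := ℂ)),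
    ← sqrt_choose_mul_self]
  simp only [map_mul, map_pow]
  ring

lemma coords_sum_smul (n : ℕ) (c : Fin (n + 1) → ℂ) :
    coords n (∑ j, c j • basisVec n j) = c := by
  ext i
  have : ∀ j, coords n (c j • basisVec n j) i = c j * (Pi.single j (1 : ℂ) : Fin (n + 1) → ℂ) i := by
    intro j
    rw [← coords_basisVec]
    simp [coords, mul_div_assoc]
  have h2 : coords n (∑ j, c j • basisVec n j) i = ∑ j, coords n (c j • basisVec n j) i := by
    simp [coords, MvPolynomial.coeff_sum, Finset.sum_div]
  rw [h2]
  simp [this, Pi.single_apply]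

lemma coords_lform_pow (n : ℕ) (b : Fin 2 → ℂ) : coords n (lform b ^ n) = powVec n b := by
  rw [lform_pow, coords_sum_smul]

/-- Powers of linear forms span `Vₙ`. -/
lemma eq_zero_of_dotProduct_powVec {n : ℕ} {x : Fin (n + 1) → ℂ} (h : ∀ b, x ⬝ᵥ powVec n b = 0) :
    x = 0 := by
  let p : Polynomial ℂ := ∑ j : Fin (n + 1),
    Polynomial.monomial (j : ℕ) (x j * ((√(n.choose j : ℝ) : ℝ) : ℂ))
  have hp : p = 0 := by
    refine Polynomial.funext fun t => ?_
    have := h ![t, 1]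
    simp only [dotProduct, powVec] at this
    simp only [p, Polynomial.eval_finsetSum, Polynomial.eval_monomial, Polynomial.eval_zero]
    rw [← this]
    exact Finset.sum_congr rfl fun j _ => by simp; ring
  ext j
  have h2 : p.coeff j = x j * ((√(n.choose j : ℝ) : ℝ) : ℂ) := by
    simp only [p, Polynomial.finsetSum_coeff, Polynomial.coeff_monomial]
    rw [Finset.sum_eq_single j]
    · simp
    · intro i _ hi
      rw [if_neg]
      exact fun h => hi (Fin.ext h)
    · simp
  rw [hp, Polynomial.coeff_zero] at h2
  exact (mul_eq_zero.mp h2.symm).resolve_right (sqrt_choose_ne_zero n j)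

/-- Operators on `Vₙ` that agree on powers of linear forms are equal. -/
lemma eq_of_mulVec_powVec {n : ℕ} {A B : EndV n} (h : ∀ b, A *ᵥ powVec n b = B *ᵥ powVec n b) :
    A = B := by
  ext i j
  have : A i - B i = 0 := by
    refine eq_zero_of_dotProduct_powVec fun b => ?_
    have := congrFun (h b) i
    simp only [Matrix.mulVec] at this
    rw [sub_dotProduct, this, sub_self]
  exact congrFun (sub_eq_zero.mp this) j

/-- The matrix of the substitution `p ↦ p(A z)` on `Vₙ`. -/
noncomputable def substMat (n : ℕ) (A : Matrix (Fin 2) (Fin 2) ℂ) : EndV n :=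
  toMat n fun p => MvPolynomial.aeval (linForm A) p

lemma tau_eq_substMat (n : ℕ) (k : U2) :
    tau n k = substMat n ((k⁻¹ : U2) : Matrix (Fin 2) (Fin 2) ℂ) := rfl

lemma aeval_linForm_lform (A : Matrix (Fin 2) (Fin 2) ℂ) (b : Fin 2 → ℂ) :
    MvPolynomial.aeval (linForm A) (lform b) = lform (b ᵥ* A) := by
  simp only [lform, linForm, Matrix.vecMul, dotProduct, Fin.sum_univ_two, map_add, map_mul,
    MvPolynomial.aeval_X, MvPolynomial.algHom_C, MvPolynomial.algebraMap_eq]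
  ring

lemma substMat_mulVec_coords {n : ℕ} (A : Matrix (Fin 2) (Fin 2) ℂ) {p : MvPolynomial (Fin 2) ℂ}
    (hp : p.IsHomogeneous n) :
    substMat n A *ᵥ coords n p = coords n (MvPolynomial.aeval (linForm A) p) :=
  toMat_mulVec_coords (MvPolynomial.aeval (linForm A)).toLinearMap hp

lemma substMat_mulVec (n : ℕ) (A : Matrix (Fin 2) (Fin 2) ℂ) (b : Fin 2 → ℂ) :
    substMat n A *ᵥ powVec n b = powVec n (b ᵥ* A) := by
  rw [← coords_lform_pow, substMat_mulVec_coords A (isHomogeneous_lform_pow n b), map_pow,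
    aeval_linForm_lform, coords_lform_pow]

lemma substMat_mul (n : ℕ) (A B : Matrix (Fin 2) (Fin 2) ℂ) :
    substMat n A * substMat n B = substMat n (B * A) := by
  refine eq_of_mulVec_powVec fun b => ?_
  rw [← Matrix.mulVec_mulVec, substMat_mulVec, substMat_mulVec, substMat_mulVec,
    Matrix.vecMul_vecMul]

lemma substMat_diagonal (n : ℕ) (a : Fin 2 → ℂ) :
    substMat n (Matrix.diagonal a) =
      Matrix.diagonal fun j : Fin (n + 1) => a 0 ^ (j : ℕ) * a 1 ^ (n - (j : ℕ)) := by
  refine eq_of_mulVec_powVec fun b => ?_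
  rw [substMat_mulVec]
  ext j
  simp [Matrix.mulVec_diagonal, powVec, Matrix.vecMul_diagonal, mul_pow]
  ring

lemma substMat_one (n : ℕ) : substMat n 1 = 1 := by
  rw [← Matrix.diagonal_one, substMat_diagonal]; simp

lemma powVec_dotProduct (n : ℕ) (a b : Fin 2 → ℂ) : powVec n a ⬝ᵥ powVec n b = (a ⬝ᵥ b) ^ n := by
  rw [dotProduct, dotProduct, Fin.sum_univ_two, add_pow, ← Fin.sum_univ_eq_sum_range
    (fun m => (a 0 * b 0) ^ m * (a 1 * b 1) ^ (n - m) * ((n.choose m : ℕ) : ℂ))]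
  refine Finset.sum_congr rfl fun j _ => ?_
  rw [← sqrt_choose_mul_self, powVec, powVec]
  ring

lemma substMat_transpose (n : ℕ) (A : Matrix (Fin 2) (Fin 2) ℂ) :
    (substMat n A)ᵀ = substMat n Aᵀ := by
  refine eq_of_mulVec_powVec fun b => ?_
  rw [← sub_eq_zero]
  refine eq_zero_of_dotProduct_powVec fun a => ?_
  rw [sub_dotProduct, sub_eq_zero, Matrix.mulVec_transpose, ← Matrix.dotProduct_mulVec,
    substMat_mulVec, substMat_mulVec, powVec_dotProduct, powVec_dotProduct, Matrix.vecMul_transpose,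
    ← Matrix.mulVec_transpose, dotProduct_comm b, Matrix.mulVec_transpose, dotProduct_comm _ a,
    Matrix.dotProduct_mulVec]

lemma star_powVec (n : ℕ) (b : Fin 2 → ℂ) : star (powVec n b) = powVec n (star b) := by
  ext j
  simp [powVec]

lemma substMat_map_star (n : ℕ) (A : Matrix (Fin 2) (Fin 2) ℂ) :
    (substMat n A).map star = substMat n (A.map star) := by
  have key : ∀ {m : ℕ} (X : Matrix (Fin m) (Fin m) ℂ) (v : Fin m → ℂ),
      X.map star *ᵥ v = star (X *ᵥ star v) := by
    intro m X v
    ext i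
    simp [Matrix.mulVec, dotProduct]
  refine eq_of_mulVec_powVec fun b => ?_
  rw [key, star_powVec, substMat_mulVec, star_powVec, substMat_mulVec]
  congr 1
  ext i
  simp [Matrix.vecMul, dotProduct]

lemma substMat_conjTranspose (n : ℕ) (A : Matrix (Fin 2) (Fin 2) ℂ) :
    (substMat n A)ᴴ = substMat n Aᴴ := by
  rw [Matrix.conjTranspose, substMat_transpose, substMat_map_star]; rfl

lemma tau_mul (n : ℕ) (k l : U2) : tau n (k * l) = tau n k * tau n l := by
  simp only [tau_eq_substMat, substMat_mul, mul_inv_rev]; rfl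

lemma tau_one (n : ℕ) : tau n 1 = 1 := by
  rw [tau_eq_substMat, inv_one]; exact substMat_one n

lemma tau_mul_tau_inv (n : ℕ) (k : U2) : tau n k * tau n k⁻¹ = 1 := by
  rw [← tau_mul, mul_inv_cancel, tau_one]

lemma tau_inv_mul_tau (n : ℕ) (k : U2) : tau n k⁻¹ * tau n k = 1 := by
  rw [← tau_mul, inv_mul_cancel, tau_one]

lemma tau_conj_mul {n : ℕ} (k : U2) (D E : EndV n) :
    tau n k * D * tau n k⁻¹ * (tau n k * E * tau n k⁻¹) = tau n k * (D * E) * tau n k⁻¹ := by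
  calc _ = tau n k * D * (tau n k⁻¹ * tau n k) * E * tau n k⁻¹ := by simp only [mul_assoc]
    _ = _ := by rw [tau_inv_mul_tau, mul_one]; simp only [mul_assoc]

/-- The representation `τₙ` is unitary. -/
lemma tau_conjTranspose (n : ℕ) (k : U2) : (tau n k)ᴴ = tau n k⁻¹ := by
  rw [tau_eq_substMat, tau_eq_substMat, substMat_conjTranspose]; rfl

lemma tau_mem_unitary (n : ℕ) (k : U2) : tau n k ∈ Matrix.unitaryGroup (Fin (n + 1)) ℂ := by
  rw [Matrix.mem_unitaryGroup_iff, Matrix.star_eq_conjTranspose, tau_conjTranspose, tau_mul_tau_inv]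

/-! ### The derived representation -/

/-- The vector field `-∑ᵢ (X z)ᵢ ∂/∂zᵢ` as a linear map of polynomials. -/
noncomputable def vectorField (X : Matrix (Fin 2) (Fin 2) ℂ) :
    MvPolynomial (Fin 2) ℂ →ₗ[ℂ] MvPolynomial (Fin 2) ℂ :=
  -∑ i, LinearMap.mulLeft ℂ (linForm X i) ∘ₗ (MvPolynomial.pderiv i).toLinearMap

lemma vectorField_apply (X : Matrix (Fin 2) (Fin 2) ℂ) (p : MvPolynomial (Fin 2) ℂ) :
    vectorField X p = -∑ i, linForm X i * MvPolynomial.pderiv i p := by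
  simp [vectorField]

lemma dtau_eq (n : ℕ) (X : Matrix (Fin 2) (Fin 2) ℂ) : dtau n X = toMat n (vectorField X) := by
  unfold dtau; congr 1

lemma vectorField_lform_pow (X : Matrix (Fin 2) (Fin 2) ℂ) (n : ℕ) (b : Fin 2 → ℂ) :
    vectorField X (lform b ^ n) = -(n • (lform (b ᵥ* X) * lform b ^ (n - 1))) := by
  have h : ∀ i, MvPolynomial.pderiv i (lform b) = MvPolynomial.C (b i) := by
    intro i
    simp only [lform, Fin.sum_univ_two]
    fin_cases i <;> simp [MvPolynomial.pderiv_X]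
  have h2 : lform (b ᵥ* X) = ∑ i, linForm X i * MvPolynomial.C (b i) := by
    simp only [lform, linForm, Matrix.vecMul, dotProduct, Fin.sum_univ_two, map_add, map_mul]
    ring
  rw [vectorField_apply, h2, Finset.sum_mul, Finset.smul_sum]
  congr 1
  refine Finset.sum_congr rfl fun i _ => ?_
  rw [Derivation.leibniz_pow, h]
  simp only [nsmul_eq_mul, smul_eq_mul]
  ring

lemma dtau_mulVec (n : ℕ) (X : Matrix (Fin 2) (Fin 2) ℂ) (b : Fin 2 → ℂ) :
    dtau n X *ᵥ powVec n b = coords n (-(n • (lform (b ᵥ* X) * lform b ^ (n - 1)))) := by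
  rw [dtau_eq, ← coords_lform_pow, toMat_mulVec_coords _ (isHomogeneous_lform_pow n b),
    vectorField_lform_pow]

lemma isHomogeneous_smul_lform_mul (n : ℕ) (b c : Fin 2 → ℂ) :
    (-(n • (lform c * lform b ^ (n - 1)))).IsHomogeneous n := by
  rcases n with _ | n
  · simpa using MvPolynomial.isHomogeneous_zero (Fin 2) ℂ 0
  · have := (isHomogeneous_lform c).mul (isHomogeneous_lform_pow n b)
    rw [add_comm] at this
    have h2 := ((MvPolynomial.isHomogeneous_C (Fin 2) (-((n + 1 : ℕ) : ℂ))).mul this)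
    rw [zero_add] at h2
    convert h2 using 1
    simp only [nsmul_eq_mul, map_neg, map_natCast, neg_mul, Nat.add_sub_cancel]

lemma substMat_mul_dtau (n : ℕ) (A X Y : Matrix (Fin 2) (Fin 2) ℂ) (h : X * A = A * Y) :
    substMat n A * dtau n X = dtau n Y * substMat n A := by
  refine eq_of_mulVec_powVec fun b => ?_
  rw [← Matrix.mulVec_mulVec, ← Matrix.mulVec_mulVec, dtau_mulVec, substMat_mulVec, dtau_mulVec,
    substMat_mulVec_coords _ (isHomogeneous_smul_lform_mul n b _), map_neg, map_nsmul, map_mul,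
    map_pow, aeval_linForm_lform, aeval_linForm_lform, Matrix.vecMul_vecMul, Matrix.vecMul_vecMul, h]

/-- `dτₙ(k X k⁻¹) = τₙ(k) dτₙ(X) τₙ(k)⁻¹`. -/
lemma dtau_conj (n : ℕ) (k : U2) (X : Matrix (Fin 2) (Fin 2) ℂ) :
    dtau n ((k : Matrix (Fin 2) (Fin 2) ℂ) * X * ((k⁻¹ : U2) : Matrix (Fin 2) (Fin 2) ℂ)) =
      tau n k * dtau n X * tau n k⁻¹ := by
  have h1 : ((k⁻¹ : U2) : Matrix (Fin 2) (Fin 2) ℂ) * (k : Matrix (Fin 2) (Fin 2) ℂ) = 1 := by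
    exact congrArg (Subtype.val) (inv_mul_cancel k)
  have := substMat_mul_dtau n ((k⁻¹ : U2) : Matrix (Fin 2) (Fin 2) ℂ) X
    ((k : Matrix (Fin 2) (Fin 2) ℂ) * X * ((k⁻¹ : U2) : Matrix (Fin 2) (Fin 2) ℂ))
    (by rw [mul_assoc (k : Matrix (Fin 2) (Fin 2) ℂ), ← mul_assoc, h1, one_mul])
  rw [tau_eq_substMat n k, this, ← tau_eq_substMat, mul_assoc _ (tau n k), tau_mul_tau_inv, mul_one]

lemma dtau_add (n : ℕ) (X Y : Matrix (Fin 2) (Fin 2) ℂ) : dtau n (X + Y) = dtau n X + dtau n Y := by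
  ext i j
  simp only [dtau, toMat, linForm, Fin.sum_univ_two, Matrix.of_apply, Matrix.add_apply, map_add]
  rw [← add_div, ← MvPolynomial.coeff_add]
  congr 2; ring

lemma dtau_smul (n : ℕ) (c : ℂ) (X : Matrix (Fin 2) (Fin 2) ℂ) : dtau n (c • X) = c • dtau n X := by
  ext i j
  simp only [dtau, toMat, linForm, Fin.sum_univ_two, Matrix.of_apply, Matrix.smul_apply, smul_eq_mul,
    map_mul, ← mul_div_assoc]
  rw [← MvPolynomial.coeff_C_mul]
  congr 2; ring

lemma dtau_diagonal (n : ℕ) :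
    dtau n !![1, 0; 0, -1] = Matrix.diagonal fun j : Fin (n + 1) => (n : ℂ) - 2 * (j : ℕ) := by
  ext i j
  have h : vectorField !![1, 0; 0, -1] (basisVec n j) =
      ((n : ℂ) - 2 * (j : ℕ)) • basisVec n j := by
    rw [vectorField_apply, Fin.sum_univ_two, linForm, linForm]
    simp only [Fin.sum_univ_two, Matrix.of_apply, Matrix.cons_val', Matrix.cons_val_zero,
      Matrix.cons_val_one, map_one, map_zero, map_neg, zero_mul, add_zero, zero_add, one_mul, neg_mul,
      basisVec, Matrix.cons_val_fin_one, MvPolynomial.X_mul_pderiv_monomial]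
    have : (j : ℕ) ≤ n := Nat.lt_succ_iff.mp j.2
    simp only [expo, Finsupp.add_apply, Finsupp.single_apply]
    simp only [MvPolynomial.smul_monomial, ← map_neg, ← map_add]
    congr 1
    simp [Nat.cast_sub this]
    ring
  rw [dtau_eq]
  have := congrFun (coords_basisVec n j) i
  simp only [coords] at this
  rw [toMat, Matrix.of_apply, h, MvPolynomial.coeff_smul, smul_eq_mul, mul_div_assoc, this]
  by_cases hij : i = j
  · subst hij; simp
  · simp [hij]

/-! ### Orbits and equivariance -/

/-- The point `(r, 0)` of `ℂ²`. -/
noncomputable def base (r : ℝ) : C2 := EuclideanSpace.single 0 (r : ℂ)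

lemma coe_mul_coe_inv (k : U2) :
    (k : Matrix (Fin 2) (Fin 2) ℂ) * ((k⁻¹ : U2) : Matrix (Fin 2) (Fin 2) ℂ) = 1 :=
  congrArg Subtype.val (mul_inv_cancel k)

lemma act_mul (k l : U2) (z : C2) : act (k * l) z = act k (act l z) := by
  simp only [act, Matrix.mulVec_mulVec]; rfl

lemma act_one (z : C2) : act 1 z = z := by
  simp [act]

lemma norm_act (k : U2) (z : C2) : ‖act k z‖ = ‖z‖ := by
  have h : ∀ x : C2, ((‖x‖ ^ 2 : ℝ) : ℂ) = star x.ofLp ⬝ᵥ x.ofLp := by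
    intro x
    rw [EuclideanSpace.norm_sq_eq]
    simp [dotProduct, Complex.conj_mul']
  have h2 : ((‖act k z‖ ^ 2 : ℝ) : ℂ) = ((‖z‖ ^ 2 : ℝ) : ℂ) := by
    rw [h, h, act]
    simp only [Matrix.star_mulVec, Matrix.dotProduct_mulVec, Matrix.vecMul_vecMul]
    have : (k : Matrix (Fin 2) (Fin 2) ℂ)ᴴ * (k : Matrix (Fin 2) (Fin 2) ℂ) = 1 :=
      Matrix.mem_unitaryGroup_iff'.mp k.2
    rw [this, Matrix.vecMul_one]
  have h3 : ‖act k z‖ ^ 2 = ‖z‖ ^ 2 := by exact_mod_cast h2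
  exact (pow_left_inj₀ (norm_nonneg _) (norm_nonneg _) two_ne_zero).mp h3

/-- The action of `k ∈ U₂` as a linear isometry of `ℂ²`. -/
noncomputable def actL (k : U2) : C2 ≃ₗᵢ[ℝ] C2 where
  toFun := act k
  invFun := act k⁻¹
  left_inv z := by rw [← act_mul, inv_mul_cancel, act_one]
  right_inv z := by rw [← act_mul, mul_inv_cancel, act_one]
  map_add' x y := by simp only [act, WithLp.ofLp_add, Matrix.mulVec_add, WithLp.toLp_add]
  map_smul' c x := by
    simp only [act, WithLp.ofLp_smul, Matrix.mulVec_smul, WithLp.toLp_smul, RingHom.id_apply]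
  norm_map' := norm_act k

@[simp] lemma actL_apply (k : U2) (z : C2) : actL k z = act k z := rfl

lemma inner_act (k : U2) (x y : C2) : inner ℝ (act k x) (act k y) = inner ℝ x y :=
  (actL k).inner_map_map x y

lemma act_smul (k : U2) (c : ℝ) (z : C2) : act k (c • z) = c • act k z := (actL k).map_smul c z

/-- Every orbit of `U₂` in `ℂ²` meets the half-line of the points `(r, 0)`, `r ≥ 0`. -/
lemma exists_act_base (w : C2) : ∃ k : U2, w = act k (base ‖w‖) := by
  rcases eq_or_ne w 0 with rfl | hw
  · exact ⟨1, by rw [act_one]; ext i; fin_cases i <;> simp [base]⟩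
  have hr : ‖w‖ ≠ 0 := norm_ne_zero_iff.mpr hw
  have hrC : ((‖w‖ : ℝ) : ℂ) ≠ 0 := by exact_mod_cast hr
  have hsq : w 0 * (starRingEnd ℂ) (w 0) + w 1 * (starRingEnd ℂ) (w 1) =
      ((‖w‖ : ℝ) : ℂ) * ((‖w‖ : ℝ) : ℂ) := by
    have := EuclideanSpace.norm_sq_eq w
    rw [Fin.sum_univ_two] at this
    rw [← Complex.ofReal_mul, ← sq, this]
    simp [Complex.mul_conj']
  let A : Matrix (Fin 2) (Fin 2) ℂ :=
    (((‖w‖ : ℝ) : ℂ)⁻¹) • !![w 0, -star (w 1); w 1, star (w 0)]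
  have hA : A ∈ Matrix.unitaryGroup (Fin 2) ℂ := by
    rw [Matrix.mem_unitaryGroup_iff']
    ext i j
    simp only [A, Matrix.star_eq_conjTranspose, Matrix.conjTranspose_smul, Matrix.smul_apply,
      Matrix.mul_apply, Fin.sum_univ_two, Matrix.conjTranspose_apply, smul_eq_mul, star_inv₀,
      Complex.star_def, Complex.conj_ofReal]
    fin_cases i <;> fin_cases j <;> simp <;> field_simp <;> first | ring1 | linear_combination hsq
  refine ⟨⟨A, hA⟩, ?_⟩
  ext i
  fin_cases i <;> simp [act, A, base] <;> field_simp

/-- The diagonal element `diag(1, e^{2πi/m})` of the stabilizer of the points `(r, 0)`. -/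
noncomputable def stab (m : ℕ) : U2 :=
  ⟨Matrix.diagonal ![1, Complex.exp (2 * Real.pi * Complex.I / m)], by
    have h : (starRingEnd ℂ) (Complex.exp (2 * Real.pi * Complex.I / m)) *
        Complex.exp (2 * Real.pi * Complex.I / m) = 1 := by
      rw [← Complex.exp_conj, ← Complex.exp_add]
      simp [Complex.conj_ofReal, neg_div, Complex.conj_ofNat]
    rw [Matrix.mem_unitaryGroup_iff', Matrix.star_eq_conjTranspose, Matrix.diagonal_conjTranspose,
      Matrix.diagonal_mul_diagonal]
    ext i j
    fin_cases i <;> fin_cases j <;> simp [h]⟩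

lemma act_stab_base (m : ℕ) (r : ℝ) : act (stab m) (base r) = base r := by
  ext i
  fin_cases i <;> simp [act, stab, base]

/-- A matrix that commutes with the stabilizer of `(r, 0)` is diagonal, since the weights of the
stabilizer on `Vₙ` are distinct. -/
lemma apply_eq_zero_of_commute {n : ℕ} {H : EndV n}
    (h : tau n (stab (n + 1)) * H = H * tau n (stab (n + 1))) {i j : Fin (n + 1)} (hij : i ≠ j) :
    H i j = 0 := by
  set ζ : ℂ := Complex.exp (2 * Real.pi * Complex.I / ((n + 1 : ℕ) : ℂ)) with hζ
  have hprim : IsPrimitiveRoot ζ (n + 1) := Complex.isPrimitiveRoot_exp (n + 1) (by omega)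
  have htau : tau n (stab (n + 1)) =
      Matrix.diagonal fun j : Fin (n + 1) => (star ζ) ^ (n - (j : ℕ)) := by
    have : ((((stab (n + 1))⁻¹ : U2)) : Matrix (Fin 2) (Fin 2) ℂ) =
        Matrix.diagonal ![1, star ζ] := by
      change (star (Matrix.diagonal ![1, ζ]) : Matrix (Fin 2) (Fin 2) ℂ) = _
      rw [Matrix.star_eq_conjTranspose, Matrix.diagonal_conjTranspose]
      congr 1
      ext i; fin_cases i <;> simp
    rw [tau_eq_substMat, this, substMat_diagonal]
    simp
  rw [htau] at h
  have h2 := congrFun (congrFun h i) j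
  rw [Matrix.diagonal_mul, Matrix.mul_diagonal, mul_comm, ← sub_eq_zero, ← mul_sub,
    ← star_pow, ← star_pow, ← star_sub] at h2
  refine (mul_eq_zero.mp h2).resolve_right fun h3 => hij ?_
  rw [star_eq_zero, sub_eq_zero] at h3
  have := hprim.pow_inj (by omega) (by omega) h3
  exact Fin.ext (by omega)

/-- Schur's lemma for `τₙ`. -/
lemma eq_smul_one_of_commute {n : ℕ} {H : EndV n} (h : ∀ k, tau n k * H = H * tau n k) :
    ∃ c : ℂ, H = c • (1 : EndV n) := by
  have hd : ∀ i j, i ≠ j → H i j = 0 := fun i j hij => apply_eq_zero_of_commute (h _) hij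
  have hsq : ((√2 : ℝ) : ℂ) * ((√2 : ℝ) : ℂ) = 2 := by
    rw [← Complex.ofReal_mul, Real.mul_self_sqrt (by norm_num)]; simp
  have hne : ((√2 : ℝ) : ℂ) ≠ 0 := by
    intro h0; rw [h0] at hsq; simp at hsq
  let A : Matrix (Fin 2) (Fin 2) ℂ := ((√2 : ℝ) : ℂ)⁻¹ • !![1, 1; -1, 1]
  have hA : A ∈ Matrix.unitaryGroup (Fin 2) ℂ := by
    rw [Matrix.mem_unitaryGroup_iff']
    ext i j
    simp only [A, Matrix.star_eq_conjTranspose, Matrix.conjTranspose_smul, Matrix.smul_apply,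
      Matrix.mul_apply, Fin.sum_univ_two, Matrix.conjTranspose_apply, smul_eq_mul, star_inv₀,
      Complex.star_def, Complex.conj_ofReal]
    fin_cases i <;> fin_cases j <;> simp <;> field_simp <;> linear_combination -hsq
  have hk := h (⟨A, hA⟩ : U2)⁻¹
  rw [tau_eq_substMat, inv_inv] at hk
  have hdiag : H = Matrix.diagonal fun i => H i i := by
    ext i j
    by_cases hij : i = j
    · subst hij; simp
    · rw [hd i j hij, Matrix.diagonal_apply_ne _ hij]
  set m : Fin (n + 1) → ℂ := fun i => H i i
  have hb : H *ᵥ powVec n ![1, 0] = m (Fin.last n) • powVec n ![1, 0] := by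
    rw [hdiag]
    ext i
    rw [Matrix.mulVec_diagonal, Pi.smul_apply, smul_eq_mul]
    by_cases hi : i = Fin.last n
    · rw [hi]
    · have : n - (i : ℕ) ≠ 0 := by
        have := i.2
        have : (i : ℕ) ≠ n := fun h => hi (Fin.ext h)
        omega
      simp [powVec, this]
  have h3 := congrArg (· *ᵥ powVec n ![1, 0]) hk
  simp only [← Matrix.mulVec_mulVec] at h3
  rw [hb, Matrix.mulVec_smul, substMat_mulVec] at h3
  refine ⟨m (Fin.last n), ?_⟩
  conv_lhs => rw [hdiag]
  rw [← Matrix.diagonal_one, ← Matrix.diagonal_smul]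
  congr 1
  ext i
  have h4 := congrFun h3 i
  conv_rhs at h4 => rw [hdiag]
  rw [Matrix.mulVec_diagonal, Pi.smul_apply, smul_eq_mul] at h4
  have h5 : powVec n (![1, 0] ᵥ* A) i ≠ 0 := by
    simp [powVec, A, Matrix.vecMul, dotProduct, Fin.sum_univ_two,
      (Nat.choose_pos (Nat.lt_succ_iff.mp i.2)).ne']
  simpa using (mul_right_cancel₀ h5 h4).symm

/-! ### Second-order operators and their symbols -/

/-- The symbol `(2πi)² ∑ₚ ⟨uₚ, w⟩ ⟨vₚ, w⟩ Aₚ` of the operator `∑ₚ Aₚ ∂_{uₚ} ∂_{vₚ}`. -/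
noncomputable def symbol {n : ℕ} {ι : Type} [Fintype ι] (A : ι → EndV n) (u v : ι → C2) (w : C2) :
    EndV n :=
  ∑ p, (-(4 * Real.pi ^ 2) * (inner ℝ (u p) w * inner ℝ (v p) w)) • A p

/-- The real basis `(1, 0), (i, 0), (0, 1), (0, i)` of `ℂ²`. -/
noncomputable def rdir : Fin 4 → C2 :=
  ![EuclideanSpace.single 0 1, EuclideanSpace.single 0 Complex.I,
    EuclideanSpace.single 1 1, EuclideanSpace.single 1 Complex.I]

/-- The matrices `i dτₙ(Xₘ)`. -/
noncomputable def hermX (n : ℕ) (X : Matrix (Fin 2) (Fin 2) ℂ) : EndV n := Complex.I • dtau n X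

/-- The coefficients of `𝐃ₙ`, written as `∑ₚ Aₚ ∂_{uₚ} ∂_{vₚ}`. -/
noncomputable def coefD (n : ℕ) : Fin 8 → EndV n :=
  ![hermX n X₁, hermX n X₁, -hermX n X₁, -hermX n X₁, (2 : ℂ) • hermX n X₂, -((2 : ℂ) • hermX n X₂),
    (2 : ℂ) • hermX n X₃, (2 : ℂ) • hermX n X₃]

/-- The first directions of differentiation in `𝐃ₙ = ∑ₚ Aₚ ∂_{uₚ} ∂_{vₚ}`. -/
noncomputable def dirD₁ : Fin 8 → C2 :=
  ![rdir 0, rdir 1, rdir 2, rdir 3, rdir 0, rdir 1, rdir 0, rdir 1]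

/-- The second directions of differentiation in `𝐃ₙ = ∑ₚ Aₚ ∂_{uₚ} ∂_{vₚ}`. -/
noncomputable def dirD₂ : Fin 8 → C2 :=
  ![rdir 0, rdir 1, rdir 2, rdir 3, rdir 3, rdir 2, rdir 2, rdir 3]

/-- The symbol of `𝐃ₙ`. -/
noncomputable def symD (n : ℕ) (w : C2) : EndV n := symbol (coefD n) dirD₁ dirD₂ w

/-- The symbol of `Δ_z`. -/
noncomputable def symL (n : ℕ) (w : C2) : EndV n :=
  symbol (fun _ : Fin 4 => -(1 : EndV n)) rdir rdir w

lemma inner_single (j : Fin 2) (c : ℂ) (w : C2) :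
    inner ℝ (EuclideanSpace.single j c : C2) w = c.re * (w j).re + c.im * (w j).im := by
  rw [PiLp.inner_apply, Finset.sum_eq_single j]
  · simp [Complex.inner, mul_comm]
  · intro i _ hi
    simp [hi]
  · simp

lemma norm_sq_C2 (w : C2) :
    ‖w‖ ^ 2 = (w 0).re ^ 2 + (w 0).im ^ 2 + ((w 1).re ^ 2 + (w 1).im ^ 2) := by
  rw [EuclideanSpace.norm_sq_eq, Fin.sum_univ_two, Complex.sq_norm, Complex.sq_norm,
    Complex.normSq_apply, Complex.normSq_apply]
  ring

lemma symL_eq (n : ℕ) (w : C2) : symL n w = (4 * Real.pi ^ 2 * ‖w‖ ^ 2) • (1 : EndV n) := by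
  simp only [symL, symbol, rdir, Fin.sum_univ_four, norm_sq_C2, Matrix.cons_val, inner_single,
    Complex.one_re, Complex.one_im, Complex.I_re, Complex.I_im]
  module

/-- The traceless Hermitian matrix `2 w w* - |w|²`. -/
noncomputable def rankOne (w : C2) : Matrix (Fin 2) (Fin 2) ℂ :=
  (2 : ℂ) • Matrix.vecMulVec w.ofLp (star w.ofLp) - ((‖w‖ ^ 2 : ℝ) : ℂ) • 1

lemma rankOne_eq (w : C2) : rankOne w =
    (((w 0).re ^ 2 + (w 0).im ^ 2 - ((w 1).re ^ 2 + (w 1).im ^ 2) : ℝ) : ℂ) • (-Complex.I • X₁) +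
    ((2 * ((w 0).re * (w 1).im - (w 0).im * (w 1).re) : ℝ) : ℂ) • (-Complex.I • X₂) +
    ((2 * ((w 0).re * (w 1).re + (w 0).im * (w 1).im) : ℝ) : ℂ) • (-Complex.I • X₃) := by
  rw [rankOne, norm_sq_C2]
  ext i j
  fin_cases i <;> fin_cases j <;> apply Complex.ext <;>
    simp [X₁, X₂, X₃, Matrix.vecMulVec, Complex.mul_re, Complex.mul_im, sq] <;> ring

/-- The symbol of `𝐃ₙ` at `w` is `4π² dτₙ(2 w w* - |w|²)`. -/
lemma symD_eq (n : ℕ) (w : C2) : symD n w = ((4 * Real.pi ^ 2 : ℝ) : ℂ) • dtau n (rankOne w) := by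
  rw [rankOne_eq]
  simp only [dtau_add, dtau_smul]
  simp only [symD, symbol, rdir, coefD, dirD₁, dirD₂, Fin.sum_univ_eight, Matrix.cons_val,
    inner_single, Complex.one_re, Complex.one_im, Complex.I_re, Complex.I_im, hermX,
    ← Complex.coe_smul]
  push_cast
  module

lemma rankOne_act (k : U2) (w : C2) : rankOne (act k w) =
    (k : Matrix (Fin 2) (Fin 2) ℂ) * rankOne w * ((k⁻¹ : U2) : Matrix (Fin 2) (Fin 2) ℂ) := by
  have h : ((k⁻¹ : U2) : Matrix (Fin 2) (Fin 2) ℂ) = (k : Matrix (Fin 2) (Fin 2) ℂ)ᴴ := rfl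
  simp only [rankOne, norm_act, mul_sub, sub_mul, Matrix.mul_smul, Matrix.smul_mul, mul_one,
    coe_mul_coe_inv]
  rw [h, act, Matrix.star_mulVec, Matrix.mul_vecMulVec, Matrix.vecMulVec_mul]

lemma symD_act (n : ℕ) (k : U2) (w : C2) :
    symD n (act k w) = tau n k * symD n w * tau n k⁻¹ := by
  rw [symD_eq, symD_eq, rankOne_act, dtau_conj, Matrix.mul_smul, Matrix.smul_mul]

lemma symD_base (n : ℕ) (r : ℝ) : symD n (base r) =
    Matrix.diagonal fun j : Fin (n + 1) =>
      ((4 * Real.pi ^ 2 * r ^ 2 * (n - 2 * (j : ℕ)) : ℝ) : ℂ) := by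
  have : rankOne (base r) = ((r ^ 2 : ℝ) : ℂ) • !![1, 0; 0, -1] := by
    rw [rankOne, norm_sq_C2]
    ext i j
    fin_cases i <;> fin_cases j <;> simp [base, Matrix.vecMulVec, sq]
    ring
  rw [symD_eq, this, dtau_smul, dtau_diagonal, ← Matrix.diagonal_smul, ← Matrix.diagonal_smul]
  congr 1
  ext j
  simp
  ring

/-- The pair of eigenvalues of the spherical function attached to the point `(r, 0)` and the
`j`-th weight vector. -/
noncomputable def spec (n : ℕ) (r : ℝ) (j : Fin (n + 1)) : R2 :=
  !₂[4 * Real.pi ^ 2 * r ^ 2, 4 * Real.pi ^ 2 * r ^ 2 * (n - 2 * (j : ℕ))]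

/-! ### Smooth dependence of integrals on parameters -/

section Smooth

variable {V E : Type} [NormedAddCommGroup V] [NormedSpace ℝ V]
  [NormedAddCommGroup E] [NormedSpace ℝ E]

/-- The partial derivative in the second variable of a jointly smooth function. -/
lemma contDiff_uncurry_fderiv {F : Type} [NormedAddCommGroup F] [NormedSpace ℝ F] {f : V → E → F}
    (hf : ContDiff ℝ ∞ (Function.uncurry f)) :
    ContDiff ℝ ∞ (Function.uncurry fun v x => fderiv ℝ (f v) x) := by
  have h := ContDiff.fderiv (𝕜 := ℝ) (m := ∞) (n := ∞) (f := fun p : V × E => f p.1)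
    (g := fun p : V × E => p.2)
    (by
      exact hf.comp ((contDiff_fst.comp contDiff_fst).prodMk contDiff_snd)) contDiff_snd (by simp)
  exact h

lemma contDiff_section {F : Type} [NormedAddCommGroup F] [NormedSpace ℝ F] {f : V → E → F}
    (hf : ContDiff ℝ ∞ (Function.uncurry f)) (v : V) : ContDiff ℝ ∞ (f v) :=
  hf.comp (contDiff_const.prodMk contDiff_id)

lemma norm_iteratedFDeriv_smul_const_le {F : Type} [NormedAddCommGroup F] [NormedSpace ℝ F]
    {φ : E → ℝ} (hφ : ContDiff ℝ ∞ φ) (a : F) (j : ℕ) (x : E) :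
    ‖iteratedFDeriv ℝ j (fun x => φ x • a) x‖ ≤ ‖iteratedFDeriv ℝ j φ x‖ * ‖a‖ := by
  have h := ((ContinuousLinearMap.id ℝ ℝ).smulRight a).norm_iteratedFDeriv_comp_left (x := x)
    (n := j) hφ.contDiffAt (by exact_mod_cast le_top)
  refine h.trans ?_
  rw [mul_comm, ContinuousLinearMap.norm_smulRight_apply]
  gcongr
  exact mul_le_of_le_one_left (norm_nonneg _) ContinuousLinearMap.norm_id_le

lemma continuous_norm_iteratedFDeriv {F : Type} [NormedAddCommGroup F] [NormedSpace ℝ F]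
    {f : V → E → F} (hf : ContDiff ℝ ∞ (Function.uncurry f)) (k : ℕ) :
    Continuous fun p : V × E => ‖iteratedFDeriv ℝ k (f p.1) p.2‖ := by
  induction k generalizing F with
  | zero => simpa [Function.uncurry_def] using hf.continuous.norm
  | succ k ih =>
    simp only [← norm_iteratedFDeriv_fderiv]
    exact ih (contDiff_uncurry_fderiv hf)

end Smooth

section Param

variable {V E : Type} [MeasurableSpace V] [NormedAddCommGroup E] [NormedSpace ℝ E]

/-- The hypothesis of differentiation under the integral sign, for derivatives of all orders. -/
def LocallyDominated {F : Type} [NormedAddCommGroup F] [NormedSpace ℝ F] (μ : Measure V)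
    (f : V → E → F) : Prop :=
  ∀ (k : ℕ) (R : ℝ), ∃ B : V → ℝ, Integrable B μ ∧
    ∀ᵐ v ∂μ, ∀ x, ‖x‖ ≤ R → ‖iteratedFDeriv ℝ k (f v) x‖ ≤ B v

lemma LocallyDominated.fderiv {F : Type} [NormedAddCommGroup F] [NormedSpace ℝ F] {μ : Measure V}
    {f : V → E → F} (h : LocallyDominated μ f) :
    LocallyDominated μ (fun v x => fderiv ℝ (f v) x) := by
  intro k R
  obtain ⟨B, hB, hB'⟩ := h (k + 1) R
  refine ⟨B, hB, ?_⟩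
  filter_upwards [hB'] with v hv x hx
  rw [norm_iteratedFDeriv_fderiv]
  exact hv x hx

variable [NormedAddCommGroup V] [NormedSpace ℝ V]

lemma locallyDominated_of_isCompact [ProperSpace E] {F : Type} [NormedAddCommGroup F]
    [NormedSpace ℝ F] {μ : Measure V} [IsFiniteMeasure μ] {f : V → E → F}
    (hf : ContDiff ℝ ∞ (Function.uncurry f)) {S : Set V} (hS : IsCompact S) (hμ : ∀ᵐ v ∂μ, v ∈ S) :
    LocallyDominated μ f := by
  intro k R
  obtain ⟨C, hC⟩ := (hS.prod (isCompact_closedBall (0 : E) R)).exists_bound_of_continuousOn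
    (continuous_norm_iteratedFDeriv hf k).continuousOn
  refine ⟨fun _ => C, integrable_const _, ?_⟩
  filter_upwards [hμ] with v hv x hx
  simpa using hC (v, x) ⟨hv, by simpa using hx⟩

variable [BorelSpace V] [SecondCountableTopology V]

lemma hasFDerivAt_integral_of_locallyDominated {F : Type} [NormedAddCommGroup F] [NormedSpace ℝ F]
    {μ : Measure V} {f : V → E → F} (hf : ContDiff ℝ ∞ (Function.uncurry f))
    (h : LocallyDominated μ f) (x : E) :
    HasFDerivAt (fun x => ∫ v, f v x ∂μ) (∫ v, fderiv ℝ (f v) x ∂μ) x := by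
  obtain ⟨B, hB, hB'⟩ := h 1 (‖x‖ + 1)
  obtain ⟨B0, hB0, hB0'⟩ := h 0 (‖x‖ + 1)
  have hcont : ∀ y, Continuous fun v => f v y := fun y =>
    hf.continuous.comp (continuous_id.prodMk continuous_const)
  have hcont' : Continuous fun v => fderiv ℝ (f v) x :=
    (contDiff_uncurry_fderiv hf).continuous.comp (continuous_id.prodMk continuous_const)
  refine hasFDerivAt_integral_of_dominated_of_fderiv_le (F := fun x v => f v x) (𝕜 := ℝ)
    (F' := fun x v => _root_.fderiv ℝ (f v) x) (bound := B)
    (Metric.ball_mem_nhds x one_pos) ?_ ?_ ?_ ?_ hB ?_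
  · exact Filter.Eventually.of_forall fun y => (hcont y).aestronglyMeasurable
  · refine hB0.mono' (hcont x).aestronglyMeasurable ?_
    filter_upwards [hB0'] with v hv
    simpa using hv x (by linarith)
  · exact hcont'.aestronglyMeasurable
  · filter_upwards [hB'] with v hv y hy
    have : ‖y‖ ≤ ‖x‖ + 1 := by
      have := norm_sub_norm_le y x
      rw [Metric.mem_ball, dist_eq_norm] at hy
      linarith
    simpa [norm_iteratedFDeriv_one] using hv y this
  · filter_upwards with v y _
    exact (((contDiff_section hf v).differentiable (by simp)) y).hasFDerivAt

lemma contDiff_nat_integral_of_locallyDominated (m : ℕ) {F : Type} [NormedAddCommGroup F]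
    [NormedSpace ℝ F] {μ : Measure V} {f : V → E → F} (hf : ContDiff ℝ ∞ (Function.uncurry f))
    (h : LocallyDominated μ f) : ContDiff ℝ m (fun x => ∫ v, f v x ∂μ) := by
  induction m generalizing F with
  | zero =>
    exact contDiff_zero.mpr (continuous_iff_continuousAt.mpr fun x =>
      (hasFDerivAt_integral_of_locallyDominated hf h x).continuousAt)
  | succ m ih =>
    push_cast
    rw [contDiff_succ_iff_hasFDerivAt]
    exact ⟨_, ih (contDiff_uncurry_fderiv hf) h.fderiv,
      fun x => hasFDerivAt_integral_of_locallyDominated hf h x⟩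

/-- An integral of a jointly smooth function is smooth in the parameter. -/
lemma contDiff_integral_of_locallyDominated {F : Type} [NormedAddCommGroup F]
    [NormedSpace ℝ F] {μ : Measure V} {f : V → E → F} (hf : ContDiff ℝ ∞ (Function.uncurry f))
    (h : LocallyDominated μ f) : ContDiff ℝ ∞ (fun x => ∫ v, f v x ∂μ) :=
  contDiff_infty.mpr fun m => contDiff_nat_integral_of_locallyDominated m hf h

/-- Bounds for the derivatives of the integrand integrate to bounds for the derivatives of the
integral. -/
lemma norm_iteratedFDeriv_integral_le (k : ℕ) {F : Type} [NormedAddCommGroup F]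
    [NormedSpace ℝ F] {μ : Measure V} {f : V → E → F} (hf : ContDiff ℝ ∞ (Function.uncurry f))
    (h : LocallyDominated μ f) (x : E) {B : V → ℝ} (hB : Integrable B μ)
    (hB' : ∀ᵐ v ∂μ, ‖iteratedFDeriv ℝ k (f v) x‖ ≤ B v) :
    ‖iteratedFDeriv ℝ k (fun x => ∫ v, f v x ∂μ) x‖ ≤ ∫ v, B v ∂μ := by
  induction k generalizing F with
  | zero =>
    rw [norm_iteratedFDeriv_zero]
    exact norm_integral_le_of_norm_le hB (by simpa using hB')
  | succ k ih =>
    rw [← norm_iteratedFDeriv_fderiv]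
    have : fderiv ℝ (fun x => ∫ v, f v x ∂μ) = fun x => ∫ v, fderiv ℝ (f v) x ∂μ :=
      funext fun x => (hasFDerivAt_integral_of_locallyDominated hf h x).fderiv
    rw [this]
    refine ih (contDiff_uncurry_fderiv hf) h.fderiv ?_
    filter_upwards [hB'] with v hv
    rwa [norm_iteratedFDeriv_fderiv]

end Param

/-! ### The derivative of the exponential -/

section Duhamel

variable {A : Type} [NormedRing A] [NormedAlgebra ℝ A] [CompleteSpace A]

lemma contDiff_normedSpace_exp : ContDiff ℝ ∞ (NormedSpace.exp : A → A) := by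
  rw [contDiff_iff_contDiffAt]
  exact fun x => (NormedSpace.exp_analytic (𝕂 := ℝ) x).contDiffAt

/-- Duhamel's formula. -/
lemma exp_sub_exp (X Y : A) : NormedSpace.exp Y - NormedSpace.exp X =
    ∫ s in (0 : ℝ)..1, NormedSpace.exp ((1 - s) • X) * (Y - X) * NormedSpace.exp (s • Y) := by
  have hd : ∀ s : ℝ, HasDerivAt
      (fun s : ℝ => NormedSpace.exp ((1 - s) • X) * NormedSpace.exp (s • Y))
      (NormedSpace.exp ((1 - s) • X) * (Y - X) * NormedSpace.exp (s • Y)) s := by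
    intro s
    have h1 : HasDerivAt (fun s : ℝ => NormedSpace.exp ((1 - s) • X))
        ((-1 : ℝ) • (NormedSpace.exp ((1 - s) • X) * X)) s :=
      (hasDerivAt_exp_smul_const (𝕂 := ℝ) X (1 - s)).scomp s ((hasDerivAt_id s).const_sub 1)
    have h2 : HasDerivAt (fun s : ℝ => NormedSpace.exp (s • Y)) (Y * NormedSpace.exp (s • Y)) s :=
      hasDerivAt_exp_smul_const' (𝕂 := ℝ) Y s
    convert h1.mul h2 using 1
    · rfl
    · simp only [mul_sub, sub_mul, mul_assoc, neg_smul, one_smul, neg_mul]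
      abel
  rw [intervalIntegral.integral_eq_sub_of_hasDerivAt (fun s _ => hd s)]
  · simp
  · have := (contDiff_normedSpace_exp (A := A)).continuous
    exact Continuous.intervalIntegrable (by fun_prop) _ _

/-- Duhamel's formula for the derivative of the exponential. -/
lemma fderiv_exp_apply (X H : A) : fderiv ℝ (NormedSpace.exp : A → A) X H =
    ∫ s in (0 : ℝ)..1, NormedSpace.exp ((1 - s) • X) * H * NormedSpace.exp (s • X) := by
  have hc := (contDiff_normedSpace_exp (A := A)).continuous
  have h1 : HasDerivAt (fun t : ℝ => NormedSpace.exp (X + t • H))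
      (fderiv ℝ (NormedSpace.exp : A → A) X H) 0 := by
    have h0 : HasFDerivAt (NormedSpace.exp : A → A) (fderiv ℝ NormedSpace.exp X)
        (X + (0 : ℝ) • H) := by
      simpa using ((contDiff_normedSpace_exp (A := A)).differentiable (by simp) X).hasFDerivAt
    have h2 : HasDerivAt (fun t : ℝ => X + t • H) H 0 := by
      simpa using ((hasDerivAt_id (0 : ℝ)).smul_const H).const_add X
    exact h0.comp_hasDerivAt (0 : ℝ) h2
  have h3 : HasDerivAt (fun t : ℝ => NormedSpace.exp (X + t • H))
      (∫ s in (0 : ℝ)..1, NormedSpace.exp ((1 - s) • X) * H * NormedSpace.exp (s • X)) 0 := by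
    rw [hasDerivAt_iff_tendsto_slope_zero]
    have hcont : Continuous fun t : ℝ => ∫ s in (0 : ℝ)..1,
        NormedSpace.exp ((1 - s) • X) * H * NormedSpace.exp (s • (X + t • H)) :=
      intervalIntegral.continuous_parametric_intervalIntegral_of_continuous' (by fun_prop) 0 1
    have ht := (hcont.tendsto 0).mono_left (nhdsWithin_le_nhds (s := {0}ᶜ))
    simp only [zero_smul, add_zero] at ht
    refine ht.congr' ?_
    filter_upwards [self_mem_nhdsWithin] with t ht0
    rw [zero_add, zero_smul, add_zero, exp_sub_exp, ← intervalIntegral.integral_smul]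
    congr 1
    ext s
    rw [add_sub_cancel_left, mul_smul_comm, smul_mul_assoc, smul_smul, inv_mul_cancel₀ ht0, one_smul]
  exact h1.unique h3

end Duhamel

/-! ### Polynomial bounds for exponentials of polynomial families -/

section PolyBound

variable {I E : Type} [NormedAddCommGroup E] [NormedSpace ℝ E]

/-- The derivatives of order at most `m` of the members of a family of functions are bounded by a
common polynomial in the weight `X`. -/
def PolyBounded {W : I → Type} [∀ i, NormedAddCommGroup (W i)] [∀ i, NormedSpace ℝ (W i)]
    (X : I → E → ℝ) (m : ℕ) (f : ∀ i, E → W i) : Prop :=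
  ∃ (C : ℝ) (q : ℕ), 0 ≤ C ∧ ∀ j ≤ m, ∀ i x, ‖iteratedFDeriv ℝ j (f i) x‖ ≤ C * X i x ^ q

/-- Polynomial bounds are preserved by uniformly bounded bilinear maps. -/
lemma PolyBounded.bilin {W₁ W₂ W₃ : I → Type} [∀ i, NormedAddCommGroup (W₁ i)]
    [∀ i, NormedSpace ℝ (W₁ i)] [∀ i, NormedAddCommGroup (W₂ i)] [∀ i, NormedSpace ℝ (W₂ i)]
    [∀ i, NormedAddCommGroup (W₃ i)] [∀ i, NormedSpace ℝ (W₃ i)] {X : I → E → ℝ} {m : ℕ}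
    (hX : ∀ i x, 0 ≤ X i x)
    (B : ∀ i, W₁ i →L[ℝ] W₂ i →L[ℝ] W₃ i) (hB : ∀ i, ‖B i‖ ≤ 1)
    {f : ∀ i, E → W₁ i} {g : ∀ i, E → W₂ i} (hf : PolyBounded X m f) (hg : PolyBounded X m g)
    (hf' : ∀ i, ContDiff ℝ ∞ (f i)) (hg' : ∀ i, ContDiff ℝ ∞ (g i)) :
    PolyBounded X m (fun i x => B i (f i x) (g i x)) := by
  obtain ⟨C, q, hC, hf⟩ := hf
  obtain ⟨D, r, hD, hg⟩ := hg
  refine ⟨2 ^ m * (C * D), q + r, by positivity, fun j hj i x => ?_⟩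
  have hXi := hX i x
  refine ((B i).norm_iteratedFDeriv_le_of_bilinear (hf' i) (hg' i) x
    (by exact_mod_cast le_top)).trans ?_
  calc _ ≤ 1 * ∑ l ∈ Finset.range (j + 1), (j.choose l : ℝ) * (C * X i x ^ q) * (D * X i x ^ r) := by
        gcongr with l hl
        · exact hB i
        · exact hf l (by have := Finset.mem_range.mp hl; omega) i x
        · exact hg (j - l) (by omega) i x
    _ = 2 ^ j * (C * D) * X i x ^ (q + r) := by
        rw [one_mul, ← Finset.sum_mul, ← Finset.sum_mul, ← Nat.cast_sum, Nat.sum_range_choose]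
        push_cast
        ring
    _ ≤ _ := by
        gcongr
        norm_num

lemma PolyBounded.comp {J : Type} {W : I → Type} [∀ i, NormedAddCommGroup (W i)]
    [∀ i, NormedSpace ℝ (W i)] {X : I → E → ℝ} {Y : J → E → ℝ} {m : ℕ} {f : ∀ i, E → W i}
    (hf : PolyBounded X m f) (σ : J → I) (hX : ∀ i x, 0 ≤ X i x)
    (hXY : ∀ j x, X (σ j) x ≤ Y j x) : PolyBounded Y m (fun j => f (σ j)) := by
  obtain ⟨C, q, hC, hf⟩ := hf
  refine ⟨C, q, hC, fun l hl j x => (hf l hl _ x).trans ?_⟩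
  have := hX (σ j) x
  gcongr
  exact hXY j x

variable {A : I → Type} [∀ i, NormedRing (A i)] [∀ i, NormedAlgebra ℝ (A i)]
  [∀ i, CompleteSpace (A i)]

/-- Left multiplication of operators into a normed algebra. -/
noncomputable def mulLeftL (R : Type) [NormedRing R] [NormedAlgebra ℝ R] :
    R →L[ℝ] (E →L[ℝ] R) →L[ℝ] (E →L[ℝ] R) :=
  (ContinuousLinearMap.compL ℝ E R R).comp (ContinuousLinearMap.mul ℝ R)

/-- Right multiplication of operators into a normed algebra. -/
noncomputable def mulRightL (R : Type) [NormedRing R] [NormedAlgebra ℝ R] :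
    R →L[ℝ] (E →L[ℝ] R) →L[ℝ] (E →L[ℝ] R) :=
  (ContinuousLinearMap.compL ℝ E R R).comp (ContinuousLinearMap.mul ℝ R).flip

lemma norm_mulLeftL_le (R : Type) [NormedRing R] [NormedAlgebra ℝ R] :
    ‖mulLeftL (E := E) R‖ ≤ 1 := by
  refine (ContinuousLinearMap.opNorm_comp_le _ _).trans ?_
  exact mul_le_one₀ (ContinuousLinearMap.norm_compL_le _ _ _ _) (norm_nonneg _)
    (ContinuousLinearMap.opNorm_mul_le _ _)

lemma norm_mulRightL_le (R : Type) [NormedRing R] [NormedAlgebra ℝ R] :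
    ‖mulRightL (E := E) R‖ ≤ 1 := by
  refine (ContinuousLinearMap.opNorm_comp_le _ _).trans ?_
  refine mul_le_one₀ (ContinuousLinearMap.norm_compL_le _ _ _ _) (norm_nonneg _) ?_
  rw [ContinuousLinearMap.opNorm_flip]
  exact ContinuousLinearMap.opNorm_mul_le _ _

/-- The integrand of Duhamel's formula for the derivative of `exp ∘ G`. -/
noncomputable def duhamel {R : Type} [NormedRing R] [NormedAlgebra ℝ R] (G : E → R) (s : ℝ) (x : E) :
    E →L[ℝ] R :=
  mulRightL R (NormedSpace.exp (s • G x))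
    (mulLeftL R (NormedSpace.exp ((1 - s) • G x)) (fderiv ℝ G x))

lemma contDiff_duhamel {R : Type} [NormedRing R] [NormedAlgebra ℝ R] [CompleteSpace R] {G : E → R}
    (hG : ContDiff ℝ ∞ G) : ContDiff ℝ ∞ (Function.uncurry (duhamel G)) := by
  have hG' : ContDiff ℝ ∞ fun p : ℝ × E => G p.2 := hG.comp contDiff_snd
  have hd : ContDiff ℝ ∞ fun p : ℝ × E => fderiv ℝ G p.2 :=
    (hG.fderiv_right (m := ∞) (by simp)).comp contDiff_snd
  have h1 : ContDiff ℝ ∞ fun p : ℝ × E => NormedSpace.exp (p.1 • G p.2) :=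
    contDiff_normedSpace_exp.comp (contDiff_fst.fun_smul hG')
  have h2 : ContDiff ℝ ∞ fun p : ℝ × E => NormedSpace.exp ((1 - p.1) • G p.2) :=
    contDiff_normedSpace_exp.comp ((contDiff_const.sub contDiff_fst).fun_smul hG')
  exact ((mulRightL R).contDiff.comp h1).clm_apply (((mulLeftL R).contDiff.comp h2).clm_apply hd)

/-- The derivative of `exp ∘ G` as an integral of vector-valued functions. -/
lemma fderiv_exp_comp {R : Type} [NormedRing R] [NormedAlgebra ℝ R] [CompleteSpace R] {G : E → R}
    (hG : ContDiff ℝ ∞ G) (x : E) : fderiv ℝ (fun x => NormedSpace.exp (G x)) x =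
      ∫ s in Set.Ioc (0 : ℝ) 1, duhamel G s x := by
  have hpair : Continuous fun s : ℝ => (s, x) := continuous_id.prodMk continuous_const
  have hcont : Continuous (fun s : ℝ => Function.uncurry (duhamel G) (s, x)) :=
    (contDiff_duhamel hG).continuous.comp hpair
  simp only [Function.uncurry_apply_pair] at hcont
  have hi : Integrable (fun s => duhamel G s x) (volume.restrict (Set.Ioc (0 : ℝ) 1)) :=
    (hcont.integrableOn_Icc (a := 0) (b := 1)).mono_set Set.Ioc_subset_Icc_self
  have he : HasFDerivAt (NormedSpace.exp : R → R) (fderiv ℝ NormedSpace.exp (G x)) (G x) :=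
    ((contDiff_normedSpace_exp (A := R)).differentiable (by simp) (G x)).hasFDerivAt
  have hg : HasFDerivAt G (fderiv ℝ G x) x := (hG.differentiable (by simp) x).hasFDerivAt
  have h : fderiv ℝ (fun x => NormedSpace.exp (G x)) x =
      (fderiv ℝ NormedSpace.exp (G x)).comp (fderiv ℝ G x) := (he.comp x hg).fderiv
  ext v
  rw [h, ContinuousLinearMap.comp_apply, fderiv_exp_apply, ContinuousLinearMap.integral_apply hi,
    intervalIntegral.integral_of_le zero_le_one]
  rfl

/-- If `G i τ` is linear in `τ` along rays, has derivatives of polynomial growth, and `exp ∘ G i τ`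
has polynomial growth, then all derivatives of `exp ∘ G i τ` have polynomial growth: by Duhamel's
formula the derivative is an integral of products of exponentials with the derivative of `G`. -/
lemma polyBounded_exp [ProperSpace E] {T : Type} [SMul ℝ T] {G : ∀ i, T → E → A i}
    (hG : ∀ i τ, ContDiff ℝ ∞ (G i τ)) (hs : ∀ i (s : ℝ) τ x, G i (s • τ) x = s • G i τ x)
    {X : I × T → E → ℝ} (hX : ∀ p x, 1 ≤ X p x)
    (hXs : ∀ i τ x, ∀ s ∈ Set.Icc (0 : ℝ) 1, X (i, s • τ) x ≤ X (i, τ) x)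
    (h0 : PolyBounded (W := fun p : I × T => A p.1) X 0
      (fun p x => NormedSpace.exp (G p.1 p.2 x)))
    (h1 : ∀ m, PolyBounded (W := fun p : I × T => E →L[ℝ] A p.1) X m
      (fun p => fderiv ℝ (G p.1 p.2))) (m : ℕ) :
    PolyBounded (W := fun p : I × T => A p.1) X m (fun p x => NormedSpace.exp (G p.1 p.2 x)) := by
  have hX0 : ∀ p x, 0 ≤ X p x := fun p x => zero_le_one.trans (hX p x)
  induction m with
  | zero => exact h0
  | succ m ih =>
    -- Both exponentials in Duhamel's integral are members of the original family, at `s • τ` and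
    -- `(1 - s) • τ`, so the induction hypothesis bounds them uniformly in `s ∈ [0, 1]`.
    let J := (I × T) × Set.Icc (0 : ℝ) 1
    let Y : J → E → ℝ := fun p => X p.1
    have e1 := ih.comp (J := J) (Y := Y) (fun p => (p.1.1, (p.2 : ℝ) • p.1.2)) hX0
      (fun p x => hXs _ _ x _ p.2.2)
    have e2 := ih.comp (J := J) (Y := Y) (fun p => (p.1.1, (1 - (p.2 : ℝ)) • p.1.2)) hX0
      (fun p x => hXs _ _ x _ ⟨by linarith [p.2.2.2], by linarith [p.2.2.1]⟩)
    have e3 := (h1 m).comp (J := J) (Y := Y) (fun p => p.1) hX0 (fun p x => le_rfl)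
    simp only [hs] at e1 e2
    have hY0 : ∀ (p : J) x, 0 ≤ Y p x := fun p x => hX0 p.1 x
    have hexp : ∀ i τ (s : ℝ), ContDiff ℝ ∞ fun x => NormedSpace.exp (s • G i τ x) := fun i τ s =>
      contDiff_normedSpace_exp.comp ((hG i τ).const_smul s)
    have hfd : ∀ i τ, ContDiff ℝ ∞ (fderiv ℝ (G i τ)) := fun i τ =>
      (hG i τ).fderiv_right (by simp)
    have e4 := PolyBounded.bilin hY0 (fun p : J => mulLeftL (E := E) (A p.1.1))
      (fun p => norm_mulLeftL_le _) e2 e3 (fun p => hexp _ _ _) (fun p => hfd _ _)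
    have e5 := PolyBounded.bilin hY0 (fun p : J => mulRightL (E := E) (A p.1.1))
      (fun p => norm_mulRightL_le _) e1 e4 (fun p => hexp _ _ _)
      (fun p => ((mulLeftL (E := E) (A p.1.1)).contDiff.comp
        (hexp p.1.1 p.1.2 (1 - p.2))).clm_apply (hfd p.1.1 p.1.2))
    obtain ⟨C, q, hC, h5⟩ := e5
    obtain ⟨C', q', hC', ih⟩ := ih
    refine ⟨max C C', max q q', le_max_of_le_left hC, fun j hj p x => ?_⟩
    have hmono : ∀ {c : ℝ} {r : ℕ}, c ≤ max C C' → r ≤ max q q' →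
        c * X p x ^ r ≤ max C C' * X p x ^ (max q q') := by
      intro c r hc hr
      have := hX p x
      have := hX0 p x
      have : 0 ≤ max C C' := le_max_of_le_left hC
      gcongr
    rcases j with _ | j
    · exact (ih 0 (Nat.zero_le _) p x).trans (hmono (le_max_right _ _) (le_max_right _ _))
    · refine le_trans ?_ (hmono (le_max_left _ _) (le_max_left _ _))
      have hd : fderiv ℝ (fun x => NormedSpace.exp (G p.1 p.2 x)) =
          fun x => ∫ s in Set.Ioc (0 : ℝ) 1, duhamel (G p.1 p.2) s x :=
        funext fun x => fderiv_exp_comp (hG _ _) x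
      rw [← norm_iteratedFDeriv_fderiv, hd]
      have hmem : ∀ᵐ s : ℝ ∂(volume.restrict (Set.Ioc (0 : ℝ) 1)), s ∈ Set.Icc (0 : ℝ) 1 := by
        filter_upwards [ae_restrict_mem measurableSet_Ioc] with s hs
        exact Set.Ioc_subset_Icc_self hs
      refine (norm_iteratedFDeriv_integral_le j (contDiff_duhamel (hG _ _))
        (locallyDominated_of_isCompact (contDiff_duhamel (hG _ _)) isCompact_Icc hmem) x
        (B := fun _ => C * X p x ^ q) (integrable_const _) ?_).trans (by simp)
      · filter_upwards [hmem] with s hs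
        exact h5 j (by omega) (p, ⟨s, hs⟩) x

end PolyBound

/-! ### The unitary matrices `exp (2πi (τ₀ Δ_z + τ₁ 𝐃ₙ))` on the symbol side -/

lemma frobenius_norm_le_of_entry_le {n : ℕ} {A : EndV n} {c : ℝ} (hc : 0 ≤ c)
    (h : ∀ i j, ‖A i j‖ ≤ c) : ‖A‖ ≤ (n + 1) * c := by
  rw [Matrix.frobenius_norm_def, ← Real.sqrt_eq_rpow]
  refine Real.sqrt_le_iff.mpr ⟨by positivity, ?_⟩
  calc ∑ i, ∑ j, ‖A i j‖ ^ (2 : ℝ) ≤ ∑ _i : Fin (n + 1), ∑ _j : Fin (n + 1), c ^ 2 := by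
        refine Finset.sum_le_sum fun i _ => Finset.sum_le_sum fun j _ => ?_
        rw [Real.rpow_two]
        exact pow_le_pow_left₀ (norm_nonneg _) (h i j) 2
    _ = ((n + 1) * c) ^ 2 := by simp; ring

lemma norm_unitary_le {n : ℕ} {A : EndV n} (h : A ∈ Matrix.unitaryGroup (Fin (n + 1)) ℂ) :
    ‖A‖ ≤ n + 1 := by
  simpa using frobenius_norm_le_of_entry_le zero_le_one (entry_norm_bound_of_unitary h)

lemma norm_conj_tau_le {n : ℕ} (k : U2) (A : EndV n) :
    ‖tau n k * A * tau n k⁻¹‖ ≤ ((n : ℝ) + 1) ^ 2 * ‖A‖ := by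
  have h1 := norm_unitary_le (tau_mem_unitary n k)
  have h2 := norm_unitary_le (tau_mem_unitary n k⁻¹)
  calc ‖tau n k * A * tau n k⁻¹‖ ≤ ‖tau n k‖ * ‖A‖ * ‖tau n k⁻¹‖ := norm_mul₃_le
    _ ≤ (n + 1) * ‖A‖ * (n + 1) := by gcongr
    _ = _ := by ring

lemma norm_symD_le (n : ℕ) (w : C2) :
    ‖symD n w‖ ≤ 4 * Real.pi ^ 2 * ((n : ℝ) + 1) ^ 4 * ‖w‖ ^ 2 := by
  obtain ⟨k, hk⟩ := exists_act_base w
  have h : ‖symD n (base ‖w‖)‖ ≤ (n + 1) * (4 * Real.pi ^ 2 * ‖w‖ ^ 2 * (n + 1)) := by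
    rw [symD_base]
    refine frobenius_norm_le_of_entry_le (by positivity) fun i j => ?_
    by_cases hij : i = j
    · subst hij
      rw [Matrix.diagonal_apply_eq, Complex.norm_real, Real.norm_eq_abs, abs_mul,
        abs_of_nonneg (by positivity : 0 ≤ 4 * Real.pi ^ 2 * ‖w‖ ^ 2)]
      have : |(n : ℝ) - 2 * (i : ℕ)| ≤ n + 1 := by
        have h1 : ((i : ℕ) : ℝ) ≤ n := by exact_mod_cast Nat.lt_succ_iff.mp i.2
        have h2 : (0 : ℝ) ≤ ((i : ℕ) : ℝ) := Nat.cast_nonneg _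
        rw [abs_le]; constructor <;> linarith
      gcongr
    · rw [Matrix.diagonal_apply_ne _ hij, norm_zero]; positivity
  conv_lhs => rw [hk, symD_act]
  calc _ ≤ ((n : ℝ) + 1) ^ 2 * ‖symD n (base ‖w‖)‖ := norm_conj_tau_le _ _
    _ ≤ ((n : ℝ) + 1) ^ 2 * ((n + 1) * (4 * Real.pi ^ 2 * ‖w‖ ^ 2 * (n + 1))) := by gcongr
    _ = _ := by ring

/-- Each `dτₙ(Xₘ)` is a multiple of the symbol of `𝐃ₙ` at some point, so that bounds for the symbol
bound the coefficients of `𝐃ₙ`. -/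
lemma hermX_eq (n : ℕ) (X : Matrix (Fin 2) (Fin 2) ℂ) (w : C2) (c : ℝ)
    (h : rankOne w = (c : ℂ) • (-Complex.I • X)) (hc : c ≠ 0) :
    hermX n X = -((((4 * Real.pi ^ 2 * c : ℝ) : ℂ)⁻¹) • symD n w) := by
  have hpi : ((4 * Real.pi ^ 2 * c : ℝ) : ℂ) ≠ 0 := by
    exact_mod_cast mul_ne_zero (by positivity) hc
  rw [symD_eq, h, dtau_smul, dtau_smul, smul_smul, smul_smul, smul_smul, hermX, ← neg_smul]
  congr 1
  have hcC : (c : ℂ) ≠ 0 := by exact_mod_cast hc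
  push_cast at hpi ⊢
  field_simp

lemma exists_norm_hermX_le : ∃ C : ℝ, 0 ≤ C ∧ ∀ n : ℕ, ‖hermX n X₁‖ ≤ C * ((n : ℝ) + 1) ^ 4 ∧
    ‖hermX n X₂‖ ≤ C * ((n : ℝ) + 1) ^ 4 ∧ ‖hermX n X₃‖ ≤ C * ((n : ℝ) + 1) ^ 4 := by
  have key : ∀ (X : Matrix (Fin 2) (Fin 2) ℂ) (w : C2) (c : ℝ),
      rankOne w = (c : ℂ) • (-Complex.I • X) → c ≠ 0 →
      ∃ C : ℝ, 0 ≤ C ∧ ∀ n : ℕ, ‖hermX n X‖ ≤ C * ((n : ℝ) + 1) ^ 4 := by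
    intro X w c h hc
    refine ⟨‖(((4 * Real.pi ^ 2 * c : ℝ) : ℂ)⁻¹)‖ * (4 * Real.pi ^ 2 * ‖w‖ ^ 2), by positivity,
      fun n => ?_⟩
    rw [hermX_eq n X w c h hc, norm_neg, norm_smul]
    calc _ ≤ ‖(((4 * Real.pi ^ 2 * c : ℝ) : ℂ)⁻¹)‖ *
          (4 * Real.pi ^ 2 * ((n : ℝ) + 1) ^ 4 * ‖w‖ ^ 2) := by
          gcongr; exact norm_symD_le n w
      _ = _ := by ring
  -- At `(1, 0)`, `(1, i)`, `(1, 1)` the symbol of `𝐃ₙ` is a multiple of `dτₙ(X₁)`, `dτₙ(X₂)`,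
  -- `dτₙ(X₃)`, respectively.
  obtain ⟨C1, h1, H1⟩ := key X₁ !₂[1, 0] 1 (by rw [rankOne_eq]; simp) one_ne_zero
  obtain ⟨C2, h2, H2⟩ := key X₂ !₂[1, Complex.I] 2 (by rw [rankOne_eq]; simp) two_ne_zero
  obtain ⟨C3, h3, H3⟩ := key X₃ !₂[1, 1] 2 (by rw [rankOne_eq]; simp) two_ne_zero
  refine ⟨C1 + C2 + C3, by positivity, fun n => ⟨?_, ?_, ?_⟩⟩
  · refine (H1 n).trans ?_; gcongr; linarith
  · refine (H2 n).trans ?_; gcongr; linarith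
  · refine (H3 n).trans ?_; gcongr; linarith

lemma exists_norm_coefD_le : ∃ C : ℝ, 0 ≤ C ∧ ∀ (n : ℕ) (p : Fin 8),
    ‖coefD n p‖ ≤ C * ((n : ℝ) + 1) ^ 4 := by
  obtain ⟨C, hC, h⟩ := exists_norm_hermX_le
  refine ⟨2 * C, by positivity, fun n p => ?_⟩
  obtain ⟨h1, h2, h3⟩ := h n
  have hp : 0 ≤ C * ((n : ℝ) + 1) ^ 4 := by positivity
  fin_cases p <;> simp [coefD, norm_smul] <;> linarith

lemma contDiff_inner_right (u : C2) : ContDiff ℝ ∞ fun w : C2 => (inner ℝ u w : ℝ) :=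
  contDiff_const.inner ℝ contDiff_id

lemma contDiff_symbol {n : ℕ} {ι : Type} [Fintype ι] (A : ι → EndV n) (u v : ι → C2) :
    ContDiff ℝ ∞ (symbol A u v) := by
  unfold symbol
  refine ContDiff.sum fun p _ => ContDiff.fun_smul (contDiff_const.mul ?_) contDiff_const
  exact (contDiff_inner_right _).mul (contDiff_inner_right _)

lemma exists_norm_iteratedFDeriv_symbol_le {ι : Type} [Fintype ι] (u v : ι → C2) (m : ℕ) :
    ∃ (C : ℝ) (q : ℕ), 0 ≤ C ∧ ∀ (n : ℕ) (A : ι → EndV n) (a : ℝ), (∀ p, ‖A p‖ ≤ a) →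
      ∀ j ≤ m, ∀ w, ‖iteratedFDeriv ℝ j (symbol A u v) w‖ ≤ C * (1 + ‖w‖) ^ q * a := by
  have htemp : ∀ p : ι, Function.HasTemperateGrowth
      (fun w : C2 => (-(4 * Real.pi ^ 2) * (inner ℝ (u p) w * inner ℝ (v p) w) : ℝ)) := by
    intro p; fun_prop
  choose q C hC hb using fun p => (htemp p).norm_iteratedFDeriv_le_uniform m
  refine ⟨∑ p, C p, ∑ p, q p, Finset.sum_nonneg fun p _ => hC p, fun n A a hA j hj w => ?_⟩
  have hsm : ∀ p, ContDiff ℝ ∞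
      (fun w : C2 => (-(4 * Real.pi ^ 2) * (inner ℝ (u p) w * inner ℝ (v p) w) : ℝ)) :=
    fun p => (htemp p).1
  unfold symbol
  rw [iteratedFDeriv_sum fun p _ => ((hsm p).fun_smul contDiff_const).of_le (by exact_mod_cast le_top),
    Finset.sum_apply]
  refine (norm_sum_le _ _).trans ?_
  rw [Finset.sum_mul, Finset.sum_mul]
  refine Finset.sum_le_sum fun p _ => ?_
  calc _ ≤ ‖iteratedFDeriv ℝ j
        (fun w : C2 => (-(4 * Real.pi ^ 2) * (inner ℝ (u p) w * inner ℝ (v p) w) : ℝ)) w‖ * ‖A p‖ :=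
        norm_iteratedFDeriv_smul_const_le (hsm p) (A p) j w
    _ ≤ (C p * (1 + ‖w‖) ^ q p) * a :=
        mul_le_mul (hb p j hj w) (hA p) (norm_nonneg _) (by have := hC p; positivity)
    _ = a * (C p * (1 + ‖w‖) ^ q p) := mul_comm _ _
    _ ≤ a * (C p * (1 + ‖w‖) ^ (∑ p, q p)) := by
        have : 0 ≤ a := (norm_nonneg _).trans (hA p)
        have := hC p
        gcongr
        · linarith [norm_nonneg w]
        · exact Finset.single_le_sum (fun _ _ => Nat.zero_le _) (Finset.mem_univ p)
    _ = _ := by ring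

/-- The skew-Hermitian matrix `2πi (τ₀ σ(Δ_z)(w) + τ₁ σ(𝐃ₙ)(w))`, where `σ` denotes the symbol. -/
noncomputable def gen (n : ℕ) (τ : R2) (w : C2) : EndV n :=
  (2 * Real.pi * Complex.I : ℂ) • (τ 0 • symL n w + τ 1 • symD n w)

/-- The unitary matrix `exp (2πi (τ₀ σ(Δ_z)(w) + τ₁ σ(𝐃ₙ)(w)))`. -/
noncomputable def expGen (n : ℕ) (τ : R2) (w : C2) : EndV n := NormedSpace.exp (gen n τ w)

lemma contDiff_coord (i : Fin 2) : ContDiff ℝ ∞ fun τ : R2 => τ i := by fun_prop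

lemma contDiff_gen (n : ℕ) : ContDiff ℝ ∞ (Function.uncurry (gen n)) := by
  refine ContDiff.const_smul _ (ContDiff.add ?_ ?_)
  · exact ((contDiff_coord 0).comp contDiff_fst).fun_smul ((contDiff_symbol _ _ _).comp contDiff_snd)
  · exact ((contDiff_coord 1).comp contDiff_fst).fun_smul ((contDiff_symbol _ _ _).comp contDiff_snd)

lemma contDiff_expGen (n : ℕ) : ContDiff ℝ ∞ (Function.uncurry (expGen n)) :=
  contDiff_normedSpace_exp.comp (contDiff_gen n)

lemma gen_smul (n : ℕ) (s : ℝ) (τ : R2) (w : C2) : gen n (s • τ) w = s • gen n τ w := by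
  simp only [gen, PiLp.smul_apply, smul_eq_mul]
  rw [mul_smul s, mul_smul s, ← smul_add, smul_comm]

lemma gen_act_base (n : ℕ) (τ : R2) (k : U2) (r : ℝ) : gen n τ (act k (base r)) =
    tau n k * Matrix.diagonal (fun j : Fin (n + 1) =>
      (2 * Real.pi * Complex.I * (inner ℝ τ (spec n r j) : ℝ) : ℂ)) * tau n k⁻¹ := by
  have hn : ‖base r‖ ^ 2 = r ^ 2 := by simp [base]
  have hd : (Matrix.diagonal fun j : Fin (n + 1) =>
      (2 * Real.pi * Complex.I * (inner ℝ τ (spec n r j) : ℝ) : ℂ)) =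
      (2 * Real.pi * Complex.I : ℂ) • (τ 0 • (4 * Real.pi ^ 2 * r ^ 2) • (1 : EndV n) + τ 1 •
        Matrix.diagonal fun j : Fin (n + 1) =>
          ((4 * Real.pi ^ 2 * r ^ 2 * (n - 2 * (j : ℕ)) : ℝ) : ℂ)) := by
    ext i j
    by_cases hij : i = j
    · subst hij
      simp [PiLp.inner_apply, spec]
      ring
    · simp [hij]
  rw [gen, symL_eq, symD_act, norm_act, hn, symD_base, hd]
  simp only [mul_add, add_mul, Matrix.mul_smul, Matrix.smul_mul, mul_one, tau_mul_tau_inv]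

lemma expGen_act_base (n : ℕ) (τ : R2) (k : U2) (r : ℝ) : expGen n τ (act k (base r)) =
    tau n k * Matrix.diagonal (fun j : Fin (n + 1) =>
      Complex.exp (2 * Real.pi * Complex.I * (inner ℝ τ (spec n r j) : ℝ) : ℂ)) * tau n k⁻¹ := by
  have hu : IsUnit (tau n k) := IsUnit.of_mul_eq_one _ (tau_mul_tau_inv n k)
  have hinv : tau n k⁻¹ = (tau n k)⁻¹ := (Matrix.inv_eq_right_inv (tau_mul_tau_inv n k)).symm
  rw [expGen, gen_act_base, hinv, Matrix.exp_conj _ _ hu, Matrix.exp_diagonal]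
  congr 3
  ext j
  rw [Pi.coe_exp, Complex.exp_eq_exp_ℂ]

/-- The exponentials are unitary, so their Hilbert-Schmidt norms are bounded in `τ` and `w`. -/
lemma norm_expGen_le (n : ℕ) (τ : R2) (w : C2) : ‖expGen n τ w‖ ≤ n + 1 := by
  obtain ⟨k, hk⟩ := exists_act_base w
  refine norm_unitary_le ?_
  rw [hk, expGen_act_base]
  refine mul_mem (mul_mem (tau_mem_unitary n k) ?_) (tau_mem_unitary n k⁻¹)
  rw [Matrix.mem_unitaryGroup_iff, Matrix.star_eq_conjTranspose, Matrix.diagonal_conjTranspose,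
    Matrix.diagonal_mul_diagonal, ← Matrix.diagonal_one]
  congr 1
  ext j
  have : (2 * Real.pi * Complex.I * (inner ℝ τ (spec n ‖w‖ j) : ℝ) : ℂ) =
    ((2 * Real.pi * (inner ℝ τ (spec n ‖w‖ j) : ℝ) : ℝ) : ℂ) * Complex.I := by push_cast; ring
  simp only [this, Pi.star_apply, Complex.star_def, Complex.mul_conj', Complex.norm_exp_ofReal_mul_I]
  simp

/-- The weight in which the derivatives of `expGen` are polynomially bounded. -/
noncomputable def weight (p : ℕ × R2) (w : C2) : ℝ := (p.1 + 1) * (1 + ‖p.2‖) * (1 + ‖w‖)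

lemma le_weight (p : ℕ × R2) (w : C2) : 1 ≤ weight p w ∧ (p.1 + 1 : ℝ) ≤ weight p w ∧
    1 + ‖p.2‖ ≤ weight p w ∧ 1 + ‖w‖ ≤ weight p w := by
  have h1 : (1 : ℝ) ≤ p.1 + 1 := by linarith [(Nat.cast_nonneg p.1 : (0 : ℝ) ≤ p.1)]
  have h2 : 1 ≤ 1 + ‖p.2‖ := by linarith [norm_nonneg p.2]
  have h3 : 1 ≤ 1 + ‖w‖ := by linarith [norm_nonneg w]
  have h12 : 1 ≤ (p.1 + 1 : ℝ) * (1 + ‖p.2‖) := one_le_mul_of_one_le_of_one_le h1 h2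
  unfold weight
  refine ⟨one_le_mul_of_one_le_of_one_le h12 h3, ?_, ?_, ?_⟩
  · rw [mul_assoc]
    exact le_mul_of_one_le_right (by positivity) (one_le_mul_of_one_le_of_one_le h2 h3)
  · rw [mul_right_comm]
    exact le_mul_of_one_le_left (by positivity) (one_le_mul_of_one_le_of_one_le h1 h3)
  · exact le_mul_of_one_le_left (by positivity) h12

lemma abs_coord_le (τ : R2) (i : Fin 2) : |τ i| ≤ ‖τ‖ := by
  simpa using PiLp.norm_apply_le τ i

/-- All derivatives of `expGen n τ` at `w` are bounded by polynomials in `n`, `‖τ‖` and `‖w‖`. -/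
lemma polyBounded_expGen (m : ℕ) :
    PolyBounded (W := fun p : ℕ × R2 => EndV p.1) weight m (fun p => expGen p.1 p.2) := by
  refine polyBounded_exp (A := EndV) (G := gen)
    (fun n τ => contDiff_section (contDiff_gen n) τ) gen_smul (fun p x => (le_weight p x).1) ?_ ?_ ?_ m
  · intro n τ x s hs
    unfold weight
    dsimp only
    have : ‖s • τ‖ ≤ ‖τ‖ := by
      rw [norm_smul, Real.norm_of_nonneg hs.1]
      exact mul_le_of_le_one_left (norm_nonneg _) hs.2
    gcongr
  · refine ⟨1, 1, zero_le_one, fun j hj p x => ?_⟩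
    obtain rfl : j = 0 := by omega
    rw [norm_iteratedFDeriv_zero, one_mul, pow_one]
    exact (norm_expGen_le p.1 p.2 x).trans (le_weight p x).2.1
  · intro m
    obtain ⟨C1, q1, hC1, h1⟩ := exists_norm_iteratedFDeriv_symbol_le rdir rdir (m + 1)
    obtain ⟨C2, q2, hC2, h2⟩ := exists_norm_iteratedFDeriv_symbol_le dirD₁ dirD₂ (m + 1)
    obtain ⟨C0, hC0, h0⟩ := exists_norm_coefD_le
    refine ⟨2 * Real.pi * (C1 + C2 * C0), 1 + q1 + q2 + 4, by positivity, fun j hj p x => ?_⟩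
    obtain ⟨hw1, hwn, hwt, hwx⟩ := le_weight p x
    have hone : ‖-(1 : EndV p.1)‖ ≤ weight p x := by
      rw [norm_neg]
      exact (norm_unitary_le (one_mem _)).trans hwn
    have hL := h1 p.1 (fun _ => -(1 : EndV p.1)) _ (fun _ => hone) (j + 1) (by omega) x
    have hD := h2 p.1 (coefD p.1) _ (h0 p.1) (j + 1) (by omega) x
    have hg : gen p.1 p.2 = (2 * Real.pi * Complex.I : ℂ) •
        (p.2 0 • symL p.1 + p.2 1 • symD p.1) := rfl
    have hsL : ContDiffAt ℝ (j + 1 : ℕ) (symL p.1) x :=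
      (contDiff_symbol _ _ _).contDiffAt.of_le (by exact_mod_cast le_top)
    have hsD : ContDiffAt ℝ (j + 1 : ℕ) (symD p.1) x :=
      (contDiff_symbol _ _ _).contDiffAt.of_le (by exact_mod_cast le_top)
    have hsL' : ContDiffAt ℝ (j + 1 : ℕ) (p.2 0 • symL p.1) x := hsL.const_smul (p.2 0)
    have hsD' : ContDiffAt ℝ (j + 1 : ℕ) (p.2 1 • symD p.1) x := hsD.const_smul (p.2 1)
    have hsum : ContDiffAt ℝ (j + 1 : ℕ) (p.2 0 • symL p.1 + p.2 1 • symD p.1) x := hsL'.add hsD'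
    rw [norm_iteratedFDeriv_fderiv, hg, iteratedFDeriv_const_smul_apply hsum,
      iteratedFDeriv_add_apply hsL' hsD', iteratedFDeriv_const_smul_apply hsL,
      iteratedFDeriv_const_smul_apply hsD, norm_smul]
    have hc : ‖(2 * Real.pi * Complex.I : ℂ)‖ = 2 * Real.pi := by
      simp [abs_of_pos Real.pi_pos]
    have ht : ∀ i, |p.2 i| ≤ weight p x := fun i =>
      (abs_coord_le p.2 i).trans (by linarith)
    rw [hc, mul_assoc (2 * Real.pi) _ (weight p x ^ _)]
    refine mul_le_mul_of_nonneg_left ?_ (by positivity)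
    refine (norm_add_le _ _).trans ?_
    rw [norm_smul, norm_smul, Real.norm_eq_abs, Real.norm_eq_abs, add_mul]
    have hX0 : 0 ≤ weight p x := zero_le_one.trans hw1
    have e1 : ∀ {q : ℕ}, (1 + ‖x‖) ^ q ≤ weight p x ^ q := fun {q} =>
      pow_le_pow_left₀ (by positivity) hwx q
    refine add_le_add ?_ ?_
    · calc _ ≤ weight p x * (C1 * weight p x ^ q1 * weight p x) := by
            refine mul_le_mul (ht 0) (hL.trans ?_) (norm_nonneg _) hX0
            gcongr
        _ = C1 * weight p x ^ (1 + q1 + 1) := by ring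
        _ ≤ _ := mul_le_mul_of_nonneg_left (pow_le_pow_right₀ hw1 (by omega)) (by positivity)
    · calc _ ≤ weight p x * (C2 * weight p x ^ q2 * (C0 * weight p x ^ 4)) := by
            refine mul_le_mul (ht 1) (hD.trans ?_) (norm_nonneg _) hX0
            gcongr
        _ = C2 * C0 * weight p x ^ (1 + q2 + 4) := by ring
        _ ≤ _ := mul_le_mul_of_nonneg_left (pow_le_pow_right₀ hw1 (by omega)) (by positivity)

/-! ### Functions of the symbols -/

/-- The joint functional calculus `w ↦ g (σ(Δ_z)(w), σ(𝐃ₙ)(w))` of the symbols of `Δ_z` and `𝐃ₙ`,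
written by means of the Fourier transform of `g`. -/
noncomputable def symCalc (n : ℕ) (g : 𝓢(R2, ℂ)) (w : C2) : EndV n :=
  ∫ τ, (𝓕 g) τ • expGen n τ w

lemma fourier_inversion (g : 𝓢(R2, ℂ)) (x : R2) :
    ∫ τ, (𝓕 g) τ * Complex.exp (2 * Real.pi * Complex.I * (inner ℝ τ x : ℝ)) = g x := by
  have h : (𝓕⁻ (𝓕 g)) x = g x := by rw [FourierTransform.fourierInv_fourier_eq]
  rw [← h, SchwartzMap.fourierInv_coe, Real.fourierInv_eq']
  refine integral_congr_ae (Filter.Eventually.of_forall fun τ => ?_)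
  simp only [smul_eq_mul]
  rw [mul_comm]
  congr 2
  push_cast; ring

/-- The map `v ↦ τₙ(k) diag(v) τₙ(k)⁻¹`. -/
noncomputable def conjDiag {n : ℕ} (k : U2) : (Fin (n + 1) → ℂ) →L[ℂ] EndV n :=
  LinearMap.toContinuousLinearMap
    { toFun := fun v => tau n k * Matrix.diagonal v * tau n k⁻¹
      map_add' := fun x y => by
        rw [← add_mul, ← mul_add, Matrix.diagonal_add]; rfl
      map_smul' := fun c x => by
        rw [← Matrix.smul_mul, ← Matrix.mul_smul, ← Matrix.diagonal_smul]; rfl }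

lemma conjDiag_apply {n : ℕ} (k : U2) (v : Fin (n + 1) → ℂ) :
    conjDiag k v = tau n k * Matrix.diagonal v * tau n k⁻¹ := rfl

lemma integral_conjDiag {n : ℕ} (k : U2) {φ : R2 → Fin (n + 1) → ℂ}
    (h : ∀ j, Integrable fun τ => φ τ j) :
    ∫ τ, conjDiag k (φ τ) = conjDiag k fun j => ∫ τ, φ τ j := by
  have h1 := (conjDiag k).integral_comp_comm (Integrable.of_eval h)
  have h2 : ∫ τ, φ τ = fun j => ∫ τ, φ τ j := funext fun j => eval_integral h j
  rw [h2] at h1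
  exact h1

lemma expGen_eq_conjDiag (n : ℕ) (τ : R2) (k : U2) (r : ℝ) : expGen n τ (act k (base r)) =
    conjDiag k fun j => Complex.exp (2 * Real.pi * Complex.I * (inner ℝ τ (spec n r j) : ℝ)) :=
  expGen_act_base n τ k r

/-- At the point `k (r, 0)` the matrix `symCalc n g` is diagonal in the basis of `Vₙ` translated by
`k`, with the values of `g` on the spectrum as its entries. -/
lemma symCalc_act_base (n : ℕ) (g : 𝓢(R2, ℂ)) (k : U2) (r : ℝ) :
    symCalc n g (act k (base r)) = conjDiag k fun j => g (spec n r j) := by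
  have hint : ∀ j : Fin (n + 1), Integrable fun τ : R2 =>
      (𝓕 g) τ * Complex.exp (2 * Real.pi * Complex.I * (inner ℝ τ (spec n r j) : ℝ)) := by
    intro j
    refine (𝓕 g).integrable.norm.mono' (Continuous.aestronglyMeasurable (by fun_prop)) ?_
    refine Filter.Eventually.of_forall fun τ => ?_
    have : (2 * Real.pi * Complex.I * (inner ℝ τ (spec n r j) : ℝ) : ℂ) =
      ((2 * Real.pi * (inner ℝ τ (spec n r j) : ℝ) : ℝ) : ℂ) * Complex.I := by push_cast; ring
    rw [norm_mul, this, Complex.norm_exp_ofReal_mul_I, mul_one]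
  have h : ∀ τ, (𝓕 g) τ • expGen n τ (act k (base r)) = conjDiag k fun j =>
      (𝓕 g) τ * Complex.exp (2 * Real.pi * Complex.I * (inner ℝ τ (spec n r j) : ℝ)) := by
    intro τ
    rw [expGen_eq_conjDiag, ← map_smul]
    rfl
  rw [symCalc, integral_congr_ae (Filter.Eventually.of_forall h), integral_conjDiag k hint]
  simp only [fourier_inversion]

/-- The moments `∫ (1 + ‖τ‖)^q |𝓕 g(τ)| dτ`. -/
noncomputable def fourierMoment (q : ℕ) (g : 𝓢(R2, ℂ)) : ℝ :=
  ∫ τ, (1 + ‖τ‖) ^ q * ‖(𝓕 g) τ‖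

lemma integrable_fourierMoment (q : ℕ) (g : 𝓢(R2, ℂ)) :
    Integrable fun τ => (1 + ‖τ‖) ^ q * ‖(𝓕 g) τ‖ := by
  have : (fun τ => (1 + ‖τ‖) ^ q * ‖(𝓕 g) τ‖) = fun τ => ∑ m ∈ Finset.range (q + 1),
      (q.choose m : ℝ) * (‖τ‖ ^ m * ‖(𝓕 g) τ‖) := by
    ext τ
    rw [add_comm, add_pow, Finset.sum_mul]
    refine Finset.sum_congr rfl fun m _ => ?_
    rw [one_pow]; ring
  rw [this]
  exact integrable_finsetSum _ fun m _ => ((𝓕 g).integrable_pow_mul volume m).const_mul _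

lemma contDiff_smul_expGen (n : ℕ) (g : 𝓢(R2, ℂ)) :
    ContDiff ℝ ∞ (Function.uncurry fun τ w => (𝓕 g) τ • expGen n τ w) := by
  have h : ContDiff ℝ ∞ fun p : R2 × C2 => (𝓕 g) p.1 := ((𝓕 g).smooth ⊤).comp contDiff_fst
  exact h.fun_smul (contDiff_expGen n)

lemma exists_norm_iteratedFDeriv_smul_expGen_le (m : ℕ) : ∃ (C : ℝ) (q : ℕ), 0 ≤ C ∧
    ∀ (n : ℕ) (g : 𝓢(R2, ℂ)), ∀ j ≤ m, ∀ τ w,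
      ‖iteratedFDeriv ℝ j (fun w => (𝓕 g) τ • expGen n τ w) w‖ ≤
        C * ((n : ℝ) + 1) ^ q * (1 + ‖w‖) ^ q * ((1 + ‖τ‖) ^ q * ‖(𝓕 g) τ‖) := by
  obtain ⟨C, q, hC, h⟩ := polyBounded_expGen m
  refine ⟨C, q, hC, fun n g j hj τ w => ?_⟩
  have hs : ContDiffAt ℝ j (expGen n τ) w :=
    (contDiff_section (contDiff_expGen n) τ).contDiffAt.of_le (by exact_mod_cast le_top)
  have : (fun w => (𝓕 g) τ • expGen n τ w) = (𝓕 g) τ • expGen n τ := rfl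
  rw [this, iteratedFDeriv_const_smul_apply hs, norm_smul]
  calc _ ≤ ‖(𝓕 g) τ‖ * (C * weight (n, τ) w ^ q) := by gcongr; exact h j hj (n, τ) w
    _ = _ := by rw [weight, mul_pow, mul_pow]; ring

lemma locallyDominated_smul_expGen (n : ℕ) (g : 𝓢(R2, ℂ)) :
    LocallyDominated volume fun τ w => (𝓕 g) τ • expGen n τ w := by
  intro k R
  obtain ⟨C, q, hC, h⟩ := exists_norm_iteratedFDeriv_smul_expGen_le k
  refine ⟨fun τ => C * ((n : ℝ) + 1) ^ q * (1 + |R|) ^ q * ((1 + ‖τ‖) ^ q * ‖(𝓕 g) τ‖),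
    (integrable_fourierMoment q g).const_mul _, Filter.Eventually.of_forall fun τ w hw => ?_⟩
  have := hw.trans (le_abs_self R)
  refine (h n g k le_rfl τ w).trans ?_
  change _ ≤ C * ((n : ℝ) + 1) ^ q * (1 + |R|) ^ q * ((1 + ‖τ‖) ^ q * ‖(𝓕 g) τ‖)
  gcongr

lemma contDiff_symCalc (n : ℕ) (g : 𝓢(R2, ℂ)) : ContDiff ℝ ∞ (symCalc n g) :=
  contDiff_integral_of_locallyDominated (contDiff_smul_expGen n g) (locallyDominated_smul_expGen n g)

lemma exists_norm_iteratedFDeriv_symCalc_le (m : ℕ) : ∃ (C : ℝ) (q : ℕ), 0 ≤ C ∧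
    ∀ (n : ℕ) (g : 𝓢(R2, ℂ)), ∀ j ≤ m, ∀ w, ‖iteratedFDeriv ℝ j (symCalc n g) w‖ ≤
      C * ((n : ℝ) + 1) ^ q * (1 + ‖w‖) ^ q * fourierMoment q g := by
  obtain ⟨C, q, hC, h⟩ := exists_norm_iteratedFDeriv_smul_expGen_le m
  refine ⟨C, q, hC, fun n g j hj w => ?_⟩
  refine (norm_iteratedFDeriv_integral_le j (contDiff_smul_expGen n g)
    (locallyDominated_smul_expGen n g) w ((integrable_fourierMoment q g).const_mul
      (C * ((n : ℝ) + 1) ^ q * (1 + ‖w‖) ^ q))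
    (Filter.Eventually.of_forall fun τ => h n g j hj τ w)).trans (le_of_eq ?_)
  rw [integral_const_mul]; rfl

/-! ### Decay -/

/-- Multiplication by the coordinate `xᵢ`. -/
noncomputable def mulCoord (i : Fin 2) : 𝓢(R2, ℂ) →L[ℂ] 𝓢(R2, ℂ) :=
  SchwartzMap.smulLeftCLM ℂ fun x : R2 => ((x i : ℝ) : ℂ)

lemma hasTemperateGrowth_coord (i : Fin 2) :
    Function.HasTemperateGrowth fun x : R2 => ((x i : ℝ) : ℂ) := by
  have h : Function.HasTemperateGrowth fun x : R2 => x i :=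
    (EuclideanSpace.proj (𝕜 := ℝ) i : R2 →L[ℝ] ℝ).hasTemperateGrowth
  exact Function.Complex.hasTemperateGrowth_ofReal.comp h

lemma mulCoord_apply (i : Fin 2) (g : 𝓢(R2, ℂ)) (x : R2) : mulCoord i g x = (x i : ℂ) * g x := by
  rw [mulCoord, SchwartzMap.smulLeftCLM_apply_apply (hasTemperateGrowth_coord i), smul_eq_mul]

/-- Multiplication by `1 + x₀ / (4π²)`, which corresponds to `1 + ‖w‖²` on the symbol side. -/
noncomputable def mulWeight (g : 𝓢(R2, ℂ)) : 𝓢(R2, ℂ) :=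
  g + (((4 * Real.pi ^ 2)⁻¹ : ℝ) : ℂ) • mulCoord 0 g

lemma mulWeight_spec (g : 𝓢(R2, ℂ)) (n : ℕ) (r : ℝ) (j : Fin (n + 1)) :
    mulWeight g (spec n r j) = ((1 + r ^ 2 : ℝ) : ℂ) * g (spec n r j) := by
  have : mulWeight g (spec n r j) = g (spec n r j) +
    (((4 * Real.pi ^ 2)⁻¹ : ℝ) : ℂ) * mulCoord 0 g (spec n r j) := rfl
  have hpi : (Real.pi : ℂ) ≠ 0 := by exact_mod_cast Real.pi_ne_zero
  rw [this, mulCoord_apply]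
  simp only [spec, PiLp.toLp_apply, Matrix.cons_val_zero]
  push_cast
  field_simp

/-- `symCalc n g w` depends only on the values of `g` at the points `spec n ‖w‖ j`. -/
lemma symCalc_congr_smul {n : ℕ} {g f : 𝓢(R2, ℂ)} {w : C2} (c : ℂ)
    (h : ∀ j : Fin (n + 1), f (spec n ‖w‖ j) = c * g (spec n ‖w‖ j)) :
    symCalc n f w = c • symCalc n g w := by
  obtain ⟨k, hk⟩ := exists_act_base w
  rw [hk, symCalc_act_base, symCalc_act_base, ← map_smul]
  congr 1
  ext j
  exact h j

lemma symCalc_iterate_mulWeight (n : ℕ) (g : 𝓢(R2, ℂ)) (L : ℕ) (w : C2) :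
    symCalc n (mulWeight^[L] g) w = (((1 + ‖w‖ ^ 2) ^ L : ℝ) : ℂ) • symCalc n g w := by
  refine symCalc_congr_smul _ fun j => ?_
  induction L with
  | zero => simp
  | succ L ih =>
    rw [Function.iterate_succ_apply', mulWeight_spec, ih]
    push_cast; ring

/-- The functions `(1 + ‖w‖²)^{-L}`. -/
noncomputable def japInv (L : ℕ) (w : C2) : ℝ := ((1 + ‖w‖ ^ 2) ^ L)⁻¹

lemma one_add_sq_pos (w : C2) : 0 < 1 + ‖w‖ ^ 2 := by positivity

lemma contDiff_japInv (L : ℕ) : ContDiff ℝ ∞ (japInv L) :=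
  ContDiff.inv ((contDiff_const.add (contDiff_norm_sq ℝ)).pow L) fun w =>
    (pow_pos (one_add_sq_pos w) L).ne'

lemma fderiv_japInv (L : ℕ) : fderiv ℝ (japInv L) =
    fun w => japInv (L + 1) w • ((-(2 * L) : ℝ) • innerSL ℝ w) := by
  ext1 w
  have hpos := one_add_sq_pos w
  have h2 : HasFDerivAt (fun w : C2 => 1 + ‖w‖ ^ 2) (2 • innerSL ℝ w) w :=
    (hasStrictFDerivAt_norm_sq w).hasFDerivAt.const_add 1
  have h1 : HasDerivAt (fun t : ℝ => (t ^ L)⁻¹) (-(L * (1 + ‖w‖ ^ 2) ^ (L - 1)) /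
      ((1 + ‖w‖ ^ 2) ^ L) ^ 2) (1 + ‖w‖ ^ 2) :=
    (hasDerivAt_pow L _).fun_inv (pow_pos hpos L).ne'
  have h3 := h1.comp_hasFDerivAt w h2
  rw [show japInv L = (fun t : ℝ => (t ^ L)⁻¹) ∘ fun w : C2 => 1 + ‖w‖ ^ 2 from rfl, h3.fderiv,
    japInv, smul_smul, ← Nat.cast_smul_eq_nsmul ℝ 2, smul_smul]
  congr 1
  rcases L with _ | L
  · simp
  · have := hpos.ne'
    simp only [Nat.add_sub_cancel]
    field_simp
    push_cast
    ring

/-- The exponent `p` does not depend on `L`: a derivative of `(1 + ‖w‖²)^{-L}` of bounded order loses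
only a bounded power of `1 + ‖w‖`. -/
lemma exists_norm_iteratedFDeriv_japInv_le (m : ℕ) : ∃ p : ℕ, ∀ L : ℕ, ∃ C : ℝ, 0 ≤ C ∧
    ∀ j ≤ m, ∀ w, ‖iteratedFDeriv ℝ j (japInv L) w‖ ≤ C * (1 + ‖w‖) ^ p * japInv L w := by
  have hpos : ∀ L w, 0 ≤ japInv L w := fun L w => by
    have := one_add_sq_pos w
    unfold japInv; positivity
  induction m with
  | zero =>
    refine ⟨0, fun L => ⟨1, zero_le_one, fun j hj w => ?_⟩⟩
    obtain rfl : j = 0 := by omega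
    simp [abs_of_nonneg (hpos L w)]
  | succ m ih =>
    obtain ⟨p, hp⟩ := ih
    have ht : Function.HasTemperateGrowth fun w : C2 => innerSL ℝ w :=
      (innerSL ℝ : C2 →L[ℝ] C2 →L[ℝ] ℝ).hasTemperateGrowth
    obtain ⟨q, D, hD, hb⟩ := ht.norm_iteratedFDeriv_le_uniform m
    refine ⟨p + q, fun L => ?_⟩
    obtain ⟨C, hC, h⟩ := hp (L + 1)
    refine ⟨2 ^ m * (C * ((2 * L) * D)) + 1, by positivity, fun j hj w => ?_⟩
    have hw : 1 ≤ 1 + ‖w‖ := by linarith [norm_nonneg w]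
    rcases j with _ | j
    · rw [norm_iteratedFDeriv_zero, Real.norm_of_nonneg (hpos L w)]
      refine le_mul_of_one_le_left (hpos L w) (one_le_mul_of_one_le_of_one_le ?_ (one_le_pow₀ hw))
      linarith [show 0 ≤ 2 ^ m * (C * ((2 * L) * D)) by positivity]
    · rw [← norm_iteratedFDeriv_fderiv, fderiv_japInv]
      have hs : ContDiff ℝ ∞ fun w : C2 => (-(2 * L) : ℝ) • innerSL ℝ w := ht.1.const_smul _
      refine (norm_iteratedFDeriv_smul_le (contDiff_japInv (L + 1)) hs w (n := j)
        (by exact_mod_cast le_top)).trans ?_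
      have hle : japInv (L + 1) w ≤ japInv L w := by
        unfold japInv
        refine inv_anti₀ (by have := one_add_sq_pos w; positivity) (pow_le_pow_right₀ ?_ (by omega))
        linarith [sq_nonneg ‖w‖]
      have hd : ∀ i ≤ m, ‖iteratedFDeriv ℝ i (fun w : C2 => (-(2 * L) : ℝ) • innerSL ℝ w) w‖ ≤
          (2 * L) * (D * (1 + ‖w‖) ^ q) := by
        intro i hi
        have e : (fun w : C2 => (-(2 * L) : ℝ) • innerSL ℝ w) =
          (-(2 * L) : ℝ) • fun w : C2 => innerSL ℝ w := rfl
        rw [e, iteratedFDeriv_const_smul_apply (ht.1.contDiffAt.of_le (by exact_mod_cast le_top)),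
          norm_smul, norm_neg, Real.norm_of_nonneg (by positivity)]
        gcongr
        exact hb i hi w
      calc _ ≤ ∑ i ∈ Finset.range (j + 1), (j.choose i : ℝ) *
            (C * (1 + ‖w‖) ^ p * japInv L w) * ((2 * L) * (D * (1 + ‖w‖) ^ q)) := by
            have h0 := hpos (L + 1) w
            have h1 := hpos L w
            gcongr with i hi
            · refine (h i (by have := Finset.mem_range.mp hi; omega) w).trans ?_
              gcongr
            · exact hd _ (by omega)
        _ = 2 ^ j * (C * ((2 * L) * D)) * (1 + ‖w‖) ^ (p + q) * japInv L w := by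
            rw [← Finset.sum_mul, ← Finset.sum_mul, ← Nat.cast_sum, Nat.sum_range_choose]
            push_cast; ring
        _ ≤ _ := by
            have := hpos L w
            have h2 : (2 : ℝ) ^ j ≤ 2 ^ m := pow_le_pow_right₀ one_le_two (by omega)
            gcongr
            have : 2 ^ j * (C * ((2 * L) * D)) ≤ 2 ^ m * (C * ((2 * L) * D)) := by gcongr
            linarith

/-- The decay of `symCalc n g`, uniformly in `n` up to powers of `n + 1`: replace `g` by
`mulWeight^[L] g`, and divide by the corresponding power of `1 + ‖w‖²`. -/
lemma exists_decay_symCalc (a m : ℕ) : ∃ (C : ℝ) (q L : ℕ), 0 ≤ C ∧ ∀ (n : ℕ) (g : 𝓢(R2, ℂ)),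
    ∀ j ≤ m, ∀ w, (1 + ‖w‖) ^ a * ‖iteratedFDeriv ℝ j (symCalc n g) w‖ ≤
      C * ((n : ℝ) + 1) ^ q * fourierMoment q (mulWeight^[L] g) := by
  obtain ⟨C1, q, hC1, h1⟩ := exists_norm_iteratedFDeriv_symCalc_le m
  obtain ⟨p, hp⟩ := exists_norm_iteratedFDeriv_japInv_le m
  obtain ⟨C2, hC2, h2⟩ := hp (a + p + q)
  -- `p` powers of `1 + ‖w‖` are lost by `japInv`, `q` by `symCalc`; `L` exceeds `p + q` by the decay
  -- `a` that is wanted.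
  set L := a + p + q with hL
  refine ⟨2 ^ m * C2 * C1 * 2 ^ L, q, L, by positivity, fun n g j hj w => ?_⟩
  have heq : symCalc n g = fun w => japInv L w • symCalc n (mulWeight^[L] g) w := by
    ext1 w
    rw [symCalc_iterate_mulWeight, Complex.coe_smul, smul_smul, japInv, inv_mul_cancel₀, one_smul]
    exact (pow_pos (one_add_sq_pos w) L).ne'
  have hM : 0 ≤ fourierMoment q (mulWeight^[L] g) := integral_nonneg fun τ => by positivity
  have hj0 : 0 ≤ japInv L w := by have := one_add_sq_pos w; unfold japInv; positivity
  rw [heq]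
  have hb := norm_iteratedFDeriv_smul_le (contDiff_japInv L)
    (contDiff_symCalc n (mulWeight^[L] g)) w (n := j) (by exact_mod_cast le_top)
  have hkey : (1 + ‖w‖) ^ L * japInv L w ≤ 2 ^ L := by
    rw [japInv, ← div_eq_mul_inv, div_le_iff₀ (pow_pos (one_add_sq_pos w) L), ← mul_pow]
    refine pow_le_pow_left₀ (by positivity) ?_ L
    nlinarith [sq_nonneg (‖w‖ - 1)]
  calc _ ≤ (1 + ‖w‖) ^ a * ∑ i ∈ Finset.range (j + 1), (j.choose i : ℝ) *
        (C2 * (1 + ‖w‖) ^ p * japInv L w) *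
        (C1 * ((n : ℝ) + 1) ^ q * (1 + ‖w‖) ^ q * fourierMoment q (mulWeight^[L] g)) := by
        refine mul_le_mul_of_nonneg_left (hb.trans ?_) (by positivity)
        gcongr with i hi
        · exact h2 i (by have := Finset.mem_range.mp hi; omega) w
        · exact h1 n _ _ (by omega) w
    _ = 2 ^ j * C2 * C1 * ((1 + ‖w‖) ^ a * (1 + ‖w‖) ^ (p + q) * japInv L w) * ((n : ℝ) + 1) ^ q *
        fourierMoment q (mulWeight^[L] g) := by
        rw [← Finset.sum_mul, ← Finset.sum_mul, ← Nat.cast_sum, Nat.sum_range_choose]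
        push_cast; ring
    _ ≤ 2 ^ m * C2 * C1 * ((1 + ‖w‖) ^ a * (1 + ‖w‖) ^ (p + q) * japInv L w) * ((n : ℝ) + 1) ^ q *
        fourierMoment q (mulWeight^[L] g) := by
        gcongr
        norm_num
    _ = 2 ^ m * C2 * C1 * ((1 + ‖w‖) ^ L * japInv L w) * ((n : ℝ) + 1) ^ q *
        fourierMoment q (mulWeight^[L] g) := by rw [hL]; ring
    _ ≤ _ := by gcongr

/-- The Schwartz function `w ↦ g (σ(Δ_z)(w), σ(𝐃ₙ)(w))`. -/
noncomputable def symCalcS (n : ℕ) (g : 𝓢(R2, ℂ)) : 𝓢(C2, EndV n) where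
  toFun := symCalc n g
  smooth' := contDiff_symCalc n g
  decay' a m := by
    obtain ⟨C, q, L, _, h⟩ := exists_decay_symCalc a m
    refine ⟨_, fun w => le_trans ?_ (h n g m le_rfl w)⟩
    gcongr
    linarith

lemma symCalcS_apply (n : ℕ) (g : 𝓢(R2, ℂ)) (w : C2) : symCalcS n g w = symCalc n g w := rfl

/-- The inverse spherical transform of `g`. -/
noncomputable def invTransform (n : ℕ) (g : 𝓢(R2, ℂ)) : 𝓢(C2, EndV n) := 𝓕⁻ (symCalcS n g)

/-- The decay of the inverse transform, from bounds for the derivatives of its Fourier transform. -/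
lemma exists_decay_invTransform (a : ℕ) : ∃ (C : ℝ) (q L : ℕ), 0 ≤ C ∧ ∀ (n : ℕ) (g : 𝓢(R2, ℂ)),
    ∀ z, ‖z‖ ^ a * ‖invTransform n g z‖ ≤
      C * ((n : ℝ) + 1) ^ q * fourierMoment q (mulWeight^[L] g) := by
  -- `(1 + ‖w‖)^{-P}` is integrable.
  set P := (volume : Measure C2).integrablePower with hP
  obtain ⟨C, q, L, hC, h⟩ := exists_decay_symCalc P a
  set I := ∫ w : C2, (1 + ‖w‖) ^ (-(P : ℝ)) with hI
  have hI0 : 0 ≤ I := integral_nonneg fun w => by positivity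
  refine ⟨2 ^ a * ((a + 1) * (2 ^ P * I * (C + C))), q, L, by positivity, fun n g z => ?_⟩
  have hM : 0 ≤ fourierMoment q (mulWeight^[L] g) := integral_nonneg fun τ => by positivity
  set B := C * ((n : ℝ) + 1) ^ q * fourierMoment q (mulWeight^[L] g) with hB
  have hint : ∀ p ≤ a, ∫ w, ‖w‖ ^ 0 * ‖iteratedFDeriv ℝ p (symCalcS n g) w‖ ≤
      2 ^ P * I * (B + B) := by
    intro p hp
    refine integral_pow_mul_le_of_le_of_pow_mul_le (fun w => ?_) fun w => ?_
    · refine le_trans (le_mul_of_one_le_left (norm_nonneg _) ?_) (h n g p hp w)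
      exact one_le_pow₀ (by linarith [norm_nonneg w])
    · refine le_trans ?_ (h n g p hp w)
      rw [zero_add]
      gcongr
      · linarith
      · rfl
  have hF := Real.pow_mul_norm_iteratedFDeriv_fourier_le (K := ⊤) (N := ⊤) (k := 0) (n := a)
    ((symCalcS n g).smooth ⊤)
    (fun k m _ _ => (symCalcS n g).integrable_pow_mul_iteratedFDeriv volume k m)
    le_top le_top (-z)
  rw [norm_iteratedFDeriv_zero, norm_neg] at hF
  have hz : invTransform n g z = 𝓕 (symCalcS n g : C2 → EndV n) (-z) := by
    rw [invTransform, SchwartzMap.fourierInv_coe, Real.fourierInv_eq_fourier_neg]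
  rw [hz]
  refine hF.trans ?_
  have hsum : ∑ p ∈ Finset.range (0 + 1) ×ˢ Finset.range (a + 1),
      ∫ v, ‖v‖ ^ p.1 * ‖iteratedFDeriv ℝ p.2 (symCalcS n g) v‖ ≤
      ∑ p ∈ Finset.range (0 + 1) ×ˢ Finset.range (a + 1), 2 ^ P * I * (B + B) := by
    refine Finset.sum_le_sum fun p hp => ?_
    rw [Finset.mem_product, Finset.mem_range, Finset.mem_range] at hp
    obtain ⟨p1, p2⟩ := p
    obtain rfl : p1 = 0 := by simpa using hp.1
    exact hint p2 (by simpa [Nat.lt_succ_iff] using hp.2)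
  rw [Finset.sum_const, Finset.card_product, Finset.card_range, Finset.card_range,
    nsmul_eq_mul] at hsum
  calc _ ≤ (2 * Real.pi) ^ 0 * (2 * ((0 : ℕ) : ℝ) + 2) ^ a *
        (((0 + 1) * (a + 1) : ℕ) * (2 ^ P * I * (B + B))) := by gcongr
    _ = _ := by rw [hB]; push_cast; ring

/-! ### Schwartz norms on the plane -/

open scoped LineDeriv

section Laplacian

variable {E W : Type*} [NormedAddCommGroup E] [InnerProductSpace ℝ E] [FiniteDimensional ℝ E]
  [NormedAddCommGroup W] [NormedSpace ℝ W]

/-- The nonnegative Laplacian of a Schwartz function, as a Schwartz function. -/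
noncomputable def lapS (f : 𝓢(E, W)) : 𝓢(E, W) := -(Δ f)

lemma posLap_coe (f : 𝓢(E, W)) : posLap (f : E → W) = lapS f := by
  ext x
  simp [posLap, lapS, SchwartzMap.laplacian_apply]

lemma posLap_iterate_coe (f : 𝓢(E, W)) (q : ℕ) :
    posLap^[q] (f : E → W) = (lapS^[q] f : 𝓢(E, W)) := by
  induction q with
  | zero => rfl
  | succ q ih => rw [Function.iterate_succ_apply', ih, posLap_coe, Function.iterate_succ_apply']

lemma lapS_eq_sum {ι : Type*} [Fintype ι] (b : OrthonormalBasis ι ℝ E) (f : 𝓢(E, W)) :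
    lapS f = -∑ i, ∂_{b i} (∂_{b i} f) := by
  rw [lapS, SchwartzMap.laplacian_eq_sum b]

end Laplacian

/-- The standard unit vectors of `ℝ²`. -/
noncomputable def unitVec (i : Fin 2) : R2 := EuclideanSpace.single i 1

lemma lapS_plane (f : 𝓢(R2, ℂ)) : lapS f = -∑ i, ∂_{unitVec i} (∂_{unitVec i} f) := by
  simpa [unitVec] using lapS_eq_sum (EuclideanSpace.basisFun (Fin 2) ℝ) f

lemma inner_unitVec (τ : R2) (i : Fin 2) : inner ℝ τ (unitVec i) = τ i := by
  simp [unitVec, EuclideanSpace.inner_single_right]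

lemma fourier_lineDeriv_unitVec (f : 𝓢(R2, ℂ)) (i : Fin 2) (τ : R2) :
    𝓕 (∂_{unitVec i} f) τ = 2 * Real.pi * Complex.I * (τ i : ℂ) * (𝓕 f) τ := by
  have : (fun x : R2 => inner ℝ x (unitVec i)).HasTemperateGrowth := by fun_prop
  rw [SchwartzMap.fourier_lineDerivOp_eq, smul_apply,
    SchwartzMap.smulLeftCLM_apply_apply this, inner_unitVec, smul_eq_mul, Complex.real_smul]
  ring

lemma fourier_lapS (f : 𝓢(R2, ℂ)) (τ : R2) :
    𝓕 (lapS f) τ = ((4 * Real.pi ^ 2 * ‖τ‖ ^ 2 : ℝ) : ℂ) * (𝓕 f) τ := by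
  have h : 𝓕 (lapS f) = -∑ i, 𝓕 (∂_{unitVec i} (∂_{unitVec i} f)) := by
    rw [lapS_plane, ← SchwartzMap.fourierTransformCLM_apply (𝕜 := ℂ), map_neg, map_sum]
    rfl
  rw [h, neg_apply, sum_apply, Fin.sum_univ_two]
  simp only [fourier_lineDeriv_unitVec, EuclideanSpace.norm_sq_eq, Fin.sum_univ_two,
    Real.norm_eq_abs, sq_abs]
  push_cast
  ring_nf
  rw [Complex.I_sq]
  ring

lemma fourier_injective {f g : 𝓢(R2, ℂ)} (h : ∀ τ, (𝓕 f) τ = (𝓕 g) τ) : f = g := by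
  have : 𝓕 f = 𝓕 g := by ext τ; exact h τ
  calc f = 𝓕⁻ (𝓕 f) := (FourierTransform.fourierInv_fourier_eq f).symm
    _ = 𝓕⁻ (𝓕 g) := by rw [this]
    _ = g := FourierTransform.fourierInv_fourier_eq g

lemma lapS_lineDeriv (f : 𝓢(R2, ℂ)) (i : Fin 2) : lapS (∂_{unitVec i} f) = ∂_{unitVec i} (lapS f) :=
  fourier_injective fun τ => by
    rw [fourier_lapS, fourier_lineDeriv_unitVec, fourier_lineDeriv_unitVec, fourier_lapS]
    ring

lemma lineDeriv_mulCoord (f : 𝓢(R2, ℂ)) (i j : Fin 2) :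
    ∂_{unitVec j} (mulCoord i f) = (if i = j then f else 0) + mulCoord i (∂_{unitVec j} f) := by
  ext x
  have h1 : HasFDerivAt (fun x : R2 => ((x i : ℝ) : ℂ))
      (Complex.ofRealCLM.comp (EuclideanSpace.proj (𝕜 := ℝ) i : R2 →L[ℝ] ℝ)) x :=
    (Complex.ofRealCLM.comp (EuclideanSpace.proj (𝕜 := ℝ) i : R2 →L[ℝ] ℝ)).hasFDerivAt
  have h2 := h1.fun_mul (f.hasFDerivAt x)
  have h3 : (mulCoord i f : R2 → ℂ) = fun x => ((x i : ℝ) : ℂ) * f x := funext (mulCoord_apply i f)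
  rw [SchwartzMap.lineDerivOp_apply_eq_fderiv, h3, h2.fderiv, add_apply, add_apply, mulCoord_apply,
    SchwartzMap.lineDerivOp_apply_eq_fderiv]
  split_ifs with hij
  · subst hij
    simp [unitVec]
    ring
  · simp [unitVec, hij]

lemma lapS_mulCoord (f : 𝓢(R2, ℂ)) (i : Fin 2) :
    lapS (mulCoord i f) = mulCoord i (lapS f) - (2 : ℂ) • ∂_{unitVec i} f := by
  rw [lapS_plane, lapS_plane]
  simp only [lineDeriv_mulCoord, LineDeriv.lineDerivOp_add, Fin.sum_univ_two, map_neg, map_add]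
  fin_cases i <;> simp [two_smul] <;> abel

lemma lapS_add (f g : 𝓢(R2, ℂ)) : lapS (f + g) = lapS f + lapS g := by
  simp only [lapS, ← SchwartzMap.laplacianCLM_eq', map_add]; abel

lemma lapS_smul (c : ℂ) (f : 𝓢(R2, ℂ)) : lapS (c • f) = c • lapS f := by
  simp only [lapS, ← SchwartzMap.laplacianCLM_eq ℂ, map_smul, smul_neg]

lemma lapS_iterate_add (f g : 𝓢(R2, ℂ)) (q : ℕ) :
    lapS^[q] (f + g) = lapS^[q] f + lapS^[q] g := by
  induction q with
  | zero => rfl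
  | succ q ih => simp only [Function.iterate_succ_apply', ih, lapS_add]

lemma lapS_iterate_smul (c : ℂ) (f : 𝓢(R2, ℂ)) (q : ℕ) :
    lapS^[q] (c • f) = c • lapS^[q] f := by
  induction q with
  | zero => rfl
  | succ q ih => simp only [Function.iterate_succ_apply', ih, lapS_smul]

/-- The commutator of a power of the Laplacian with multiplication by a coordinate. -/
lemma lapS_iterate_mulCoord (f : 𝓢(R2, ℂ)) (i : Fin 2) (q : ℕ) :
    lapS^[q + 1] (mulCoord i f) =
      mulCoord i (lapS^[q + 1] f) + (-(2 * (q + 1)) : ℂ) • ∂_{unitVec i} (lapS^[q] f) := by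
  induction q with
  | zero => simp [lapS_mulCoord, sub_eq_add_neg]
  | succ q ih =>
    rw [Function.iterate_succ_apply', ih, lapS_add, lapS_smul, lapS_mulCoord, lapS_lineDeriv,
      ← Function.iterate_succ_apply' lapS, ← Function.iterate_succ_apply' lapS, sub_eq_add_neg,
      add_assoc, ← neg_smul, ← add_smul]
    congr 2
    push_cast; ring

/-- Multiplication by `(1 + |x|²)^a`. -/
noncomputable def mulOmega (a : ℕ) : 𝓢(R2, ℂ) →L[ℝ] 𝓢(R2, ℂ) :=
  SchwartzMap.smulLeftCLM ℂ fun x : R2 => (1 + ‖x‖ ^ 2) ^ a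

lemma hasTemperateGrowth_omega (a : ℕ) :
    Function.HasTemperateGrowth fun x : R2 => (1 + ‖x‖ ^ 2) ^ a := by fun_prop

lemma mulOmega_apply (a : ℕ) (f : 𝓢(R2, ℂ)) (x : R2) :
    mulOmega a f x = (1 + ‖x‖ ^ 2) ^ a • f x := by
  rw [mulOmega, SchwartzMap.smulLeftCLM_apply_apply (hasTemperateGrowth_omega a)]

/-- The norm of `(1 + |x|²)^a f` in `L²(ℝ²)`. -/
noncomputable def wnorm (a : ℕ) (f : 𝓢(R2, ℂ)) : ℝ := ‖(mulOmega a f).toLp 2‖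

lemma norm_toLp_two (f : 𝓢(R2, ℂ)) : ‖f.toLp 2‖ = √(∫ x, ‖f x‖ ^ 2) := by
  rw [SchwartzMap.norm_toLp' (by norm_num) (by norm_num), Real.sqrt_eq_rpow]
  norm_num

lemma norm_mulOmega_apply (a : ℕ) (f : 𝓢(R2, ℂ)) (x : R2) :
    ‖mulOmega a f x‖ = (1 + ‖x‖ ^ 2) ^ a * ‖f x‖ := by
  rw [mulOmega_apply, norm_smul, Real.norm_of_nonneg (by positivity)]

lemma wnorm_eq (a : ℕ) (f : 𝓢(R2, ℂ)) : wnorm a f = √(∫ x, ((1 + ‖x‖ ^ 2) ^ a * ‖f x‖) ^ 2) := by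
  rw [wnorm, norm_toLp_two]
  simp only [norm_mulOmega_apply]

lemma wnorm_nonneg (a : ℕ) (f : 𝓢(R2, ℂ)) : 0 ≤ wnorm a f := norm_nonneg _

lemma integrable_norm_sq (f : 𝓢(R2, ℂ)) : Integrable fun x => ‖f x‖ ^ 2 := by
  have h := f.memLp 2 volume
  exact h.integrable_norm_pow (by norm_num)

lemma norm_toLp_two_le {f g : 𝓢(R2, ℂ)} (h : ∀ x, ‖f x‖ ≤ ‖g x‖) : ‖f.toLp 2‖ ≤ ‖g.toLp 2‖ := by
  rw [norm_toLp_two, norm_toLp_two]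
  refine Real.sqrt_le_sqrt (integral_mono (integrable_norm_sq f) (integrable_norm_sq g) fun x => ?_)
  exact pow_le_pow_left₀ (norm_nonneg _) (h x) 2

lemma integral_norm_mul_norm_le (f g : 𝓢(R2, ℂ)) :
    ∫ x, ‖f x‖ * ‖g x‖ ≤ ‖f.toLp 2‖ * ‖g.toLp 2‖ := by
  have h := integral_mul_le_Lp_mul_Lq_of_nonneg (μ := (volume : Measure R2))
    (p := 2) (q := 2) (by constructor <;> norm_num)
    (Filter.Eventually.of_forall fun x => norm_nonneg (f x))
    (Filter.Eventually.of_forall fun x => norm_nonneg (g x))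
    (by simpa using (f.memLp 2 volume).norm) (by simpa using (g.memLp 2 volume).norm)
  rw [norm_toLp_two, norm_toLp_two, Real.sqrt_eq_rpow, Real.sqrt_eq_rpow]
  simpa using h

lemma wnorm_mono {a b : ℕ} (h : a ≤ b) (f : 𝓢(R2, ℂ)) : wnorm a f ≤ wnorm b f := by
  refine norm_toLp_two_le fun x => ?_
  rw [norm_mulOmega_apply, norm_mulOmega_apply]
  gcongr
  linarith [sq_nonneg ‖x‖]

lemma wnorm_add_le (a : ℕ) (f g : 𝓢(R2, ℂ)) : wnorm a (f + g) ≤ wnorm a f + wnorm a g := by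
  rw [wnorm, map_add, ← SchwartzMap.toLpCLM_apply (𝕜 := ℝ), map_add]
  exact norm_add_le _ _

lemma wnorm_smul (a : ℕ) (c : ℂ) (f : 𝓢(R2, ℂ)) : wnorm a (c • f) = ‖c‖ * wnorm a f := by
  have : mulOmega a (c • f) = c • mulOmega a f := by
    ext x
    simp only [mulOmega_apply, smul_apply, smul_comm c]
  rw [wnorm, this, ← SchwartzMap.toLpCLM_apply (𝕜 := ℂ), map_smul, norm_smul]
  rfl

lemma wnorm_mulCoord_le (a : ℕ) (i : Fin 2) (f : 𝓢(R2, ℂ)) :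
    wnorm a (mulCoord i f) ≤ wnorm (a + 1) f := by
  refine norm_toLp_two_le fun x => ?_
  rw [norm_mulOmega_apply, norm_mulOmega_apply, mulCoord_apply, norm_mul, pow_succ _ a, mul_assoc]
  gcongr
  rw [Complex.norm_real, Real.norm_eq_abs]
  have := abs_coord_le x i
  nlinarith [sq_nonneg (‖x‖ - 1), norm_nonneg x]

lemma wnorm_fourier (f : 𝓢(R2, ℂ)) : ‖(𝓕 f).toLp 2‖ = wnorm 0 f := by
  rw [SchwartzMap.norm_fourier_toL2_eq, norm_toLp_two, wnorm_eq]
  simp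

lemma wnorm_lineDeriv_two_le (i : Fin 2) (f : 𝓢(R2, ℂ)) :
    wnorm 0 (∂_{unitVec i} (∂_{unitVec i} f)) ≤ wnorm 0 (lapS f) := by
  rw [← wnorm_fourier, ← wnorm_fourier]
  refine norm_toLp_two_le fun τ => ?_
  rw [fourier_lineDeriv_unitVec, fourier_lineDeriv_unitVec, fourier_lapS, ← mul_assoc, norm_mul,
    norm_mul (Complex.ofReal _)]
  gcongr
  have h : (2 * Real.pi * Complex.I * (τ i : ℂ) * (2 * Real.pi * Complex.I * (τ i : ℂ)) : ℂ) =
      ((-(4 * Real.pi ^ 2 * (τ i) ^ 2) : ℝ) : ℂ) := by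
    push_cast; ring_nf; rw [Complex.I_sq]; ring
  rw [h, Complex.norm_real, Complex.norm_real, norm_neg, Real.norm_of_nonneg (by positivity),
    Real.norm_of_nonneg (by positivity)]
  have := abs_coord_le τ i
  gcongr 4 * _ * ?_
  rw [← sq_abs]
  gcongr

lemma lineDeriv_mulOmega (a : ℕ) (i : Fin 2) (f : 𝓢(R2, ℂ)) (x : R2) :
    ∂_{unitVec i} (mulOmega a f) x = (1 + ‖x‖ ^ 2) ^ a • ∂_{unitVec i} f x +
      (2 * a * x i * (1 + ‖x‖ ^ 2) ^ (a - 1)) • f x := by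
  have h1 : HasFDerivAt (fun x : R2 => 1 + ‖x‖ ^ 2) (2 • innerSL ℝ x) x :=
    (hasStrictFDerivAt_norm_sq x).hasFDerivAt.const_add 1
  have h4 : HasFDerivAt (fun x : R2 => (1 + ‖x‖ ^ 2) ^ a) _ x := h1.pow a
  have h2 := h4.fun_smul (f.hasFDerivAt x)
  have h3 : (mulOmega a f : R2 → ℂ) = fun x => (1 + ‖x‖ ^ 2) ^ a • f x := funext (mulOmega_apply a f)
  rw [SchwartzMap.lineDerivOp_apply_eq_fderiv, h3]
  rw [h2.fderiv, SchwartzMap.lineDerivOp_apply_eq_fderiv]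
  simp only [add_apply, smul_apply, ContinuousLinearMap.smulRight_apply, innerSL_apply_apply,
    inner_unitVec, nsmul_eq_mul, smul_eq_mul]
  congr 2
  ring

/-- The weighted interpolation inequality behind the fact that first derivatives are controlled by
powers of the Laplacian: integrate by parts in `∫ (1 + |x|²)^{2a} |∂ᵢf|²`. -/
lemma wnorm_lineDeriv_sq_le (a : ℕ) (i : Fin 2) (f : 𝓢(R2, ℂ)) :
    wnorm a (∂_{unitVec i} f) ^ 2 ≤ wnorm (2 * a) f *
      (wnorm 0 (∂_{unitVec i} (∂_{unitVec i} f)) + 4 * a * wnorm 0 (∂_{unitVec i} f)) := by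
  set D := ∂_{unitVec i} f with hD
  have h1 : wnorm a D ^ 2 = ∫ x, inner ℝ (mulOmega (2 * a) D x) (D x) := by
    rw [wnorm_eq, Real.sq_sqrt (integral_nonneg fun x => sq_nonneg _)]
    refine integral_congr_ae (Filter.Eventually.of_forall fun x => ?_)
    simp only [mulOmega_apply, real_inner_smul_left, real_inner_self_eq_norm_sq]
    ring
  have h2 : ∫ x, inner ℝ (mulOmega (2 * a) D x) (D x) =
      -∫ x, inner ℝ (∂_{unitVec i} (mulOmega (2 * a) D) x) (f x) :=
    SchwartzMap.integral_bilinear_lineDerivOp_right_eq_neg_left (mulOmega (2 * a) D) f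
      (innerSL ℝ : ℂ →L[ℝ] ℂ →L[ℝ] ℝ) (unitVec i)
  rw [h1, h2]
  have hint : ∀ u v : 𝓢(R2, ℂ), Integrable fun x => ‖u x‖ * ‖v x‖ := fun u v =>
    (SchwartzMap.pairing (ContinuousLinearMap.mul ℝ ℂ) u v).integrable.norm.congr
      (Filter.Eventually.of_forall fun x => by simp)
  have hzero : ∀ u : 𝓢(R2, ℂ), ‖u.toLp 2‖ = wnorm 0 u := fun u => by
    rw [norm_toLp_two, wnorm_eq]; simp
  calc -∫ x, inner ℝ (∂_{unitVec i} (mulOmega (2 * a) D) x) (f x)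
      ≤ ∫ x, (‖mulOmega (2 * a) f x‖ * ‖∂_{unitVec i} D x‖ +
          4 * a * (‖mulOmega (2 * a) f x‖ * ‖D x‖)) := by
        rw [← integral_neg]
        refine integral_mono ?_ ((hint _ _).add ((hint _ _).const_mul _)) fun x => ?_
        · exact (SchwartzMap.pairing (innerSL ℝ : ℂ →L[ℝ] ℂ →L[ℝ] ℝ)
            (∂_{unitVec i} (mulOmega (2 * a) D)) f).integrable.neg
        · have hx := abs_coord_le x i
          have hb : |x i| * (1 + ‖x‖ ^ 2) ^ (2 * a - 1) * a ≤ (1 + ‖x‖ ^ 2) ^ (2 * a) * a := by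
            rcases a with _ | a
            · simp
            · gcongr ?_ * _
              rw [show 2 * (a + 1) = 2 * (a + 1) - 1 + 1 by omega, Nat.add_sub_cancel,
                pow_succ' _ (2 * (a + 1) - 1)]
              gcongr
              nlinarith [sq_nonneg (‖x‖ - 1), norm_nonneg x]
          have hnorm : ‖∂_{unitVec i} (mulOmega (2 * a) D) x‖ ≤
              (1 + ‖x‖ ^ 2) ^ (2 * a) * ‖∂_{unitVec i} D x‖ +
                4 * a * (1 + ‖x‖ ^ 2) ^ (2 * a) * ‖D x‖ := by
            rw [lineDeriv_mulOmega]
            refine (norm_add_le _ _).trans ?_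
            rw [norm_smul, norm_smul, Real.norm_of_nonneg (by positivity)]
            gcongr
            rw [Real.norm_eq_abs, abs_mul, abs_mul, abs_of_nonneg (by positivity),
              abs_of_nonneg (show 0 ≤ (1 + ‖x‖ ^ 2) ^ (2 * a - 1) by positivity)]
            push_cast
            linarith
          refine (neg_le_abs _).trans ((abs_real_inner_le_norm _ _).trans ?_)
          rw [norm_mulOmega_apply]
          refine (mul_le_mul_of_nonneg_right hnorm (norm_nonneg _)).trans (le_of_eq ?_)
          ring
    _ = (∫ x, ‖mulOmega (2 * a) f x‖ * ‖∂_{unitVec i} D x‖) +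
          4 * a * ∫ x, ‖mulOmega (2 * a) f x‖ * ‖D x‖ := by
        rw [integral_add (hint _ _) ((hint _ _).const_mul _), integral_const_mul]
    _ ≤ wnorm (2 * a) f * wnorm 0 (∂_{unitVec i} D) +
          4 * a * (wnorm (2 * a) f * wnorm 0 D) := by
        rw [← hzero, ← hzero]
        gcongr
        · exact integral_norm_mul_norm_le _ _
        · exact integral_norm_mul_norm_le _ _
    _ = _ := by ring

/-- The first derivative on the right of `wnorm_lineDeriv_sq_le` is removed by the case `a = 0`, which
bounds it by `f` and its second derivatives; these are controlled by `Δf`. -/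
lemma wnorm_lineDeriv_le (a : ℕ) (i : Fin 2) (f : 𝓢(R2, ℂ)) :
    wnorm a (∂_{unitVec i} f) ≤
      (2 + 4 * a) * (wnorm (2 * a) f + wnorm 0 f + wnorm 0 (lapS f)) := by
  have h2 := wnorm_lineDeriv_two_le i f
  have h0 := wnorm_lineDeriv_sq_le 0 i f
  have ha := wnorm_lineDeriv_sq_le a i f
  have p1 := wnorm_nonneg (2 * a) f
  have p2 := wnorm_nonneg 0 f
  have p3 := wnorm_nonneg 0 (lapS f)
  have p4 := wnorm_nonneg 0 (∂_{unitVec i} (∂_{unitVec i} f))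
  have p5 := wnorm_nonneg 0 (∂_{unitVec i} f)
  set S := wnorm (2 * a) f + wnorm 0 f + wnorm 0 (lapS f) with hS
  simp only [mul_zero, Nat.cast_zero, zero_mul, add_zero] at h0
  have hS0 : 0 ≤ S := by positivity
  -- The case `a = 0` reads `wnorm 0 (∂ᵢf)² ≤ wnorm 0 f * wnorm 0 (∂ᵢ∂ᵢf)`.
  have hd : wnorm 0 (∂_{unitVec i} f) ≤ S := by
    refine abs_le_of_sq_le_sq' ?_ hS0 |>.2
    nlinarith
  refine abs_le_of_sq_le_sq' ?_ (by positivity) |>.2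
  have ha0 : (0 : ℝ) ≤ a := Nat.cast_nonneg a
  calc _ ≤ _ := ha
    _ ≤ S * (S + 4 * a * S) := by gcongr <;> linarith
    _ ≤ _ := by nlinarith [mul_nonneg ha0 (sq_nonneg S),
        mul_nonneg (sq_nonneg (a : ℝ)) (sq_nonneg S), sq_nonneg S]

lemma schwartzNorm_le_iff {M : ℕ} {f : 𝓢(R2, ℂ)} {c : ℝ} :
    schwartzNorm M f ≤ c ↔ ∀ q ≤ M, wnorm M (lapS^[q] f) ≤ c := by
  rw [schwartzNorm, Finset.sup'_le_iff]
  simp only [Finset.mem_range, Nat.lt_succ_iff, posLap_iterate_coe, wnorm_eq]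

lemma wnorm_le_schwartzNorm {a q M : ℕ} (ha : a ≤ M) (hq : q ≤ M) (f : 𝓢(R2, ℂ)) :
    wnorm a (lapS^[q] f) ≤ schwartzNorm M f :=
  (wnorm_mono ha _).trans (schwartzNorm_le_iff.1 le_rfl q hq)

lemma schwartzNorm_nonneg (M : ℕ) (f : 𝓢(R2, ℂ)) : 0 ≤ schwartzNorm M f :=
  (wnorm_nonneg _ _).trans (wnorm_le_schwartzNorm (q := 0) le_rfl (Nat.zero_le M) f)

lemma schwartzNorm_mono {M N : ℕ} (h : M ≤ N) (f : 𝓢(R2, ℂ)) :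
    schwartzNorm M f ≤ schwartzNorm N f :=
  schwartzNorm_le_iff.2 fun _ hq => wnorm_le_schwartzNorm h (hq.trans h) f

/-- An operator on Schwartz functions is tame if each norm of the image is controlled by some norm
of the argument. -/
def Tame (T : 𝓢(R2, ℂ) → 𝓢(R2, ℂ)) : Prop :=
  ∀ M, ∃ (N : ℕ) (C : ℝ), 0 ≤ C ∧ ∀ f, schwartzNorm M (T f) ≤ C * schwartzNorm N f

lemma Tame.comp {S T : 𝓢(R2, ℂ) → 𝓢(R2, ℂ)} (hS : Tame S) (hT : Tame T) : Tame (S ∘ T) := by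
  intro M
  obtain ⟨N, C, hC, h⟩ := hS M
  obtain ⟨N', C', hC', h'⟩ := hT N
  refine ⟨N', C * C', by positivity, fun f => (h _).trans ?_⟩
  rw [mul_assoc]
  exact mul_le_mul_of_nonneg_left (h' f) hC

lemma tame_id : Tame id := fun M => ⟨M, 1, zero_le_one, fun f => by simp⟩

lemma Tame.iterate {T : 𝓢(R2, ℂ) → 𝓢(R2, ℂ)} (hT : Tame T) (q : ℕ) : Tame T^[q] := by
  induction q with
  | zero => exact tame_id
  | succ q ih => exact ih.comp hT

/-- The perturbations of the identity by multiples of a tame operator are tame. -/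
lemma Tame.id_add_smul {T : 𝓢(R2, ℂ) → 𝓢(R2, ℂ)} (hT : Tame T) (c : ℂ) :
    Tame fun f => f + c • T f := by
  intro M
  obtain ⟨N, C, hC, h⟩ := hT M
  refine ⟨max M N, 1 + ‖c‖ * C, by positivity, fun f => schwartzNorm_le_iff.2 fun q hq => ?_⟩
  rw [lapS_iterate_add, lapS_iterate_smul]
  refine (wnorm_add_le _ _ _).trans ?_
  rw [wnorm_smul]
  have h1 := wnorm_le_schwartzNorm le_rfl hq (T f)
  have h2 := schwartzNorm_mono (le_max_right M N) f
  have h3 := schwartzNorm_mono (le_max_left M N) f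
  have h4 := wnorm_le_schwartzNorm le_rfl hq f
  calc _ ≤ schwartzNorm (max M N) f + ‖c‖ * (C * schwartzNorm (max M N) f) := by
        gcongr
        · exact h4.trans h3
        · exact h1.trans ((h f).trans (by gcongr))
    _ = _ := by ring

lemma tame_lapS : Tame lapS := fun M => ⟨M + 1, 1, zero_le_one, fun f =>
  schwartzNorm_le_iff.2 fun q hq => by
    rw [one_mul, ← Function.iterate_succ_apply]
    exact wnorm_le_schwartzNorm (Nat.le_succ M) (Nat.succ_le_succ hq) f⟩

/-- Multiplication by a coordinate is tame. The norms contain no odd derivatives, so the first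
derivatives in its commutators with the powers of the Laplacian need `wnorm_lineDeriv_le`. -/
lemma tame_mulCoord (i : Fin 2) : Tame (mulCoord i) := by
  intro M
  refine ⟨2 * M + 1, 1 + 2 * M * ((2 + 4 * M) * 3), by positivity, fun f =>
    schwartzNorm_le_iff.2 fun q hq => ?_⟩
  set S := schwartzNorm (2 * M + 1) f with hS
  have hS0 : 0 ≤ S := schwartzNorm_nonneg _ _
  have h1 : ∀ q ≤ M, wnorm M (mulCoord i (lapS^[q] f)) ≤ S := fun q hq =>
    (wnorm_mulCoord_le _ _ _).trans (wnorm_le_schwartzNorm (by omega) (by omega) f)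
  rcases q with _ | q
  · refine (h1 0 hq).trans (le_mul_of_one_le_left hS0 ?_)
    linarith [show (0 : ℝ) ≤ 2 * M * ((2 + 4 * M) * 3) by positivity]
  · rw [lapS_iterate_mulCoord]
    refine (wnorm_add_le _ _ _).trans ?_
    have h2 : wnorm M (∂_{unitVec i} (lapS^[q] f)) ≤ (2 + 4 * M) * (S + S + S) := by
      refine (wnorm_lineDeriv_le _ _ _).trans ?_
      rw [← Function.iterate_succ_apply' lapS]
      gcongr
      · exact wnorm_le_schwartzNorm (by omega) (by omega) f
      · exact wnorm_le_schwartzNorm (by omega) (by omega) f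
      · exact wnorm_le_schwartzNorm (by omega) (by omega) f
    have h3 : ‖(-(2 * (q + 1)) : ℂ)‖ ≤ 2 * M := by
      rw [norm_neg, norm_mul, Complex.norm_ofNat]
      have : ((q : ℂ) + 1) = ((q + 1 : ℕ) : ℂ) := by push_cast; rfl
      rw [this, Complex.norm_natCast]
      gcongr
    rw [wnorm_smul]
    calc _ ≤ S + 2 * M * ((2 + 4 * M) * (S + S + S)) := by
          have := wnorm_nonneg M (∂_{unitVec i} (lapS^[q] f))
          gcongr
          exact h1 _ hq
      _ = _ := by ring

lemma tame_mulWeight : Tame mulWeight := (tame_mulCoord 0).id_add_smul _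

/-- The moments of the Fourier transform are controlled by the Schwartz norms: by the
Cauchy-Schwarz inequality and Plancherel's theorem. -/
lemma exists_fourierMoment_le (q : ℕ) : ∃ (N : ℕ) (C : ℝ), 0 ≤ C ∧ ∀ g : 𝓢(R2, ℂ),
    fourierMoment q g ≤ C * schwartzNorm N g := by
  -- `B` corresponds to multiplication by `1 + ‖τ‖²` on the Fourier side; one of the `q + 1` factors is
  -- spent on the integrability of `(1 + ‖τ‖²)⁻²`.
  set B : 𝓢(R2, ℂ) → 𝓢(R2, ℂ) := fun f => f + (((4 * Real.pi ^ 2)⁻¹ : ℝ) : ℂ) • lapS f with hB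
  have hBt : Tame B := tame_lapS.id_add_smul _
  obtain ⟨N, C, hC, h⟩ := hBt.iterate (q + 1) 0
  have hF : ∀ f τ, (𝓕 (B f)) τ = ((1 + ‖τ‖ ^ 2 : ℝ) : ℂ) * (𝓕 f) τ := by
    intro f τ
    have : 𝓕 (B f) = 𝓕 f + (((4 * Real.pi ^ 2)⁻¹ : ℝ) : ℂ) • 𝓕 (lapS f) := by
      rw [hB, FourierTransform.fourier_add, FourierTransform.fourier_smul]
    have hpi : (Real.pi : ℂ) ≠ 0 := by exact_mod_cast Real.pi_ne_zero
    rw [this, add_apply, smul_apply, fourier_lapS, smul_eq_mul]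
    push_cast
    field_simp
  have hFi : ∀ k f τ, ‖(𝓕 (B^[k] f)) τ‖ = (1 + ‖τ‖ ^ 2) ^ k * ‖(𝓕 f) τ‖ := by
    intro k f τ
    induction k with
    | zero => simp
    | succ k ih =>
      rw [Function.iterate_succ_apply', hF, norm_mul, ih, Complex.norm_real,
        Real.norm_of_nonneg (by positivity)]
      ring
  have hw : Integrable fun τ : R2 => (((1 + ‖τ‖ ^ 2)⁻¹) ^ 2 : ℝ) := by
    have := integrable_rpow_neg_one_add_norm_sq (E := R2) (μ := volume) (r := 4)
      (by rw [finrank_euclideanSpace]; norm_num)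
    refine this.congr (Filter.Eventually.of_forall fun τ => ?_)
    have hp : 0 < 1 + ‖τ‖ ^ 2 := by positivity
    simp only
    rw [show (-4 / 2 : ℝ) = ((-2 : ℤ) : ℝ) by norm_num, Real.rpow_intCast, zpow_neg, inv_pow]
    rfl
  set W := √(∫ τ : R2, (((1 + ‖τ‖ ^ 2)⁻¹) ^ 2 : ℝ)) with hW
  refine ⟨N, 2 ^ q * W * C, by positivity, fun g => ?_⟩
  set G := B^[q + 1] g with hG
  have hwm : MemLp (fun τ : R2 => ((1 + ‖τ‖ ^ 2)⁻¹ : ℝ)) (ENNReal.ofReal 2) volume := by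
    have hc : Continuous fun τ : R2 => ((1 + ‖τ‖ ^ 2)⁻¹ : ℝ) :=
      Continuous.inv₀ (by fun_prop) fun τ => by positivity
    rw [ENNReal.ofReal_ofNat, memLp_two_iff_integrable_sq hc.aestronglyMeasurable]
    exact hw
  have hcs := integral_mul_le_Lp_mul_Lq_of_nonneg (μ := (volume : Measure R2))
    (p := 2) (q := 2) (by constructor <;> norm_num)
    (f := fun τ : R2 => ((1 + ‖τ‖ ^ 2)⁻¹ : ℝ)) (g := fun τ => ‖(𝓕 G) τ‖)
    (Filter.Eventually.of_forall fun τ => by simp only [Pi.zero_apply]; positivity)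
    (Filter.Eventually.of_forall fun τ => norm_nonneg _)
    hwm (by simpa using ((𝓕 G).memLp 2 volume).norm)
  have hcs' : ∫ τ : R2, (1 + ‖τ‖ ^ 2)⁻¹ * ‖(𝓕 G) τ‖ ≤ W * wnorm 0 G := by
    rw [← wnorm_fourier, norm_toLp_two, hW, Real.sqrt_eq_rpow, Real.sqrt_eq_rpow]
    simpa using hcs
  calc fourierMoment q g ≤ ∫ τ : R2, 2 ^ q * ((1 + ‖τ‖ ^ 2)⁻¹ * ‖(𝓕 G) τ‖) := by
        refine integral_mono_of_nonneg (Filter.Eventually.of_forall fun τ => by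
          simp only [Pi.zero_apply]; positivity) ?_ (Filter.Eventually.of_forall fun τ => ?_)
        · refine Integrable.const_mul ?_ _
          refine (𝓕 G).integrable.norm.mono' ?_ (Filter.Eventually.of_forall fun τ => ?_)
          · have hc : Continuous fun τ : R2 => ((1 + ‖τ‖ ^ 2)⁻¹ : ℝ) :=
              Continuous.inv₀ (by fun_prop) fun τ => by positivity
            exact (hc.mul (𝓕 G).continuous.norm).aestronglyMeasurable
          · rw [Real.norm_of_nonneg (by positivity)]
            refine mul_le_of_le_one_left (norm_nonneg _) (inv_le_one_of_one_le₀ ?_)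
            linarith [sq_nonneg ‖τ‖]
        · have hp : 0 < 1 + ‖τ‖ ^ 2 := by positivity
          simp only
          have e : 2 ^ q * ((1 + ‖τ‖ ^ 2)⁻¹ * ‖(𝓕 G) τ‖) =
              (2 * (1 + ‖τ‖ ^ 2)) ^ q * ‖(𝓕 g) τ‖ := by
            rw [hG, hFi, mul_pow]
            field_simp
            ring
          rw [e]
          gcongr
          nlinarith [sq_nonneg (‖τ‖ - 1)]
    _ = 2 ^ q * ∫ τ : R2, (1 + ‖τ‖ ^ 2)⁻¹ * ‖(𝓕 G) τ‖ := integral_const_mul _ _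
    _ ≤ 2 ^ q * (W * (C * schwartzNorm N g)) := by
        gcongr
        exact hcs'.trans (by
          gcongr
          exact (wnorm_le_schwartzNorm (q := 0) le_rfl le_rfl G).trans (h g))
    _ = _ := by ring

/-- All the quantities by which the inverse transform is estimated are controlled by the Schwartz
norms of `g`. -/
lemma exists_fourierMoment_iterate_le (q L p : ℕ) : ∃ (N : ℕ) (C : ℝ), 0 ≤ C ∧ ∀ g : 𝓢(R2, ℂ),
    fourierMoment q (mulWeight^[L] ((mulCoord 0)^[p] g)) ≤ C * schwartzNorm N g := by
  obtain ⟨N, C, hC, h⟩ := exists_fourierMoment_le q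
  obtain ⟨N', C', hC', h'⟩ := ((tame_mulWeight.iterate L).comp ((tame_mulCoord 0).iterate p)) N
  refine ⟨N', C * C', by positivity, fun g => (h _).trans ?_⟩
  rw [mul_assoc]
  exact mul_le_mul_of_nonneg_left (h' g) hC

/-! ### The differential operators and their symbols -/

/-- The second directional derivative `∂_u ∂_v F`. -/
noncomputable def dd {W : Type} [NormedAddCommGroup W] [NormedSpace ℝ W] (u v : C2) (F : C2 → W)
    (z : C2) : W :=
  fderiv ℝ (fun y => fderiv ℝ F y v) z u

section dd

variable {W : Type} [NormedAddCommGroup W] [NormedSpace ℝ W]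

lemma dd_eq_iteratedFDeriv {F : C2 → W} (hF : ContDiff ℝ ∞ F) (u v z : C2) :
    dd u v F z = iteratedFDeriv ℝ 2 F z ![u, v] := by
  have h : DifferentiableAt ℝ (fderiv ℝ F) z :=
    ((hF.fderiv_right (m := 1) (by norm_cast)).differentiable one_ne_zero).differentiableAt
  rw [iteratedFDeriv_two_apply, dd, fderiv_clm_apply h (differentiableAt_const v)]
  simp

lemma dd_comm {F : C2 → W} (hF : ContDiff ℝ ∞ F) (u v z : C2) : dd u v F z = dd v u F z := by
  have h := (hF.contDiffAt (x := z)).isSymmSndFDerivAt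
    (by
      rw [minSmoothness_of_isRCLikeNormedField]
      exact WithTop.coe_le_coe.2 (le_top : (2 : ℕ∞) ≤ ⊤))
  have h2 := h.eq u v
  rw [dd_eq_iteratedFDeriv hF, dd_eq_iteratedFDeriv hF, iteratedFDeriv_two_apply,
    iteratedFDeriv_two_apply]
  simpa using h2

lemma norm_dd_le {F : C2 → W} (hF : ContDiff ℝ ∞ F) (u v z : C2) :
    ‖dd u v F z‖ ≤ ‖iteratedFDeriv ℝ 2 F z‖ * (‖u‖ * ‖v‖) := by
  rw [dd_eq_iteratedFDeriv hF]
  refine ((iteratedFDeriv ℝ 2 F z).le_opNorm _).trans (le_of_eq ?_)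
  simp [Fin.prod_univ_two]

lemma contDiff_fderiv_apply {F : C2 → W} (hF : ContDiff ℝ ∞ F) (v : C2) :
    ContDiff ℝ ∞ fun y => fderiv ℝ F y v :=
  (hF.fderiv_right (m := ∞) (by norm_cast)).clm_apply contDiff_const

lemma contDiff_dd {F : C2 → W} (hF : ContDiff ℝ ∞ F) (u v : C2) : ContDiff ℝ ∞ (dd u v F) :=
  contDiff_fderiv_apply (contDiff_fderiv_apply hF v) u

end dd

lemma orthonormal_rdir : Orthonormal ℝ rdir := by
  rw [orthonormal_iff_ite]
  intro i j
  fin_cases i <;> fin_cases j <;> simp [rdir, inner_single]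

lemma posLap_eq_sum {n : ℕ} {F : C2 → EndV n} (z : C2) (hF : ContDiff ℝ ∞ F) :
    posLap F z = ∑ p, (-(1 : EndV n)) * dd (rdir p) (rdir p) F z := by
  have hc : Module.finrank ℝ C2 = Fintype.card (Fin 4) := by
    rw [← Module.finrank_mul_finrank ℝ ℂ C2, finrank_euclideanSpace, Complex.finrank_real_complex]
    rfl
  let b := (basisOfOrthonormalOfCardEqFinrank orthonormal_rdir hc.symm)
  let o : OrthonormalBasis (Fin 4) ℝ C2 := b.toOrthonormalBasis (by
    simpa [b] using orthonormal_rdir)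
  have ho : ∀ p, o p = rdir p := fun p => by simp [o, b]
  rw [posLap, InnerProductSpace.laplacian_eq_iteratedFDeriv_orthonormalBasis F o,
    ← Finset.sum_neg_distrib]
  refine Finset.sum_congr rfl fun p _ => ?_
  rw [ho, dd_eq_iteratedFDeriv hF, neg_one_mul]

lemma fderiv_dz {n : ℕ} {F : C2 → EndV n} (hF : ContDiff ℝ ∞ F) (j : Fin 2) (z u : C2) :
    fderiv ℝ (dz j F) z u = (1 / 2 : ℂ) • (dd u (EuclideanSpace.single j 1) F z -
      Complex.I • dd u (EuclideanSpace.single j Complex.I) F z) := by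
  have h (v : C2) := ((contDiff_fderiv_apply hF v).differentiable (by simp) z).hasFDerivAt
  have h2 := (((h (EuclideanSpace.single j 1)).fun_sub
    ((h (EuclideanSpace.single j Complex.I)).fun_const_smul Complex.I)).fun_const_smul (1 / 2 : ℂ))
  have h3 : HasFDerivAt (dz j F) _ z := h2
  rw [h3.fderiv]
  rfl

lemma fderiv_dzbar {n : ℕ} {F : C2 → EndV n} (hF : ContDiff ℝ ∞ F) (j : Fin 2) (z u : C2) :
    fderiv ℝ (dzbar j F) z u = (1 / 2 : ℂ) • (dd u (EuclideanSpace.single j 1) F z +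
      Complex.I • dd u (EuclideanSpace.single j Complex.I) F z) := by
  have h (v : C2) := ((contDiff_fderiv_apply hF v).differentiable (by simp) z).hasFDerivAt
  have h2 := (((h (EuclideanSpace.single j 1)).fun_add
    ((h (EuclideanSpace.single j Complex.I)).fun_const_smul Complex.I)).fun_const_smul (1 / 2 : ℂ))
  have h3 : HasFDerivAt (dzbar j F) _ z := h2
  rw [h3.fderiv]
  rfl

lemma opD_eq_sum {n : ℕ} {F : C2 → EndV n} (z : C2) (hF : ContDiff ℝ ∞ F) :
    opD n F z = ∑ p, coefD n p * dd (dirD₁ p) (dirD₂ p) F z := by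
  rw [opD, lapz, lapz]
  simp only [dz.eq_1 _ (dzbar _ _), dzbar.eq_1 _ (dz _ _), fderiv_dz hF,
    fderiv_dzbar hF]
  rw [dd_comm hF (EuclideanSpace.single 0 Complex.I) (EuclideanSpace.single 0 1),
    dd_comm hF (EuclideanSpace.single 1 Complex.I) (EuclideanSpace.single 1 1)]
  simp only [Fin.sum_univ_eight, coefD, dirD₁, dirD₂, rdir, hermX, Matrix.cons_val]
  simp only [Matrix.mul_smul, Matrix.smul_mul, mul_add, mul_sub, neg_mul, smul_add, smul_sub,
    smul_smul]
  match_scalars <;> ring_nf <;> simp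

/-- Right multiplication by a matrix. -/
noncomputable def rmul {n : ℕ} (A : EndV n) : EndV n →L[ℂ] EndV n :=
  (ContinuousLinearMap.mul ℂ (EndV n)).flip A

lemma fourier_postcomp {W : Type} [NormedAddCommGroup W] [NormedSpace ℂ W] [CompleteSpace W]
    (L : W →L[ℂ] W) (f : 𝓢(C2, W)) (w : C2) :
    𝓕 (f.postcompCLM L) w = L (𝓕 f w) := by
  rw [SchwartzMap.fourier_coe, SchwartzMap.fourier_coe, Real.fourier_eq, Real.fourier_eq,
    ← L.integral_comp_comm]
  · refine integral_congr_ae (Filter.Eventually.of_forall fun z => ?_)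
    simp only [SchwartzMap.postcompCLM_apply, Circle.smul_def, map_smul]
  · exact (Real.fourierIntegral_convergent_iff w).2 f.integrable

lemma fourier_lineDeriv {n : ℕ} (f : 𝓢(C2, EndV n)) (u w : C2) :
    𝓕 (∂_{u} f) w = (2 * Real.pi * Complex.I * (inner ℝ w u : ℝ) : ℂ) • 𝓕 f w := by
  have : (fun x : C2 => inner ℝ x u).HasTemperateGrowth := by fun_prop
  rw [SchwartzMap.fourier_lineDerivOp_eq, smul_apply, SchwartzMap.smulLeftCLM_apply_apply this,
    ← Complex.coe_smul, smul_smul]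

lemma dd_eq_lineDeriv {n : ℕ} (f : 𝓢(C2, EndV n)) (u v z : C2) :
    dd u v f z = ∂_{u} (∂_{v} f) z := by
  rw [dd, SchwartzMap.lineDerivOp_apply_eq_fderiv]
  rfl

lemma fourier_invTransform (n : ℕ) (g : 𝓢(R2, ℂ)) : 𝓕 (invTransform n g) = symCalcS n g := by
  rw [invTransform, FourierTransform.fourier_fourierInv_eq]

/-- If the symbol of `g'` is that of `g` times the symbol of a differential operator, then that
operator, its coefficients acting from the right, takes the inverse transform of `g` to that of
`g'`. -/
lemma invTransform_eq_sum {n : ℕ} {ι : Type} [Fintype ι] (A : ι → EndV n) (u v : ι → C2)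
    {g g' : 𝓢(R2, ℂ)} (h : ∀ w, symCalc n g' w = symCalc n g w * symbol A u v w) (z : C2) :
    invTransform n g' z = ∑ p, dd (v p) (u p) (invTransform n g) z * A p := by
  set S : 𝓢(C2, EndV n) :=
    ∑ p, (∂_{v p} (∂_{u p} (invTransform n g))).postcompCLM (rmul (A p)) with hS
  have hFS : 𝓕 S = symCalcS n g' := by
    ext1 w
    have h1 : 𝓕 S = ∑ p, 𝓕 ((∂_{v p} (∂_{u p} (invTransform n g))).postcompCLM (rmul (A p))) := by
      rw [hS, ← SchwartzMap.fourierTransformCLM_apply (𝕜 := ℂ), map_sum]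
      rfl
    rw [h1, sum_apply, symCalcS_apply, h, symbol, Finset.mul_sum]
    refine Finset.sum_congr rfl fun p _ => ?_
    refine (fourier_postcomp (rmul (A p)) _ w).trans ?_
    change 𝓕 (∂_{v p} (∂_{u p} (invTransform n g))) w * A p = _
    rw [fourier_lineDeriv, fourier_lineDeriv, fourier_invTransform,
      symCalcS_apply, Matrix.mul_smul, ← Complex.coe_smul, smul_smul, Matrix.smul_mul]
    congr 1
    rw [real_inner_comm w (v p), real_inner_comm w (u p)]
    push_cast
    ring_nf
    rw [Complex.I_sq]
    ring
  have : invTransform n g' = S := by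
    rw [invTransform, ← hFS, FourierTransform.fourierInv_fourier_eq]
  rw [this, hS, sum_apply]
  refine Finset.sum_congr rfl fun p _ => ?_
  rw [dd_eq_lineDeriv]
  rfl

lemma symCalc_mulCoord_zero (n : ℕ) (g : 𝓢(R2, ℂ)) (w : C2) :
    symCalc n (mulCoord 0 g) w = symCalc n g w * symL n w := by
  rw [symL_eq, Matrix.mul_smul, mul_one, ← Complex.coe_smul]
  refine symCalc_congr_smul _ fun j => ?_
  rw [mulCoord_apply]
  rfl

lemma symCalc_mulCoord_one (n : ℕ) (g : 𝓢(R2, ℂ)) (w : C2) :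
    symCalc n (mulCoord 1 g) w = symCalc n g w * symD n w := by
  obtain ⟨k, hk⟩ := exists_act_base w
  rw [hk, symCalc_act_base, symCalc_act_base, symD_act, symD_base, conjDiag_apply, conjDiag_apply]
  rw [tau_conj_mul, Matrix.diagonal_mul_diagonal]
  congr 3
  ext j
  rw [mulCoord_apply, mul_comm]
  rfl

lemma lapS_invTransform (n : ℕ) (g : 𝓢(R2, ℂ)) :
    lapS (invTransform n g) = invTransform n (mulCoord 0 g) := by
  ext1 z
  rw [invTransform_eq_sum _ _ _ (symCalc_mulCoord_zero n g), ← posLap_coe,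
    posLap_eq_sum z ((invTransform n g).smooth ⊤)]
  simp only [neg_mul, one_mul, mul_neg, mul_one]

lemma lapS_iterate_invTransform (n : ℕ) (g : 𝓢(R2, ℂ)) (q : ℕ) :
    lapS^[q] (invTransform n g) = invTransform n ((mulCoord 0)^[q] g) := by
  induction q with
  | zero => rfl
  | succ q ih => rw [Function.iterate_succ_apply', ih, lapS_invTransform,
      Function.iterate_succ_apply']

/-! ### Integration by parts against bounded functions -/

section Cutoff

lemma norm_iteratedFDeriv_comp_affine_le {E F : Type} [NormedAddCommGroup E] [NormedSpace ℝ E]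
    [NormedAddCommGroup F] [NormedSpace ℝ F] {f : E → F} (hf : ContDiff ℝ ∞ f) (a : E) {c : ℝ}
    (hc : |c| ≤ 1) (j : ℕ) (x : E) :
    ‖iteratedFDeriv ℝ j (fun x => f (a + c • x)) x‖ ≤ ‖iteratedFDeriv ℝ j f (a + c • x)‖ := by
  set L : E →L[ℝ] E := c • ContinuousLinearMap.id ℝ E with hL
  have hLn : ‖L‖ ≤ 1 := by
    rw [hL, norm_smul, Real.norm_eq_abs]
    exact mul_le_one₀ hc (norm_nonneg _) ContinuousLinearMap.norm_id_le
  have h1 : (fun x => f (a + c • x)) = (fun y => f (a + y)) ∘ L := rfl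
  have hfa : ContDiff ℝ ∞ fun y => f (a + y) := hf.comp (contDiff_const.add contDiff_id)
  rw [h1, L.iteratedFDeriv_comp_right hfa x (i := j) (by exact_mod_cast le_top),
    iteratedFDeriv_comp_add_left]
  refine (ContinuousMultilinearMap.norm_compContinuousLinearMap_le _ _).trans ?_
  refine mul_le_of_le_one_right (norm_nonneg _) ?_
  exact Finset.prod_le_one (fun _ _ => norm_nonneg _) fun _ _ => hLn

/-- Smooth cut-off functions, bounded together with their derivatives of order at most two, each point
having a neighbourhood on which all but finitely many of them are `1`. -/
lemma exists_cutoff : ∃ (χ : ℕ → C2 → ℝ) (C : ℝ), 0 ≤ C ∧ (∀ N, ContDiff ℝ ∞ (χ N)) ∧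
    (∀ N, HasCompactSupport (χ N)) ∧
    (∀ N, ∀ j ≤ 2, ∀ x, ‖iteratedFDeriv ℝ j (χ N) x‖ ≤ C) ∧
    ∀ x, ∀ᶠ N in Filter.atTop, χ N =ᶠ[nhds x] fun _ => 1 := by
  let f : ContDiffBump (0 : C2) := ⟨1, 2, one_pos, one_lt_two⟩
  have hf : ContDiff ℝ ∞ f := f.contDiff
  have hb : ∀ j, ∃ C, ∀ x, ‖iteratedFDeriv ℝ j f x‖ ≤ C := fun j =>
    (f.hasCompactSupport.iteratedFDeriv j).exists_bound_of_continuous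
      (hf.continuous_iteratedFDeriv (by exact_mod_cast le_top))
  choose C hC using hb
  have hc : ∀ N : ℕ, |((N : ℝ) + 1)⁻¹| ≤ 1 := fun N => by
    rw [abs_of_nonneg (by positivity)]
    exact inv_le_one_of_one_le₀ (by linarith [Nat.cast_nonneg (α := ℝ) N])
  have hC0 : ∀ j, 0 ≤ C j := fun j => (norm_nonneg _).trans (hC j 0)
  refine ⟨fun N x => f (0 + ((N : ℝ) + 1)⁻¹ • x), C 0 + C 1 + C 2, ?_, fun N => ?_, fun N => ?_,
    fun N j hj x => ?_, fun x => ?_⟩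
  · linarith [hC0 0, hC0 1, hC0 2]
  · exact hf.comp (contDiff_const.add (contDiff_id.const_smul _))
  · simp only [zero_add]
    exact f.hasCompactSupport.comp_smul (by positivity)
  · refine (norm_iteratedFDeriv_comp_affine_le hf 0 (hc N) j x).trans ((hC j _).trans ?_)
    have := hC0 0
    have := hC0 1
    have := hC0 2
    interval_cases j <;> linarith
  · obtain ⟨N₀, hN₀⟩ := exists_nat_gt ‖x‖
    filter_upwards [Filter.eventually_ge_atTop N₀] with N hN
    have hlt : ‖x‖ < N + 1 := by
      have : (N₀ : ℝ) ≤ N := by exact_mod_cast hN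
      linarith
    have : ∀ᶠ y in nhds x, ‖y‖ < N + 1 := (continuous_norm.tendsto x).eventually_lt_const hlt
    filter_upwards [this] with y hy
    refine f.one_of_mem_closedBall ?_
    rw [mem_closedBall_zero_iff, zero_add, norm_smul, Real.norm_of_nonneg (by positivity)]
    change _ ≤ (1 : ℝ)
    rw [inv_mul_le_iff₀ (by positivity), mul_one]
    exact hy.le

variable {W W' : Type} [NormedAddCommGroup W] [NormedSpace ℝ W] [NormedAddCommGroup W']
  [NormedSpace ℝ W']

lemma integral_fderiv_right_eq_neg_left (B : W →L[ℝ] W' →L[ℝ] ℂ) {G : C2 → W} {Φ : C2 → W'}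
    (hG : ContDiff ℝ ∞ G) (hGs : HasCompactSupport G) (hΦ : ContDiff ℝ ∞ Φ) (v : C2) :
    ∫ z, B (G z) (fderiv ℝ Φ z v) = -∫ z, B (fderiv ℝ G z v) (Φ z) := by
  have hB : ∀ {f : C2 → W} {g : C2 → W'}, Continuous f → Continuous g → HasCompactSupport f →
      Integrable fun z => B (f z) (g z) := by
    intro f g hf hg hs
    refine Continuous.integrable_of_hasCompactSupport ?_ ?_
    · exact (B.continuous.comp hf).clm_apply hg
    · refine hs.mono fun x hx => ?_
      contrapose! hx
      simp only [Function.mem_support, not_not] at hx ⊢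
      simp [hx]
  have hs : HasCompactSupport fun z => fderiv ℝ G z v := by
    refine (hGs.fderiv (𝕜 := ℝ)).mono fun x hx => ?_
    contrapose! hx
    simp only [Function.mem_support, not_not] at hx ⊢
    simp [hx]
  refine integral_bilinear_hasLineDerivAt_right_eq_neg_left_of_integrable (v := v)
    (hB (contDiff_fderiv_apply hG v).continuous hΦ.continuous hs)
    (hB hG.continuous (contDiff_fderiv_apply hΦ v).continuous hGs)
    (hB hG.continuous hΦ.continuous hGs) (fun x _ => ?_) fun x _ => ?_
  · exact ((hG.differentiable (by simp)) x).hasFDerivAt.hasLineDerivAt v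
  · exact ((hΦ.differentiable (by simp)) x).hasFDerivAt.hasLineDerivAt v

lemma integral_dd_left_eq_right (B : W →L[ℝ] W' →L[ℝ] ℂ) {G : C2 → W} {Φ : C2 → W'}
    (hG : ContDiff ℝ ∞ G) (hGs : HasCompactSupport G) (hΦ : ContDiff ℝ ∞ Φ) (u v : C2) :
    ∫ z, B (dd v u G z) (Φ z) = ∫ z, B (G z) (dd u v Φ z) := by
  have hs : HasCompactSupport fun z => fderiv ℝ G z u := by
    refine (hGs.fderiv (𝕜 := ℝ)).mono fun x hx => ?_
    contrapose! hx
    simp only [Function.mem_support, not_not] at hx ⊢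
    simp [hx]
  have h1 := integral_fderiv_right_eq_neg_left B (contDiff_fderiv_apply hG u) hs hΦ v
  have h2 := integral_fderiv_right_eq_neg_left B hG hGs (contDiff_fderiv_apply hΦ v) u
  rw [← neg_eq_iff_eq_neg] at h1
  change _ = ∫ z, B (G z) (fderiv ℝ (fun y => fderiv ℝ Φ y v) z u)
  rw [h2, h1]
  rfl

/-- Cut-offs may be removed from an integral in which a differential operator `T` of order `m ≤ 2` is
applied to a Schwartz function; `T` enters only through its locality and its boundedness. -/
lemma tendsto_integral_cutoff (B : W →L[ℝ] W' →L[ℝ] ℂ) {χ : ℕ → C2 → ℝ} {C : ℝ} (hC : 0 ≤ C)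
    (hχ : ∀ N, ContDiff ℝ ∞ (χ N)) (hb : ∀ N, ∀ j ≤ 2, ∀ x, ‖iteratedFDeriv ℝ j (χ N) x‖ ≤ C)
    (h1 : ∀ x, ∀ᶠ N in Filter.atTop, χ N =ᶠ[nhds x] fun _ => 1) (F : 𝓢(C2, W)) {Φ : C2 → W'}
    (hΦ : Continuous Φ) {K : ℝ} (hK : ∀ z, ‖Φ z‖ ≤ K) (T : (C2 → W) → C2 → W) {t : ℝ} {m : ℕ}
    (hm : m ≤ 2) (ht : 0 ≤ t)
    (hT : ∀ G : C2 → W, ContDiff ℝ ∞ G → Continuous (T G) ∧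
      ∀ z, ‖T G z‖ ≤ t * ‖iteratedFDeriv ℝ m G z‖)
    (hloc : ∀ (G G' : C2 → W) (z : C2), G =ᶠ[nhds z] G' → T G z = T G' z) :
    Filter.Tendsto (fun N => ∫ z, B (T (fun z => χ N z • F z) z) (Φ z)) Filter.atTop
      (nhds (∫ z, B (T F z) (Φ z))) := by
  have hs : ∀ N, ContDiff ℝ ∞ fun z => χ N z • F z := fun N => (hχ N).fun_smul (F.smooth ⊤)
  have hK0 : 0 ≤ K := (norm_nonneg _).trans (hK 0)
  refine tendsto_integral_of_dominated_convergence
    (fun z => ‖B‖ * (t * ∑ i ∈ Finset.range (m + 1), (m.choose i : ℝ) *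
      (C * ‖iteratedFDeriv ℝ (m - i) F z‖)) * K) (fun N => ?_) ?_ (fun N => ?_) ?_
  · exact ((B.continuous.comp (hT _ (hs N)).1).clm_apply hΦ).aestronglyMeasurable
  · refine Integrable.mul_const (Integrable.const_mul (Integrable.const_mul ?_ _) _) _
    refine integrable_finsetSum _ fun i _ => ((Integrable.const_mul ?_ _).const_mul _)
    simpa using F.integrable_pow_mul_iteratedFDeriv volume 0 (m - i)
  · refine Filter.Eventually.of_forall fun z => ?_
    refine (B.le_opNorm₂ _ _).trans ?_
    gcongr
    · refine ((hT _ (hs N)).2 z).trans ?_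
      gcongr
      refine (norm_iteratedFDeriv_smul_le (hχ N) (F.smooth ⊤) z (n := m)
        (by exact_mod_cast le_top)).trans ?_
      refine Finset.sum_le_sum fun i hi => ?_
      rw [mul_assoc]
      gcongr
      exact hb N i (by have := Finset.mem_range.1 hi; omega) z
    · exact hK z
  · refine Filter.Eventually.of_forall fun z => ?_
    refine tendsto_const_nhds.congr' ?_
    filter_upwards [h1 z] with N hN
    have : (fun z => χ N z • F z) =ᶠ[nhds z] F := by
      filter_upwards [hN] with y hy
      rw [hy, one_smul]
    rw [hloc _ _ z this]

lemma integrable_dd (F : 𝓢(C2, W)) (u v : C2) : Integrable fun z => dd u v F z := by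
  refine ((F.integrable_pow_mul_iteratedFDeriv volume 0 2).mul_const (‖u‖ * ‖v‖)).mono'
    (contDiff_dd (F.smooth ⊤) u v).continuous.aestronglyMeasurable
    (Filter.Eventually.of_forall fun z => ?_)
  rw [pow_zero, one_mul]
  exact norm_dd_le (F.smooth ⊤) u v z

lemma dd_congr {G G' : C2 → W} {z : C2} (h : G =ᶠ[nhds z] G') (u v : C2) :
    dd u v G z = dd u v G' z := by
  have h2 : (fun y => fderiv ℝ G y v) =ᶠ[nhds z] fun y => fderiv ℝ G' y v := by
    filter_upwards [h.fderiv (𝕜 := ℝ)] with y hy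
    rw [hy]
  rw [dd, dd, h2.fderiv_eq]

end Cutoff

/-- Bounded real bilinear forms with complex values. Spelled with the normed space structure of `W`,
so that for matrices the topology is the one that comes from the norm. -/
abbrev BilForm (W : Type) [NormedAddCommGroup W] [NormedSpace ℝ W] : Type := W →L[ℝ] W →L[ℝ] ℂ

/-- The bilinear form `(X, Y) ↦ tr (X A Y)`. -/
noncomputable def trForm {n : ℕ} (A : EndV n) : BilForm (EndV n) :=
  LinearMap.toContinuousLinearMap
    { toFun := fun X => LinearMap.toContinuousLinearMap
        { toFun := fun Y => (X * A * Y).trace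
          map_add' := fun Y Z => by rw [mul_add, Matrix.trace_add]
          map_smul' := fun c Y => by simp [Matrix.trace_smul] }
      map_add' := fun X X' => by ext Y; simp [add_mul, Matrix.trace_add]
      map_smul' := fun c X => by ext Y; simp [Matrix.trace_smul] }

lemma trForm_apply {n : ℕ} (A X Y : EndV n) : trForm A X Y = (X * A * Y).trace := rfl

lemma trForm_one {n : ℕ} (X Y : EndV n) : trForm 1 X Y = (X * Y).trace := by
  rw [trForm_apply, mul_one]

/-- A constant coefficient operator acting on the bounded eigenfunction `Φ` can be moved to the
Schwartz function with which it is paired, although the derivatives of `Φ` are not known to be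
bounded. -/
lemma integral_trace_sum_dd {n : ℕ} {ι : Type} [Fintype ι] (A : ι → EndV n) (u v : ι → C2)
    {Φ : C2 → EndV n} (hΦ : ContDiff ℝ ∞ Φ) {K : ℝ} (hK : ∀ z, ‖Φ z‖ ≤ K) {c : ℝ}
    (hc : ∀ z, ∑ p, A p * dd (u p) (v p) Φ z = c • Φ z) (F : 𝓢(C2, EndV n)) :
    ∫ z, ((∑ p, dd (v p) (u p) F z * A p) * Φ z).trace = c * ∫ z, (F z * Φ z).trace := by
  obtain ⟨χ, C, hC, hχ, hs, hb, h1⟩ := exists_cutoff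
  have hG : ∀ N, ContDiff ℝ ∞ fun z => χ N z • F z := fun N => (hχ N).fun_smul (F.smooth ⊤)
  have hGs : ∀ N, HasCompactSupport fun z => χ N z • F z := fun N => (hs N).smul_right
  have hlim1 : ∀ p, Filter.Tendsto
      (fun N => ∫ z, trForm (A p) (dd (v p) (u p) (fun z => χ N z • F z) z) (Φ z)) Filter.atTop
      (nhds (∫ z, trForm (A p) (dd (v p) (u p) F z) (Φ z))) := fun p =>
    tendsto_integral_cutoff (trForm (A p)) hC hχ hb h1 F hΦ.continuous hK (dd (v p) (u p))
      (t := ‖v p‖ * ‖u p‖) le_rfl (by positivity)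
      (fun G hG => ⟨(contDiff_dd hG _ _).continuous, fun z => by
        rw [mul_comm]; exact norm_dd_le hG _ _ z⟩) fun G G' z h => dd_congr h _ _
  have hlim2 : Filter.Tendsto (fun N => ∫ z, trForm (1 : EndV n) (χ N z • F z) (Φ z)) Filter.atTop
      (nhds (∫ z, trForm (1 : EndV n) (F z) (Φ z))) :=
    tendsto_integral_cutoff (trForm (1 : EndV n)) hC hχ hb h1 F hΦ.continuous hK (fun G => G)
      (t := 1) (m := 0) (by norm_num) zero_le_one
      (fun G hG => ⟨hG.continuous, fun z => by simp⟩) fun G G' z h => h.self_of_nhds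
  have hint : ∀ (B : BilForm (EndV n)) {f g : C2 → EndV n}, Continuous f →
      Continuous g → HasCompactSupport f → Integrable fun z => B (f z) (g z) := by
    intro B f g hf hg hs
    refine Continuous.integrable_of_hasCompactSupport ((B.continuous.comp hf).clm_apply hg) ?_
    refine hs.mono fun x hx => ?_
    contrapose! hx
    simp only [Function.mem_support, not_not] at hx ⊢
    simp [hx]
  have heq : ∀ N, ∑ p, ∫ z, trForm (A p) (dd (v p) (u p) (fun z => χ N z • F z) z) (Φ z) =
      c * ∫ z, trForm (1 : EndV n) (χ N z • F z) (Φ z) := by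
    intro N
    simp only [integral_dd_left_eq_right (trForm _) (hG N) (hGs N) hΦ]
    rw [← integral_finsetSum _ fun p _ => hint (trForm (A p)) (hG N).continuous
      (contDiff_dd hΦ _ _).continuous (hGs N), ← integral_const_mul]
    refine integral_congr_ae (Filter.Eventually.of_forall fun z => ?_)
    change ∑ p, (χ N z • F z * A p * dd (u p) (v p) Φ z).trace =
      c * (χ N z • F z * 1 * Φ z).trace
    simp only [mul_one, mul_assoc]
    rw [← Matrix.trace_sum, ← Finset.mul_sum, hc, Matrix.mul_smul, Matrix.trace_smul,
      Complex.real_smul]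
  have hlim3 := tendsto_finsetSum Finset.univ fun p _ => hlim1 p
  simp only [heq] at hlim3
  have huniq := tendsto_nhds_unique hlim3 (hlim2.const_mul (c : ℂ))
  have hint2 : ∀ p, Integrable fun z => trForm (A p) (dd (v p) (u p) F z) (Φ z) := by
    intro p
    have hd := integrable_dd F (v p) (u p)
    refine ((hd.norm.const_mul ‖trForm (A p)‖).mul_const K).mono'
      (((trForm (A p)).continuous.comp
        (contDiff_dd (F.smooth ⊤) _ _).continuous).clm_apply hΦ.continuous).aestronglyMeasurable
      (Filter.Eventually.of_forall fun z => ?_)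
    refine ((trForm (A p)).le_opNorm₂ _ _).trans ?_
    gcongr
    exact hK z
  rw [← integral_finsetSum _ fun p _ => hint2 p] at huniq
  have e : ∫ z, trForm (1 : EndV n) (F z) (Φ z) = ∫ z, (F z * Φ z).trace :=
    integral_congr_ae (Filter.Eventually.of_forall fun z => trForm_one _ _)
  rw [← e, ← huniq]
  refine integral_congr_ae (Filter.Eventually.of_forall fun z => ?_)
  change _ = ∑ p, (dd (v p) (u p) F z * A p * Φ z).trace
  simp only [Finset.sum_mul, Matrix.trace_sum]

/-! ### Hadamard's lemma for Schwartz functions -/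

/-- The coefficient `aᵢ(x) = ∫₀¹ ∂ᵢψ(ξ + t(x - ξ)) dt` in Hadamard's formula
`ψ(x) - ψ(ξ) = ∑ᵢ (xᵢ - ξᵢ) aᵢ(x)`. -/
noncomputable def hadamardCoeff (ξ : R2) (i : Fin 2) (ψ : 𝓢(R2, ℂ)) (x : R2) : ℂ :=
  ∫ t in Set.Icc (0 : ℝ) 1, (∂_{unitVec i} ψ) ((ξ - t • ξ) + t • x)

lemma hasTemperateGrowth_hadamardCoeff (ξ : R2) (i : Fin 2) (ψ : 𝓢(R2, ℂ)) :
    (hadamardCoeff ξ i ψ).HasTemperateGrowth := by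
  set f : ℝ → R2 → ℂ := fun t x => (∂_{unitVec i} ψ) ((ξ - t • ξ) + t • x) with hf
  have hs : ContDiff ℝ ∞ (Function.uncurry f) := by
    refine ((∂_{unitVec i} ψ).smooth ⊤).comp (ContDiff.add (contDiff_const.sub ?_) ?_)
    · exact contDiff_fst.smul contDiff_const
    · exact contDiff_fst.smul contDiff_snd
  have hmem : ∀ᵐ t ∂(volume.restrict (Set.Icc (0 : ℝ) 1)), t ∈ Set.Icc (0 : ℝ) 1 :=
    ae_restrict_mem measurableSet_Icc
  have hd : LocallyDominated (volume.restrict (Set.Icc (0 : ℝ) 1)) f :=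
    locallyDominated_of_isCompact hs isCompact_Icc hmem
  refine ⟨contDiff_integral_of_locallyDominated hs hd, fun m => ?_⟩
  obtain ⟨C, -, hC⟩ := (∂_{unitVec i} ψ).decay 0 m
  refine ⟨0, C, fun x => ?_⟩
  refine (norm_iteratedFDeriv_integral_le m hs hd x (integrable_const C) ?_).trans ?_
  · filter_upwards [hmem] with t ht
    refine (norm_iteratedFDeriv_comp_affine_le ((∂_{unitVec i} ψ).smooth ⊤) _
      (abs_le.2 ⟨by linarith [ht.1], ht.2⟩) m x).trans ?_
    simpa using hC _
  · simp

lemma hadamard (ξ x : R2) (ψ : 𝓢(R2, ℂ)) :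
    ψ x - ψ ξ = ∑ i, ((x i - ξ i : ℝ) : ℂ) * hadamardCoeff ξ i ψ x := by
  set γ : ℝ → R2 := fun t => (ξ - t • ξ) + t • x with hγ
  have hderiv : ∀ t, HasDerivAt (fun t => ψ (γ t))
      (∑ i, ((x i - ξ i : ℝ) : ℂ) * (∂_{unitVec i} ψ) (γ t)) t := by
    intro t
    have h1 : HasDerivAt γ (x - ξ) t := by
      have := (((hasDerivAt_id t).smul_const ξ).const_sub ξ).add ((hasDerivAt_id t).smul_const x)
      refine this.congr_deriv ?_
      simp only [one_smul]
      abel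
    have h2 := (ψ.hasFDerivAt (γ t)).comp_hasDerivAt t h1
    refine h2.congr_deriv ?_
    have hx : x - ξ = ∑ i, (x i - ξ i) • unitVec i := by
      ext j
      fin_cases j <;> simp [unitVec]
    rw [hx, map_sum]
    refine Finset.sum_congr rfl fun i _ => ?_
    rw [map_smul, SchwartzMap.lineDerivOp_apply_eq_fderiv, Complex.real_smul]
  have hc : ∀ i, Continuous fun t => (∂_{unitVec i} ψ) (γ t) := fun i =>
    (∂_{unitVec i} ψ).continuous.comp (by fun_prop)
  have hftc := intervalIntegral.integral_eq_sub_of_hasDerivAt (a := 0) (b := 1)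
    (fun t _ => hderiv t) (Continuous.intervalIntegrable (by fun_prop) _ _)
  have h1 : γ 1 = x := by simp [hγ]
  have h0 : γ 0 = ξ := by simp [hγ]
  rw [h1, h0] at hftc
  rw [← hftc, intervalIntegral.integral_finsetSum fun i _ =>
    ((hc i).const_mul _).intervalIntegrable _ _]
  refine Finset.sum_congr rfl fun i _ => ?_
  rw [intervalIntegral.integral_const_mul, intervalIntegral.integral_of_le zero_le_one,
    hadamardCoeff, integral_Icc_eq_integral_Ioc]

lemma exists_schwartz_eq_one (ξ : R2) : ∃ W : 𝓢(R2, ℂ), W ξ = 1 := by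
  let f : ContDiffBump ξ := ⟨1, 2, one_pos, one_lt_two⟩
  have hs : HasCompactSupport fun x => ((f x : ℝ) : ℂ) :=
    f.hasCompactSupport.comp_left (g := Complex.ofReal) Complex.ofReal_zero
  refine ⟨hs.toSchwartzMap (Complex.ofRealCLM.contDiff.comp f.contDiff), ?_⟩
  change ((f ξ : ℝ) : ℂ) = 1
  rw [f.one_of_mem_closedBall (by simp [f.rIn_pos.le])]
  simp

/-- A Schwartz function that vanishes at `ξ` belongs to the ideal generated by the functions
`xᵢ - ξᵢ`. The coefficients `Aᵢ` of Hadamard's formula need not decay, so they are applied to `g`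
and to a Schwartz function `W` with `W ξ = 1`, and multiplied by `W` and `g`, respectively. -/
lemma exists_eq_sum_mulCoord (ξ : R2) (g W : 𝓢(R2, ℂ)) (hW : W ξ = 1) :
    ∃ b : Fin 2 → 𝓢(R2, ℂ),
      g = g ξ • W + ∑ i, (mulCoord i (b i) + (-(ξ i : ℝ) : ℂ) • b i) := by
  refine ⟨fun i => SchwartzMap.smulLeftCLM ℂ (hadamardCoeff ξ i g) W -
    SchwartzMap.smulLeftCLM ℂ (hadamardCoeff ξ i W) g, ?_⟩
  ext x
  have h1 := hadamard ξ x g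
  have h2 := hadamard ξ x W
  rw [hW] at h2
  rw [add_apply, smul_apply, sum_apply]
  simp only [add_apply, smul_apply, sub_apply, mulCoord_apply, smul_eq_mul,
    SchwartzMap.smulLeftCLM_apply_apply (hasTemperateGrowth_hadamardCoeff ξ _ _), Fin.sum_univ_two]
    at h1 h2 ⊢
  push_cast at h1 h2
  linear_combination W x * h1 - g x * h2

/-! ### The inverse transform and bounded spherical functions -/

lemma symCalcS_add (n : ℕ) (g f : 𝓢(R2, ℂ)) : symCalcS n (g + f) = symCalcS n g + symCalcS n f := by
  ext1 w
  obtain ⟨k, hk⟩ := exists_act_base w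
  rw [add_apply]
  simp only [symCalcS_apply]
  rw [hk, symCalc_act_base, symCalc_act_base, symCalc_act_base, ← map_add]
  rfl

lemma symCalcS_smul (n : ℕ) (c : ℂ) (g : 𝓢(R2, ℂ)) : symCalcS n (c • g) = c • symCalcS n g := by
  ext1 w
  obtain ⟨k, hk⟩ := exists_act_base w
  rw [smul_apply]
  simp only [symCalcS_apply]
  rw [hk, symCalc_act_base, symCalc_act_base, ← map_smul]
  rfl

lemma invTransform_add (n : ℕ) (g f : 𝓢(R2, ℂ)) :
    invTransform n (g + f) = invTransform n g + invTransform n f := by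
  rw [invTransform, symCalcS_add, FourierTransform.fourierInv_add]; rfl

lemma invTransform_smul (n : ℕ) (c : ℂ) (g : 𝓢(R2, ℂ)) :
    invTransform n (c • g) = c • invTransform n g := by
  rw [invTransform, symCalcS_smul, FourierTransform.fourierInv_smul]; rfl

lemma integrable_trace_mul {n : ℕ} (F : 𝓢(C2, EndV n)) {Φ : C2 → EndV n} (hΦ : Continuous Φ)
    {K : ℝ} (hK : ∀ z, ‖Φ z‖ ≤ K) : Integrable fun z => (F z * Φ z).trace := by
  have h : Integrable fun z => trForm (1 : EndV n) (F z) (Φ z) := by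
    refine ((F.integrable.norm.const_mul ‖trForm (1 : EndV n)‖).mul_const K).mono'
      (((trForm (1 : EndV n)).continuous.comp F.continuous).clm_apply hΦ).aestronglyMeasurable
      (Filter.Eventually.of_forall fun z => ?_)
    refine ((trForm (1 : EndV n)).le_opNorm₂ _ _).trans ?_
    gcongr
    exact hK z
  exact h.congr (Filter.Eventually.of_forall fun z => trForm_one _ _)

/-- The pairing of the inverse transform of `g` with `Φ`. -/
noncomputable def pairing (n : ℕ) (Φ : C2 → EndV n) (g : 𝓢(R2, ℂ)) : ℂ :=
  ∫ z, (invTransform n g z * Φ z).trace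

lemma pairing_add {n : ℕ} {Φ : C2 → EndV n} (hΦ : Continuous Φ) {K : ℝ} (hK : ∀ z, ‖Φ z‖ ≤ K)
    (g f : 𝓢(R2, ℂ)) : pairing n Φ (g + f) = pairing n Φ g + pairing n Φ f := by
  rw [pairing, pairing, pairing, ← integral_add (integrable_trace_mul _ hΦ hK)
    (integrable_trace_mul _ hΦ hK), invTransform_add]
  refine integral_congr_ae (Filter.Eventually.of_forall fun z => ?_)
  simp only [add_apply, add_mul, Matrix.trace_add]

lemma pairing_smul {n : ℕ} (Φ : C2 → EndV n) (c : ℂ) (g : 𝓢(R2, ℂ)) :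
    pairing n Φ (c • g) = c * pairing n Φ g := by
  rw [pairing, pairing, ← integral_const_mul, invTransform_smul]
  refine integral_congr_ae (Filter.Eventually.of_forall fun z => ?_)
  simp only [smul_apply, Matrix.smul_mul, Matrix.trace_smul, smul_eq_mul]

/-- Multiplication of `g` by a coordinate acts on `invTransform n g` as `Δ_z` or `𝐃ₙ`, which is then
moved to `Φ`. -/
lemma pairing_mulCoord {n : ℕ} {ξ : R2} {Φ : C2 → EndV n} (h : IsBoundedSpherical n ξ Φ)
    (i : Fin 2) (g : 𝓢(R2, ℂ)) : pairing n Φ (mulCoord i g) = ξ i * pairing n Φ g := by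
  obtain ⟨K, hK⟩ := h.bounded
  have key : ∀ {ι : Type} [Fintype ι] (A : ι → EndV n) (u v : ι → C2) (f : 𝓢(R2, ℂ)) (c : ℝ),
      (∀ w, symCalc n f w = symCalc n g w * symbol A u v w) →
      (∀ z, ∑ p, A p * dd (u p) (v p) Φ z = c • Φ z) →
      pairing n Φ f = c * pairing n Φ g := by
    intro ι _ A u v f c h1 h2
    rw [pairing, pairing, ← integral_trace_sum_dd A u v h.smooth hK h2]
    simp only [← invTransform_eq_sum A u v h1]
  fin_cases i
  · exact key _ _ _ _ _ (symCalc_mulCoord_zero n g) fun z =>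
      (posLap_eq_sum z h.smooth).symm.trans (h.eigen_lap z)
  · exact key _ _ _ _ _ (symCalc_mulCoord_one n g) fun z =>
      (opD_eq_sum z h.smooth).symm.trans (h.eigen_opD z)

/-- The pairing with a bounded spherical function is a multiple of the evaluation at its pair of
eigenvalues, because it annihilates the ideal of the functions vanishing there. -/
lemma pairing_eq_mul {n : ℕ} {ξ : R2} {Φ : C2 → EndV n} (h : IsBoundedSpherical n ξ Φ)
    {W : 𝓢(R2, ℂ)} (hW : W ξ = 1) (g : 𝓢(R2, ℂ)) : pairing n Φ g = g ξ * pairing n Φ W := by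
  obtain ⟨K, hK⟩ := h.bounded
  obtain ⟨b, hb⟩ := exists_eq_sum_mulCoord ξ g W hW
  conv_lhs => rw [hb]
  simp only [Fin.sum_univ_two, pairing_add h.smooth.continuous hK, pairing_smul, pairing_mulCoord h]
  ring

/-! ### Symmetries of the inverse transform -/

lemma fourierInv_postcomp {W : Type} [NormedAddCommGroup W] [NormedSpace ℂ W] [CompleteSpace W]
    (L : W →L[ℂ] W) (f : 𝓢(C2, W)) (w : C2) :
    𝓕⁻ (f.postcompCLM L) w = L (𝓕⁻ f w) := by
  rw [SchwartzMap.fourierInv_coe, SchwartzMap.fourierInv_coe, Real.fourierInv_eq_fourier_neg,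
    Real.fourierInv_eq_fourier_neg]
  exact fourier_postcomp L f (-w)

/-- The map `B ↦ τₙ(k) B τₙ(k)⁻¹`. -/
noncomputable def conjTau {n : ℕ} (k : U2) : EndV n →L[ℂ] EndV n :=
  (ContinuousLinearMap.mul ℂ (EndV n) (tau n k)).comp (rmul (tau n k⁻¹))

lemma conjTau_apply {n : ℕ} (k : U2) (B : EndV n) :
    conjTau k B = tau n k * B * tau n k⁻¹ := (mul_assoc _ _ _).symm

lemma symCalc_act (n : ℕ) (g : 𝓢(R2, ℂ)) (k : U2) (w : C2) :
    symCalc n g (act k w) = conjTau k (symCalc n g w) := by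
  obtain ⟨l, hl⟩ := exists_act_base w
  rw [hl, ← act_mul, symCalc_act_base, symCalc_act_base, conjDiag_apply, conjDiag_apply,
    conjTau_apply, mul_inv_rev, tau_mul, tau_mul]
  simp only [mul_assoc]

lemma isEquivariant_invTransform (n : ℕ) (g : 𝓢(R2, ℂ)) : IsEquivariant n (invTransform n g) := by
  intro k z
  rw [← conjTau_apply, invTransform]
  refine Eq.trans ?_ (fourierInv_postcomp (conjTau k) (symCalcS n g) z)
  rw [SchwartzMap.fourierInv_coe, SchwartzMap.fourierInv_coe, ← actL_apply,
    ← Real.fourierInv_comp_linearIsometry]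
  have h : (symCalcS n g : C2 → EndV n) ∘ actL k =
      ((symCalcS n g).postcompCLM (conjTau k) : 𝓢(C2, EndV n)) :=
    funext fun w => symCalc_act n g k w
  rw [h]

lemma base_smul (c r : ℝ) : base (c * r) = c • base r := by
  ext i
  fin_cases i <;> simp [base]

/-- Dilations of the frequency variable correspond to dilations of `g`. -/
lemma symCalc_smul_of_forall {n : ℕ} {g f : 𝓢(R2, ℂ)} (c : ℝ)
    (h : ∀ r (j : Fin (n + 1)), f (spec n r j) = g (spec n (c * r) j)) (w : C2) :
    symCalc n f w = symCalc n g (c • w) := by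
  obtain ⟨k, hk⟩ := exists_act_base w
  rw [hk, ← act_smul, ← base_smul, symCalc_act_base, symCalc_act_base]
  simp only [h]

/-- The inverse transform is even because `spec n r j` depends on `r` only through `r²`. -/
lemma invTransform_neg (n : ℕ) (g : 𝓢(R2, ℂ)) (z : C2) :
    invTransform n g (-z) = invTransform n g z := by
  have h : (symCalcS n g : C2 → EndV n) = symCalcS n g ∘ LinearIsometryEquiv.neg ℝ := by
    ext1 w
    have := symCalc_smul_of_forall (n := n) (g := g) (f := g) (-1)
      (fun r j => by simp [spec]) w
    rw [neg_one_smul] at this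
    exact this
  have h2 := Real.fourierInv_comp_linearIsometry (LinearIsometryEquiv.neg ℝ)
    (symCalcS n g : C2 → EndV n) z
  rw [← h] at h2
  rw [invTransform, SchwartzMap.fourierInv_coe]
  exact h2.symm

/-! ### Normalization -/

lemma exists_scale (G : 𝓢(R2, ℂ)) {c : ℝ} (hc : c ≠ 0) :
    ∃ f : 𝓢(R2, ℂ), ∀ x, f x = G (c • x) :=
  ⟨SchwartzMap.compCLMOfContinuousLinearEquiv ℂ
    (LinearEquiv.smulOfNeZero ℝ R2 c hc).toContinuousLinearEquiv G, fun _ => rfl⟩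

lemma spec_mul (n : ℕ) (c r : ℝ) (j : Fin (n + 1)) : spec n (c * r) j = c ^ 2 • spec n r j := by
  ext i
  fin_cases i <;> simp [spec] <;> ring

lemma invTransform_eq_integral (n : ℕ) (g : 𝓢(R2, ℂ)) (z : C2) : invTransform n g z =
    ∫ w, Complex.exp ((2 * Real.pi * inner ℝ w z : ℝ) * Complex.I) • symCalc n g w := by
  rw [invTransform, SchwartzMap.fourierInv_coe, Real.fourierInv_eq']
  rfl

/-- Dilating `g` by `c²` amounts to dilating `Φ` by `c`. -/
lemma pairing_scale {n : ℕ} (Φ : C2 → EndV n) {G f : 𝓢(R2, ℂ)} {c : ℝ} (hc : 0 < c)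
    (hf : ∀ x, f x = G (c ^ 2 • x)) :
    pairing n Φ f = ∫ z, (invTransform n G z * Φ (c • z)).trace := by
  set d := Module.finrank ℝ C2 with hd
  have hcd : (c ^ d : ℝ) ≠ 0 := (pow_pos hc d).ne'
  have h1 : ∀ z, invTransform n G z = c ^ d • invTransform n f (c • z) := by
    intro z
    have h := Measure.integral_comp_smul_of_nonneg (μ := (volume : Measure C2))
      (fun w : C2 => Complex.exp ((2 * Real.pi * inner ℝ w z : ℝ) * Complex.I) • symCalc n G w) c
      (hR := hc.le)
    rw [← invTransform_eq_integral] at h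
    rw [invTransform_eq_integral n f, ← smul_right_injective _ (inv_ne_zero hcd) |>.eq_iff, ← h,
      smul_smul, inv_mul_cancel₀ hcd, one_smul]
    refine integral_congr_ae (Filter.Eventually.of_forall fun w => ?_)
    simp only
    rw [symCalc_smul_of_forall (f := f) (g := G) c fun r j => by rw [hf, spec_mul],
      real_inner_smul_left, real_inner_smul_right]
  have h := Measure.integral_comp_smul_of_nonneg (μ := (volume : Measure C2))
    (fun z => (invTransform n f z * Φ z).trace) c (hR := hc.le)
  rw [pairing, ← smul_right_injective _ (inv_ne_zero hcd) |>.eq_iff, ← h, ← integral_smul]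
  refine integral_congr_ae (Filter.Eventually.of_forall fun z => ?_)
  simp only
  rw [h1, Matrix.smul_mul, Matrix.trace_smul, smul_smul, inv_mul_cancel₀ hcd, one_smul]

/-- The integral is the value at `0` of the Fourier transform, that is `tr (G(0) I)`. -/
lemma integral_trace_invTransform (n : ℕ) (G : 𝓢(R2, ℂ)) :
    ∫ z, (invTransform n G z).trace = (n + 1) * G 0 := by
  have h : ∫ z, invTransform n G z = symCalc n G 0 := by
    rw [← symCalcS_apply, ← fourier_invTransform, SchwartzMap.fourier_coe, Real.fourier_eq']
    simp
  have h0 : (0 : C2) = act 1 (base 0) := by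
    rw [act_one]
    ext i
    fin_cases i <;> simp [base]
  have hs : ∀ j, spec n 0 j = 0 := fun j => by
    ext i
    fin_cases i <;> simp [spec]
  have hT := ((trForm (1 : EndV n)).flip 1).integral_comp_comm
    ((invTransform n G).integrable (μ := volume))
  simp only [ContinuousLinearMap.flip_apply, trForm_one, mul_one] at hT
  rw [hT, h, h0, symCalc_act_base, conjDiag_apply, inv_one, tau_one, one_mul, mul_one,
    Matrix.trace_diagonal]
  simp [hs]

/-- The constant left open by `pairing_eq_mul` is found by dilating a Schwartz function `G` with
`G 0 = 1` to the constant `1`. -/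
lemma pairing_eq {n : ℕ} {ξ : R2} {Φ : C2 → EndV n} (h : IsBoundedSpherical n ξ Φ)
    (g : 𝓢(R2, ℂ)) : pairing n Φ g = (n + 1) * g ξ := by
  obtain ⟨K, hK⟩ := h.bounded
  obtain ⟨W, hW⟩ := exists_schwartz_eq_one ξ
  obtain ⟨G, hG⟩ := exists_schwartz_eq_one 0
  suffices hc : pairing n Φ W = n + 1 by rw [pairing_eq_mul h hW, hc, mul_comm]
  -- Both sides of the identity for the dilates of `G` are followed to the limit `c → 0`.
  set c : ℕ → ℝ := fun N => ((N : ℝ) + 1)⁻¹ with hcdef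
  have hcpos : ∀ N, 0 < c N := fun N => by positivity
  have hclim : Filter.Tendsto c Filter.atTop (nhds 0) := by
    simpa [hcdef] using tendsto_one_div_add_atTop_nhds_zero_nat (𝕜 := ℝ)
  have heq : ∀ N, ∫ z, (invTransform n G z * Φ (c N • z)).trace =
      G (c N ^ 2 • ξ) * pairing n Φ W := by
    intro N
    obtain ⟨f, hf⟩ := exists_scale G (pow_pos (hcpos N) 2).ne'
    rw [← pairing_scale Φ (hcpos N) hf, pairing_eq_mul h hW, hf]
  have hlim1 : Filter.Tendsto (fun N => G (c N ^ 2 • ξ) * pairing n Φ W) Filter.atTop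
      (nhds (1 * pairing n Φ W)) := by
    rw [← hG]
    refine Filter.Tendsto.mul_const _ ((G.continuous.tendsto 0).comp ?_)
    have := (hclim.pow 2).smul_const ξ
    simpa using this
  have hlim2 : Filter.Tendsto (fun N => ∫ z, (invTransform n G z * Φ (c N • z)).trace) Filter.atTop
      (nhds (∫ z, (invTransform n G z * Φ 0).trace)) := by
    refine tendsto_integral_of_dominated_convergence
      (fun z => ‖trForm (1 : EndV n)‖ * ‖invTransform n G z‖ * K) (fun N => ?_) ?_ (fun N => ?_) ?_
    · exact (integrable_trace_mul (invTransform n G) (Φ := fun z => Φ (c N • z))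
        (h.smooth.continuous.comp (continuous_const_smul _)) fun z => hK _).aestronglyMeasurable
    · exact ((invTransform n G).integrable.norm.const_mul _).mul_const _
    · refine Filter.Eventually.of_forall fun z => ?_
      rw [← trForm_one]
      refine ((trForm (1 : EndV n)).le_opNorm₂ _ _).trans ?_
      gcongr
      exact hK _
    · refine Filter.Eventually.of_forall fun z => ?_
      have h1 : Filter.Tendsto (fun N => c N • z) Filter.atTop (nhds 0) := by
        simpa using hclim.smul_const z
      have h2 := (h.smooth.continuous.tendsto 0).comp h1
      exact ((continuous_id.matrix_trace.tendsto _).comp (h2.const_mul (invTransform n G z)))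
  simp only [heq] at hlim2
  have := tendsto_nhds_unique hlim1 hlim2
  rw [one_mul] at this
  rw [this, h.normalized]
  simp only [mul_one]
  rw [integral_trace_invTransform, hG, mul_one]

/-- The spherical transform of the inverse transform of `g` is the restriction of `g`. -/
lemma hasSphericalTransform_invTransform (n : ℕ) (g : 𝓢(R2, ℂ)) :
    HasSphericalTransform n (invTransform n g) ((spectrumD n).domRestrict g) := by
  intro ξ Φ hΦ
  have h1 : ∫ z, (invTransform n g z * Φ (-z)).trace = pairing n Φ g := by
    rw [pairing, ← integral_neg_eq_self]
    simp only [invTransform_neg, neg_neg]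
  have hn : (n : ℂ) + 1 ≠ 0 := Nat.cast_add_one_ne_zero n
  rw [sphericalTransform, h1, pairing_eq hΦ, one_div, inv_mul_cancel_left₀ hn]
  rfl

/-! ### Invariant measures on spheres -/

/-- The map `w ↦ (r / ‖w‖) w` onto the sphere of radius `r`. -/
noncomputable def toSphereOfRadius (r : ℝ) (w : C2) : C2 := (r / ‖w‖) • w

lemma measurable_toSphereOfRadius (r : ℝ) : Measurable (toSphereOfRadius r) :=
  (measurable_const.div measurable_norm).smul measurable_id

lemma norm_toSphereOfRadius {r : ℝ} (hr : 0 ≤ r) {w : C2} (hw : w ≠ 0) :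
    ‖toSphereOfRadius r w‖ = r := by
  have := norm_ne_zero_iff.2 hw
  rw [toSphereOfRadius, norm_smul, Real.norm_of_nonneg (by positivity)]
  field_simp

/-- A `U₂`-invariant probability measure on the sphere of radius `r`: the image of the normalized
volume of the unit ball under the radial projection. -/
noncomputable def sphereMeasure (r : ℝ) : Measure C2 :=
  (ProbabilityTheory.cond volume (Metric.ball (0 : C2) 1)).map (toSphereOfRadius r)

instance (r : ℝ) : IsProbabilityMeasure (sphereMeasure r) := by
  have : IsProbabilityMeasure (ProbabilityTheory.cond volume (Metric.ball (0 : C2) 1)) :=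
    ProbabilityTheory.cond_isProbabilityMeasure_of_finite
      (Metric.measure_ball_pos _ _ one_pos).ne' measure_ball_lt_top.ne
  exact Measure.isProbabilityMeasure_map (measurable_toSphereOfRadius r).aemeasurable

lemma ae_sphereMeasure {r : ℝ} (hr : 0 ≤ r) : ∀ᵐ w ∂(sphereMeasure r), ‖w‖ = r := by
  rw [sphereMeasure, ae_map_iff (measurable_toSphereOfRadius r).aemeasurable
    (measurableSet_eq_fun measurable_norm measurable_const)]
  have h : ∀ᵐ w : C2, w ≠ 0 := Measure.ae_ne volume 0
  filter_upwards [(ProbabilityTheory.cond_absolutelyContinuous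
    (μ := (volume : Measure C2)) (s := Metric.ball (0 : C2) 1)).ae_le h] with w hw
  exact norm_toSphereOfRadius hr hw

lemma measurePreserving_act (r : ℝ) (k : U2) :
    MeasurePreserving (actL k) (sphereMeasure r) (sphereMeasure r) := by
  have h1 : MeasurePreserving (actL k) (ProbabilityTheory.cond volume (Metric.ball (0 : C2) 1))
      (ProbabilityTheory.cond volume (Metric.ball (0 : C2) 1)) := by
    have h := (actL k).measurePreserving.restrict_preimage
      (measurableSet_ball (x := (0 : C2)) (ε := 1))
    have hb : actL k ⁻¹' Metric.ball (0 : C2) 1 = Metric.ball 0 1 := by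
      ext w
      simp
    rw [hb] at h
    exact h.smul_measure _
  refine ⟨(actL k).continuous.measurable, ?_⟩
  rw [sphereMeasure, Measure.map_map (actL k).continuous.measurable (measurable_toSphereOfRadius r)]
  have : actL k ∘ toSphereOfRadius r = toSphereOfRadius r ∘ actL k := by
    ext1 w
    simp only [Function.comp_apply, actL_apply, toSphereOfRadius, norm_act, act_smul]
  rw [this, ← Measure.map_map (measurable_toSphereOfRadius r) (actL k).continuous.measurable,
    h1.map_eq]

lemma integral_act_sphereMeasure {W : Type} [NormedAddCommGroup W] [NormedSpace ℝ W] (r : ℝ)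
    (k : U2) (f : C2 → W) : ∫ w, f (act k w) ∂(sphereMeasure r) = ∫ w, f w ∂(sphereMeasure r) :=
  (measurePreserving_act r k).integral_comp (actL k).toHomeomorph.measurableEmbedding f

lemma ae_mem_closedBall {r : ℝ} (hr : 0 ≤ r) :
    ∀ᵐ w ∂(sphereMeasure r), w ∈ Metric.closedBall (0 : C2) r := by
  filter_upwards [ae_sphereMeasure hr] with w hw
  simp [hw]

lemma integrable_sphereMeasure {W : Type} [NormedAddCommGroup W] {r : ℝ} (hr : 0 ≤ r) {f : C2 → W}
    (hf : Continuous f) : Integrable f (sphereMeasure r) := by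
  obtain ⟨C, hC⟩ := (isCompact_closedBall (0 : C2) r).exists_bound_of_continuousOn hf.continuousOn
  refine (integrable_const C).mono' hf.aestronglyMeasurable ?_
  filter_upwards [ae_mem_closedBall hr] with w hw
  exact hC w hw

lemma dd_integral {W : Type} [NormedAddCommGroup W] [NormedSpace ℝ W] [CompleteSpace W] {r : ℝ}
    (hr : 0 ≤ r) {f : C2 → C2 → W} (hf : ContDiff ℝ ∞ (Function.uncurry f)) (u v z : C2) :
    dd u v (fun z => ∫ w, f w z ∂(sphereMeasure r)) z = ∫ w, dd u v (f w) z ∂(sphereMeasure r) := by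
  have key : ∀ {f : C2 → C2 → W}, ContDiff ℝ ∞ (Function.uncurry f) → ∀ v z,
      fderiv ℝ (fun z => ∫ w, f w z ∂(sphereMeasure r)) z v =
        ∫ w, fderiv ℝ (f w) z v ∂(sphereMeasure r) := by
    intro f hf v z
    have hd := locallyDominated_of_isCompact (μ := sphereMeasure r) hf
      (isCompact_closedBall (0 : C2) r) (ae_mem_closedBall hr)
    have hi : Integrable (fun w => fderiv ℝ (f w) z) (sphereMeasure r) :=
      integrable_sphereMeasure hr
        ((contDiff_uncurry_fderiv hf).continuous.comp (by fun_prop : Continuous fun w => (w, z)))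
    rw [(hasFDerivAt_integral_of_locallyDominated hf hd z).fderiv,
      ContinuousLinearMap.integral_apply hi]
  have hf' : ContDiff ℝ ∞ (Function.uncurry fun w z => fderiv ℝ (f w) z v) :=
    (contDiff_uncurry_fderiv hf).clm_apply contDiff_const
  rw [dd]
  simp only [key hf]
  rw [key hf']
  rfl

/-! ### The bounded spherical functions -/

section Wave

variable {W : Type} [NormedAddCommGroup W] [NormedSpace ℂ W]

lemma continuous_planeWave {S : C2 → W} (hS : Continuous S) (z : C2) :
    Continuous fun w => Complex.exp ((2 * Real.pi * inner ℝ w z : ℝ) * Complex.I) • S w := by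
  have h : Continuous fun w : C2 => (inner ℝ w z : ℝ) := by fun_prop
  fun_prop

variable [NormedSpace ℝ W]

/-- The superposition of the plane waves `z ↦ e^{2πi⟨w,z⟩}`, `‖w‖ = r`, with the coefficients
`S w`. -/
noncomputable def waveIntegral (S : C2 → W) (r : ℝ) (z : C2) : W :=
  ∫ w, Complex.exp ((2 * Real.pi * inner ℝ w z : ℝ) * Complex.I) • S w ∂(sphereMeasure r)

lemma norm_waveIntegral_le (S : C2 → W) (r : ℝ) (z : C2) :
    ‖waveIntegral S r z‖ ≤ ∫ w, ‖S w‖ ∂(sphereMeasure r) := by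
  refine (norm_integral_le_integral_norm _).trans (le_of_eq ?_)
  simp only [norm_smul, Complex.norm_exp_ofReal_mul_I, one_mul]

lemma waveIntegral_congr {S S' : C2 → W} {r : ℝ} (hr : 0 ≤ r) (h : ∀ w, ‖w‖ = r → S w = S' w)
    (z : C2) : waveIntegral S r z = waveIntegral S' r z := by
  refine integral_congr_ae ?_
  filter_upwards [ae_sphereMeasure hr] with w hw
  rw [h w hw]

lemma waveIntegral_act (S : C2 → W) (r : ℝ) (k : U2) (z : C2) :
    waveIntegral S r (act k z) = waveIntegral (fun w => S (act k w)) r z := by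
  rw [waveIntegral, ← integral_act_sphereMeasure r k, waveIntegral]
  simp only [inner_act]

lemma map_waveIntegral [CompleteSpace W] (L : W →L[ℂ] W) {S : C2 → W} (hS : Continuous S) {r : ℝ}
    (hr : 0 ≤ r) (z : C2) : L (waveIntegral S r z) = waveIntegral (fun w => L (S w)) r z := by
  rw [waveIntegral, ← L.integral_comp_comm
    (integrable_sphereMeasure hr (continuous_planeWave hS z)), waveIntegral]
  simp only [map_smul]

lemma waveIntegral_sum {ι : Type} [Fintype ι] {S : ι → C2 → W} (hS : ∀ p, Continuous (S p)) {r : ℝ}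
    (hr : 0 ≤ r) (z : C2) :
    ∑ p, waveIntegral (S p) r z = waveIntegral (fun w => ∑ p, S p w) r z := by
  simp only [waveIntegral, Finset.smul_sum]
  rw [integral_finsetSum]
  exact fun p _ => integrable_sphereMeasure hr (continuous_planeWave (hS p) z)

variable [IsScalarTower ℝ ℂ W]

lemma contDiff_planeWave {S : C2 → W} (hS : ContDiff ℝ ∞ S) :
    ContDiff ℝ ∞ (Function.uncurry fun w z : C2 =>
      Complex.exp ((2 * Real.pi * inner ℝ w z : ℝ) * Complex.I) • S w) := by
  refine ContDiff.fun_smul ?_ (hS.comp contDiff_fst)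
  refine Complex.contDiff_exp.comp (ContDiff.mul ?_ contDiff_const)
  exact Complex.ofRealCLM.contDiff.comp (contDiff_const.mul (contDiff_fst.inner ℝ contDiff_snd))

lemma fderiv_planeWave (B : W) (v w z : C2) :
    fderiv ℝ (fun z => Complex.exp ((2 * Real.pi * inner ℝ w z : ℝ) * Complex.I) • B) z v =
      Complex.exp ((2 * Real.pi * inner ℝ w z : ℝ) * Complex.I) •
        ((2 * Real.pi * inner ℝ v w : ℝ) * Complex.I : ℂ) • B := by
  have h1 : HasFDerivAt (fun z : C2 => (2 * Real.pi * inner ℝ w z : ℝ))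
      ((2 * Real.pi) • innerSL ℝ w) z := ((innerSL ℝ w).hasFDerivAt).const_mul (2 * Real.pi)
  have h2 : HasFDerivAt (fun z : C2 => ((2 * Real.pi * inner ℝ w z : ℝ) * Complex.I : ℂ))
      (Complex.I • Complex.ofRealCLM.comp ((2 * Real.pi) • innerSL ℝ w)) z :=
    (Complex.ofRealCLM.hasFDerivAt.comp z h1).mul_const Complex.I
  have h3 := h2.cexp.smul_const B
  rw [h3.fderiv]
  simp only [ContinuousLinearMap.smulRight_apply, smul_apply, ContinuousLinearMap.comp_apply,
    innerSL_apply_apply, Complex.ofRealCLM_apply, smul_eq_mul, real_inner_comm w v, smul_smul]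
  congr 1
  ring

lemma dd_planeWave (B : W) (u v w z : C2) :
    dd u v (fun z => Complex.exp ((2 * Real.pi * inner ℝ w z : ℝ) * Complex.I) • B) z =
      Complex.exp ((2 * Real.pi * inner ℝ w z : ℝ) * Complex.I) •
        ((-(4 * Real.pi ^ 2) * (inner ℝ u w * inner ℝ v w) : ℝ) : ℂ) • B := by
  rw [dd]
  simp only [fderiv_planeWave]
  rw [smul_smul, smul_smul, smul_smul]
  congr 1
  push_cast
  ring_nf
  rw [Complex.I_sq]
  ring

lemma contDiff_waveIntegral {S : C2 → W} (hS : ContDiff ℝ ∞ S) {r : ℝ} (hr : 0 ≤ r) :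
    ContDiff ℝ ∞ (waveIntegral S r) :=
  contDiff_integral_of_locallyDominated (contDiff_planeWave hS) (locallyDominated_of_isCompact
    (contDiff_planeWave hS) (isCompact_closedBall (0 : C2) r) (ae_mem_closedBall hr))

lemma waveIntegral_smul (S : C2 → W) (c : ℂ) (r : ℝ) (z : C2) :
    waveIntegral (fun w => c • S w) r z = c • waveIntegral S r z := by
  simp only [waveIntegral, smul_comm _ c, integral_smul]

lemma dd_waveIntegral [CompleteSpace W] {S : C2 → W} (hS : ContDiff ℝ ∞ S) {r : ℝ} (hr : 0 ≤ r)
    (u v z : C2) : dd u v (waveIntegral S r) z = waveIntegral (fun w =>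
      ((-(4 * Real.pi ^ 2) * (inner ℝ u w * inner ℝ v w) : ℝ) : ℂ) • S w) r z := by
  have h := dd_integral hr (contDiff_planeWave hS) u v z
  simp only [dd_planeWave] at h
  exact h

end Wave

/-- A second order operator acts on a superposition of plane waves by a scalar if its symbol acts so
on the coefficients. -/
lemma sum_dd_waveIntegral {n : ℕ} {S : C2 → EndV n} (hS : ContDiff ℝ ∞ S) {r : ℝ} (hr : 0 ≤ r)
    {ι : Type} [Fintype ι] (A : ι → EndV n) (u v : ι → C2) (c : ℝ)
    (h : ∀ w, ‖w‖ = r → symbol A u v w * S w = (c : ℂ) • S w) (z : C2) :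
    ∑ p, A p * dd (u p) (v p) (waveIntegral S r) z = c • waveIntegral S r z := by
  have hc : ∀ p, Continuous fun w =>
      ((-(4 * Real.pi ^ 2) * (inner ℝ (u p) w * inner ℝ (v p) w) : ℝ) : ℂ) • S w := fun p =>
    Continuous.smul (Complex.continuous_ofReal.comp (by fun_prop)) hS.continuous
  have h1 : ∀ p, A p * dd (u p) (v p) (waveIntegral S r) z = waveIntegral (fun w => A p *
      (((-(4 * Real.pi ^ 2) * (inner ℝ (u p) w * inner ℝ (v p) w) : ℝ) : ℂ) • S w)) r z := by
    intro p
    rw [dd_waveIntegral hS hr]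
    exact map_waveIntegral (ContinuousLinearMap.mul ℂ (EndV n) (A p)) (hc p) hr z
  have hc' : ∀ p, Continuous fun w => A p *
      (((-(4 * Real.pi ^ 2) * (inner ℝ (u p) w * inner ℝ (v p) w) : ℝ) : ℂ) • S w) := fun p =>
    continuous_const.mul (hc p)
  rw [Finset.sum_congr rfl fun p _ => h1 p, waveIntegral_sum hc' hr,
    ← Complex.coe_smul, ← waveIntegral_smul]
  refine waveIntegral_congr hr (fun w hw => ?_) z
  rw [← h w hw, symbol, Finset.sum_mul]
  refine Finset.sum_congr rfl fun p _ => ?_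
  rw [Matrix.mul_smul, Matrix.smul_mul, Complex.coe_smul]

/-- A function on the plane that is `1` at `spec n r j` and `0` at the other points
`spec n r i`. -/
def IsProjector (n : ℕ) (r : ℝ) (j : Fin (n + 1)) (g : 𝓢(R2, ℂ)) : Prop :=
  ∀ i, g (spec n r i) = if i = j then 1 else 0

/-- The points `spec n r j` are distinct for `r > 0`, at mutual distance at least `8π²r²`. -/
lemma exists_isProjector (n : ℕ) {r : ℝ} (hr : 0 < r) (j : Fin (n + 1)) :
    ∃ g, IsProjector n r j g := by
  let f : ContDiffBump (spec n r j) :=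
    ⟨r ^ 2, 2 * r ^ 2, by positivity, by linarith [sq_pos_of_pos hr]⟩
  have hs : HasCompactSupport fun x => ((f x : ℝ) : ℂ) :=
    f.hasCompactSupport.comp_left (g := Complex.ofReal) Complex.ofReal_zero
  refine ⟨hs.toSchwartzMap (Complex.ofRealCLM.contDiff.comp f.contDiff), fun i => ?_⟩
  change ((f (spec n r i) : ℝ) : ℂ) = _
  split_ifs with hij
  · rw [hij, f.one_of_mem_closedBall (by simp [f.rIn_pos.le])]
    simp
  · rw [f.zero_of_le_dist, Complex.ofReal_zero]
    change 2 * r ^ 2 ≤ _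
    have h1 := abs_coord_le (spec n r i - spec n r j) 1
    rw [← dist_eq_norm] at h1
    refine le_trans ?_ h1
    have h2 : (spec n r i - spec n r j) 1 = 8 * Real.pi ^ 2 * r ^ 2 * ((j : ℕ) - (i : ℕ) : ℝ) := by
      simp only [spec, PiLp.sub_apply, Matrix.cons_val_one, Matrix.cons_val_fin_one]
      ring
    have h3 : 1 ≤ |((j : ℕ) - (i : ℕ) : ℝ)| := by
      have : (1 : ℤ) ≤ |((j : ℕ) : ℤ) - ((i : ℕ) : ℤ)| := by
        refine Int.one_le_abs fun h => hij (Fin.ext ?_)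
        omega
      exact_mod_cast this
    rw [h2, abs_mul, abs_of_nonneg (by positivity)]
    have hpi := Real.pi_gt_three
    have h4 : 2 * r ^ 2 ≤ 8 * Real.pi ^ 2 * r ^ 2 := by
      gcongr
      nlinarith
    calc 2 * r ^ 2 ≤ 8 * Real.pi ^ 2 * r ^ 2 * 1 := by linarith
      _ ≤ _ := by gcongr

/-- On the sphere of radius `r > 0`, `symCalc n g` is the spectral projection for the `j`-th eigenvalue
of the symbol of `𝐃ₙ`. -/
lemma symCalc_of_isProjector {n : ℕ} {r : ℝ} {j : Fin (n + 1)} {g : 𝓢(R2, ℂ)}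
    (h : IsProjector n r j g) (k : U2) :
    symCalc n g (act k (base r)) = conjDiag k (Pi.single j 1) := by
  rw [symCalc_act_base]
  congr 1
  ext i
  rw [h i, Pi.single_apply]

lemma trace_conjDiag {n : ℕ} (k : U2) (v : Fin (n + 1) → ℂ) : (conjDiag k v).trace = ∑ i, v i := by
  rw [conjDiag_apply, Matrix.trace_mul_comm, ← mul_assoc, tau_inv_mul_tau, one_mul,
    Matrix.trace_diagonal]

lemma symL_mul_symCalc {n : ℕ} {r : ℝ} (j : Fin (n + 1)) (g : 𝓢(R2, ℂ)) {w : C2} (hw : ‖w‖ = r) :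
    symL n w * symCalc n g w = ((spec n r j 0 : ℝ) : ℂ) • symCalc n g w := by
  rw [symL_eq, hw, Matrix.smul_mul, one_mul, ← Complex.coe_smul]
  rfl

lemma symD_mul_symCalc {n : ℕ} {r : ℝ} {j : Fin (n + 1)} {g : 𝓢(R2, ℂ)} (h : IsProjector n r j g)
    {w : C2} (hw : ‖w‖ = r) :
    symD n w * symCalc n g w = ((spec n r j 1 : ℝ) : ℂ) • symCalc n g w := by
  obtain ⟨k, hk⟩ := exists_act_base w
  rw [hk, hw, symCalc_of_isProjector h, symD_act, symD_base, conjDiag_apply, ← Matrix.smul_mul,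
    ← Matrix.mul_smul]
  rw [tau_conj_mul, Matrix.diagonal_mul_diagonal, ← Matrix.diagonal_smul]
  congr 3
  ext i
  rcases eq_or_ne i j with rfl | hij
  · simp [spec]
  · simp [hij]

/-- The mean of the spectral projections over the sphere commutes with `τₙ` and has trace `1`, so
Schur's lemma determines it. -/
lemma integral_symCalc {n : ℕ} {r : ℝ} (hr : 0 ≤ r) {j : Fin (n + 1)} {g : 𝓢(R2, ℂ)}
    (h : IsProjector n r j g) : waveIntegral (symCalc n g) r 0 = ((n : ℂ) + 1)⁻¹ • (1 : EndV n) := by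
  have hS := (contDiff_symCalc n g).continuous
  have hcomm : ∀ k, tau n k * waveIntegral (symCalc n g) r 0 =
      waveIntegral (symCalc n g) r 0 * tau n k := by
    intro k
    have h1 : conjTau k (waveIntegral (symCalc n g) r 0) = waveIntegral (symCalc n g) r 0 := by
      have e : waveIntegral (fun w => symCalc n g (act k w)) r 0 =
          waveIntegral (symCalc n g) r 0 := by
        rw [← waveIntegral_act]
        exact congrArg (waveIntegral (symCalc n g) r) (actL k).map_zero
      refine (map_waveIntegral (conjTau k) hS hr 0).trans (Eq.trans ?_ e)
      exact congrArg (fun S => waveIntegral S r 0) (funext fun w => (symCalc_act n g k w).symm)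
    rw [conjTau_apply] at h1
    calc _ = tau n k * waveIntegral (symCalc n g) r 0 * (tau n k⁻¹ * tau n k) := by
          rw [tau_inv_mul_tau, mul_one]
      _ = tau n k * waveIntegral (symCalc n g) r 0 * tau n k⁻¹ * tau n k := by rw [← mul_assoc]
      _ = _ := by rw [h1]
  obtain ⟨c, hc⟩ := eq_smul_one_of_commute hcomm
  have htr : (waveIntegral (symCalc n g) r 0).trace = 1 := by
    have h1 := ((trForm (1 : EndV n)).flip 1).integral_comp_comm
      (integrable_sphereMeasure hr (continuous_planeWave hS 0))
    simp only [ContinuousLinearMap.flip_apply, trForm_one, mul_one] at h1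
    rw [waveIntegral, ← h1]
    have h2 : ∀ᵐ w ∂(sphereMeasure r), (Complex.exp ((2 * Real.pi * inner ℝ w (0 : C2) : ℝ) *
        Complex.I) • symCalc n g w).trace = 1 := by
      filter_upwards [ae_sphereMeasure hr] with w hw
      obtain ⟨k, hk⟩ := exists_act_base w
      rw [hw] at hk
      rw [hk, symCalc_of_isProjector h, Matrix.trace_smul, trace_conjDiag]
      simp
    rw [integral_congr_ae h2]
    simp
  rw [hc, Matrix.trace_smul, Matrix.trace_one, Fintype.card_fin, smul_eq_mul] at htr
  rw [hc, eq_inv_of_mul_eq_one_left (a := c) (b := (n : ℂ) + 1) (by exact_mod_cast htr)]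

/-- The bounded spherical functions `Φ(z) = (n+1) ∫ e^{2πi⟨w,z⟩} P(w) dσ(w)`, where `σ` is the
invariant measure on the sphere of radius `r` and `P(w)` is a spectral projection of the symbol of
`𝐃ₙ` at `w`. -/
lemma isBoundedSpherical_waveIntegral {n : ℕ} {r : ℝ} (hr : 0 ≤ r) {j : Fin (n + 1)} {g : 𝓢(R2, ℂ)}
    (h : IsProjector n r j g) : IsBoundedSpherical n (spec n r j)
      (waveIntegral (fun w => ((n : ℂ) + 1) • symCalc n g w) r) := by
  set S : C2 → EndV n := fun w => ((n : ℂ) + 1) • symCalc n g w with hSdef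
  have hS : ContDiff ℝ ∞ S := (contDiff_symCalc n g).const_smul _
  refine ⟨contDiff_waveIntegral hS hr, ⟨_, norm_waveIntegral_le S r⟩, fun k z => ?_, ?_, fun z => ?_,
    fun z => ?_⟩
  · rw [waveIntegral_act, ← conjTau_apply]
    refine Eq.trans ?_ (map_waveIntegral (conjTau k) hS.continuous hr z).symm
    congr 1
    ext1 w
    simp only [hSdef, symCalc_act]
    exact ((conjTau k).map_smul _ _).symm
  · rw [hSdef, waveIntegral_smul, integral_symCalc hr h, smul_smul,
      mul_inv_cancel₀ (Nat.cast_add_one_ne_zero n), one_smul]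
  · rw [posLap_eq_sum z (contDiff_waveIntegral hS hr)]
    refine sum_dd_waveIntegral hS hr _ _ _ _ (fun w hw => ?_) z
    simp only [hSdef]
    rw [Matrix.mul_smul, smul_comm]
    congr 1
    exact symL_mul_symCalc j g hw
  · rw [opD_eq_sum z (contDiff_waveIntegral hS hr)]
    refine sum_dd_waveIntegral hS hr _ _ _ _ (fun w hw => ?_) z
    simp only [hSdef]
    rw [Matrix.mul_smul, smul_comm]
    congr 1
    exact symD_mul_symCalc h hw

/-! ### Injectivity of the spherical transform -/

lemma fourier_act {n : ℕ} {F : 𝓢(C2, EndV n)} (hF : IsEquivariant n F) (k : U2) (w : C2) :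
    𝓕 F (act k w) = conjTau k (𝓕 F w) := by
  refine Eq.trans ?_ (fourier_postcomp (conjTau k) F w)
  rw [SchwartzMap.fourier_coe, SchwartzMap.fourier_coe, ← actL_apply,
    ← Real.fourier_comp_linearIsometry]
  have h : (F : C2 → EndV n) ∘ actL k = (F.postcompCLM (conjTau k) : 𝓢(C2, EndV n)) :=
    funext fun w => (hF k w).trans (conjTau_apply k (F w)).symm
  rw [h]

/-- Bounded complex bilinear forms, spelled with the normed space structure of `W`. -/
abbrev CBilForm (W : Type) [NormedAddCommGroup W] [NormedSpace ℂ W] : Type := W →L[ℂ] W →L[ℂ] ℂ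

/-- Fubini's theorem, in the form of the self-adjointness of the Fourier transform. -/
lemma integral_waveIntegral {W : Type} [NormedAddCommGroup W] [NormedSpace ℂ W]
    [CompleteSpace W] (B : CBilForm W) (F : 𝓢(C2, W)) {S : C2 → W} (hS : Continuous S) {r : ℝ}
    (hr : 0 ≤ r) :
    ∫ z, B (F z) (waveIntegral S r (-z)) = ∫ w, B (𝓕 (F : C2 → W) w) (S w) ∂(sphereMeasure r) := by
  have h := VectorFourier.integral_bilin_fourierIntegral_eq_flip (μ := (volume : Measure C2))
    (ν := sphereMeasure r) (L := innerₗ C2) (e := Real.fourierChar) B Real.continuous_fourierChar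
    continuous_inner F.integrable (integrable_sphereMeasure hr hS)
  have h2 : ∀ z, VectorFourier.fourierIntegral Real.fourierChar (sphereMeasure r) (innerₗ C2).flip
      S z = waveIntegral S r (-z) := by
    intro z
    rw [VectorFourier.fourierIntegral, waveIntegral]
    congr 1
    ext1 w
    simp only [Circle.smul_def, Real.fourierChar_apply, LinearMap.flip_apply, innerₗ_apply_apply,
      inner_neg_right, real_inner_comm w z]
  simp only [h2] at h
  exact h.symm

/-- The bilinear form `(X, Y) ↦ tr (X Y)`. -/
noncomputable def trFormC (n : ℕ) : CBilForm (EndV n) :=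
  LinearMap.toContinuousLinearMap
    { toFun := fun X => LinearMap.toContinuousLinearMap
        { toFun := fun Y => (X * Y).trace
          map_add' := fun Y Z => by rw [mul_add, Matrix.trace_add]
          map_smul' := fun c Y => by simp [Matrix.trace_smul] }
      map_add' := fun X X' => by ext Y; simp [add_mul, Matrix.trace_add]
      map_smul' := fun c X => by ext Y; simp [Matrix.trace_smul] }

/-- The trace of `𝓕F(w)` against the spectral projection at `w` does not depend on `w`, `‖w‖ = r`, and
equals the `j`-th diagonal entry of `𝓕F(r, 0)`. -/
lemma sphericalTransform_waveIntegral {n : ℕ} {F : 𝓢(C2, EndV n)} (hF : IsEquivariant n F) {r : ℝ}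
    (hr : 0 ≤ r) {j : Fin (n + 1)} {g : 𝓢(R2, ℂ)} (h : IsProjector n r j g) :
    sphericalTransform n F (waveIntegral (fun w => ((n : ℂ) + 1) • symCalc n g w) r) =
      𝓕 F (base r) j j := by
  have hS : Continuous fun w => ((n : ℂ) + 1) • symCalc n g w :=
    (contDiff_symCalc n g).continuous.const_smul ((n : ℂ) + 1)
  have h1 := integral_waveIntegral (trFormC n) F hS hr
  have h2 : ∀ᵐ w ∂(sphereMeasure r), trFormC n (𝓕 (F : C2 → EndV n) w)
      (((n : ℂ) + 1) • symCalc n g w) = ((n : ℂ) + 1) * 𝓕 F (base r) j j := by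
    filter_upwards [ae_sphereMeasure hr] with w hw
    change (𝓕 F w * (((n : ℂ) + 1) • symCalc n g w)).trace = _
    obtain ⟨k, hk⟩ := exists_act_base w
    rw [hw] at hk
    rw [hk, symCalc_of_isProjector h, fourier_act hF, Matrix.mul_smul, Matrix.trace_smul,
      smul_eq_mul, conjTau_apply, conjDiag_apply]
    rw [tau_conj_mul, Matrix.trace_mul_comm, ← mul_assoc, tau_inv_mul_tau, one_mul]
    congr 1
    simp [Matrix.trace, Matrix.mul_diagonal, Pi.single_apply]
  rw [integral_congr_ae h2] at h1
  have h3 : ∫ z, (F z * waveIntegral (fun w => ((n : ℂ) + 1) • symCalc n g w) r (-z)).trace =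
      ((n : ℂ) + 1) * 𝓕 F (base r) j j := by
    refine Eq.trans h1 ?_
    simp
  rw [sphericalTransform, h3, one_div, inv_mul_cancel_left₀ (Nat.cast_add_one_ne_zero n)]

/-- The spherical transform is injective on equivariant Schwartz functions. -/
lemma eq_zero_of_sphericalTransform {n : ℕ} {F : 𝓢(C2, EndV n)} (hF : IsEquivariant n F)
    (h : ∀ ξ Φ, IsBoundedSpherical n ξ Φ → sphericalTransform n F Φ = 0) : F = 0 := by
  have hbase : ∀ r, 0 < r → 𝓕 F (base r) = 0 := by
    intro r hr
    ext i j
    rcases eq_or_ne i j with rfl | hij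
    · obtain ⟨g, hg⟩ := exists_isProjector n hr i
      rw [← sphericalTransform_waveIntegral hF hr.le hg,
        h _ _ (isBoundedSpherical_waveIntegral hr.le hg)]
      rfl
    · refine apply_eq_zero_of_commute ?_ hij
      have h1 := fourier_act hF (stab (n + 1)) (base r)
      rw [act_stab_base, conjTau_apply] at h1
      conv_rhs => rw [h1]
      rw [mul_assoc, tau_inv_mul_tau, mul_one]
  have hzero : (𝓕 F : 𝓢(C2, EndV n)) = 0 := by
    have : ((𝓕 F : 𝓢(C2, EndV n)) : C2 → EndV n) = fun _ => 0 := by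
      refine Continuous.ext_on (dense_compl_singleton (0 : C2)) (𝓕 F).continuous continuous_const ?_
      intro w hw
      obtain ⟨k, hk⟩ := exists_act_base w
      rw [hk, fourier_act hF, hbase _ (norm_pos_iff.2 hw), map_zero]
    ext1 w
    exact congrFun this w
  calc F = 𝓕⁻ (𝓕 F) := (FourierTransform.fourierInv_fourier_eq F).symm
    _ = 𝓕⁻ (0 : 𝓢(C2, EndV n)) := by rw [hzero]
    _ = 0 := by
      rw [← zero_smul ℂ (0 : 𝓢(C2, EndV n)), FourierTransform.fourierInv_smul, zero_smul, zero_smul]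

/-! ### The estimate of the inverse transform -/

lemma exists_pow_mul_le (a p : ℕ) : ∃ (N Q : ℕ) (C : ℝ), 0 ≤ C ∧ ∀ (n : ℕ) (g : 𝓢(R2, ℂ)) (z : C2),
    ‖z‖ ^ a * ‖invTransform n ((mulCoord 0)^[p] g) z‖ ≤
      C * ((n : ℝ) + 1) ^ Q * schwartzNorm N g := by
  obtain ⟨C, Q, L, hC, h⟩ := exists_decay_invTransform a
  obtain ⟨N, C', hC', h'⟩ := exists_fourierMoment_iterate_le Q L p
  refine ⟨N, Q, C * C', by positivity, fun n g z => (h n _ z).trans ?_⟩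
  calc _ ≤ C * ((n : ℝ) + 1) ^ Q * (C' * schwartzNorm N g) := by
        gcongr
        exact h' g
    _ = _ := by ring

/-- The estimate of `Δ^p (invTransform n g)` with weight `(1 + |z|²)^b`, uniform in `n` up to powers of
`n + 1`. -/
lemma exists_weight_mul_le (b p : ℕ) : ∃ (N Q : ℕ) (C : ℝ), 0 ≤ C ∧
    ∀ (n : ℕ) (g : 𝓢(R2, ℂ)) (z : C2),
      (1 + ‖z‖ ^ 2) ^ b * ‖invTransform n ((mulCoord 0)^[p] g) z‖ ≤
        C * ((n : ℝ) + 1) ^ Q * schwartzNorm N g := by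
  obtain ⟨N, Q, C, hC, h⟩ := exists_pow_mul_le 0 p
  obtain ⟨N', Q', C', hC', h'⟩ := exists_pow_mul_le (2 * b) p
  refine ⟨max N N', max Q Q', 2 ^ b * (C + C'), by positivity, fun n g z => ?_⟩
  set X := ‖invTransform n ((mulCoord 0)^[p] g) z‖
  have hX : 0 ≤ X := norm_nonneg _
  have hn : (1 : ℝ) ≤ (n : ℝ) + 1 := by linarith [(Nat.cast_nonneg n : (0 : ℝ) ≤ n)]
  have hpow : (1 + ‖z‖ ^ 2) ^ b ≤ 2 ^ b * (‖z‖ ^ 0 + ‖z‖ ^ (2 * b)) := by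
    calc (1 + ‖z‖ ^ 2) ^ b ≤ 2 ^ (b - 1) * (1 ^ b + (‖z‖ ^ 2) ^ b) :=
          add_pow_le zero_le_one (sq_nonneg _) b
      _ ≤ 2 ^ b * (1 ^ b + (‖z‖ ^ 2) ^ b) := by
          gcongr
          · norm_num
          · omega
      _ = _ := by rw [one_pow, pow_zero, pow_mul]
  calc (1 + ‖z‖ ^ 2) ^ b * X ≤ 2 ^ b * (‖z‖ ^ 0 + ‖z‖ ^ (2 * b)) * X := by gcongr
    _ = 2 ^ b * (‖z‖ ^ 0 * X + ‖z‖ ^ (2 * b) * X) := by ring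
    _ ≤ 2 ^ b * (C * ((n : ℝ) + 1) ^ Q * schwartzNorm N g +
          C' * ((n : ℝ) + 1) ^ Q' * schwartzNorm N' g) := by
        exact mul_le_mul_of_nonneg_left (add_le_add (h n g z) (h' n g z)) (by positivity)
    _ ≤ 2 ^ b * (C * ((n : ℝ) + 1) ^ max Q Q' * schwartzNorm (max N N') g +
          C' * ((n : ℝ) + 1) ^ max Q Q' * schwartzNorm (max N N') g) := by
        have h0 := schwartzNorm_nonneg N g
        have h0' := schwartzNorm_nonneg N' g
        gcongr
        · exact le_max_left _ _
        · exact schwartzNorm_mono (le_max_left _ _) g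
        · exact le_max_right _ _
        · exact schwartzNorm_mono (le_max_right _ _) g
    _ = _ := by ring

lemma integrable_inv_weight : Integrable fun z : C2 => ((1 + ‖z‖ ^ 2) ^ 4)⁻¹ := by
  have := integrable_rpow_neg_one_add_norm_sq (E := C2) (μ := volume) (r := 8) (by
    rw [← Module.finrank_mul_finrank ℝ ℂ C2, finrank_euclideanSpace, Complex.finrank_real_complex]
    norm_num)
  refine this.congr (Filter.Eventually.of_forall fun z => ?_)
  have hp : 0 < 1 + ‖z‖ ^ 2 := by positivity
  simp only
  rw [show (-8 / 2 : ℝ) = ((-4 : ℤ) : ℝ) by norm_num, Real.rpow_intCast, zpow_neg]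
  rfl

/-- A pointwise bound with the weight `(1 + |z|²)ᴹ⁺²` controls the `L²` norm with the weight
`(1 + |z|²)ᴹ`. -/
lemma sqrt_integral_weight_le {W : Type} [NormedAddCommGroup W] (M : ℕ) (f : C2 → W) {K : ℝ}
    (hK : 0 ≤ K) (h : ∀ z, (1 + ‖z‖ ^ 2) ^ (M + 2) * ‖f z‖ ≤ K) :
    √(∫ z, ((1 + ‖z‖ ^ 2) ^ M * ‖f z‖) ^ 2) ≤ K * √(∫ z : C2, ((1 + ‖z‖ ^ 2) ^ 4)⁻¹) := by
  rw [← Real.sqrt_sq hK, ← Real.sqrt_mul (sq_nonneg K), ← integral_const_mul]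
  refine Real.sqrt_le_sqrt (integral_mono_of_nonneg (Filter.Eventually.of_forall fun z =>
    sq_nonneg _) (integrable_inv_weight.const_mul _) (Filter.Eventually.of_forall fun z => ?_))
  have hp : 0 < 1 + ‖z‖ ^ 2 := by positivity
  change ((1 + ‖z‖ ^ 2) ^ M * ‖f z‖) ^ 2 ≤ K ^ 2 * ((1 + ‖z‖ ^ 2) ^ 4)⁻¹
  rw [← div_eq_mul_inv, le_div_iff₀ (by positivity)]
  calc _ = ((1 + ‖z‖ ^ 2) ^ (M + 2) * ‖f z‖) ^ 2 := by ring
    _ ≤ K ^ 2 := by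
        gcongr
        exact h z

lemma exists_schwartzNorm_invTransform_le (M : ℕ) : ∃ (N Q : ℕ) (A : ℝ), ∀ (n : ℕ) (g : 𝓢(R2, ℂ)),
    schwartzNorm M (invTransform n g) ≤ A * ((n : ℝ) + 1) ^ Q * schwartzNorm N g := by
  -- Two extra powers of `1 + |z|²` make the square of the weighted norm integrable on `ℂ² = ℝ⁴`.
  choose N Q C hC h using exists_weight_mul_le (M + 2)
  set s := Finset.range (M + 1)
  set I := √(∫ z : C2, ((1 + ‖z‖ ^ 2) ^ 4)⁻¹)
  refine ⟨∑ p ∈ s, N p, ∑ p ∈ s, Q p, (∑ p ∈ s, C p) * I, fun n g => ?_⟩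
  refine Finset.sup'_le _ _ fun p hp => ?_
  have hn : (1 : ℝ) ≤ (n : ℝ) + 1 := by linarith [(Nat.cast_nonneg n : (0 : ℝ) ≤ n)]
  rw [posLap_iterate_coe, lapS_iterate_invTransform]
  have h0 := schwartzNorm_nonneg (N p) g
  have hCp := hC p
  refine (sqrt_integral_weight_le M _ (by positivity) (h p n g)).trans ?_
  have hI : 0 ≤ I := Real.sqrt_nonneg _
  have hsum : C p ≤ ∑ p ∈ s, C p := Finset.single_le_sum (fun p _ => hC p) hp
  calc C p * ((n : ℝ) + 1) ^ Q p * schwartzNorm (N p) g * I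
      ≤ (∑ p ∈ s, C p) * ((n : ℝ) + 1) ^ (∑ p ∈ s, Q p) * schwartzNorm (∑ p ∈ s, N p) g * I := by
        have hA : 0 ≤ ∑ p ∈ s, C p := hCp.trans hsum
        gcongr
        · exact Finset.single_le_sum (fun p _ => Nat.zero_le (Q p)) hp
        · exact schwartzNorm_mono (Finset.single_le_sum (fun p _ => Nat.zero_le (N p)) hp) g
    _ = _ := by ring

lemma sphericalTransform_sub {n : ℕ} (F F' : 𝓢(C2, EndV n)) {ξ : R2} {Φ : C2 → EndV n}
    (hΦ : IsBoundedSpherical n ξ Φ) : sphericalTransform n (F - F' : 𝓢(C2, EndV n)) Φ =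
      sphericalTransform n F Φ - sphericalTransform n F' Φ := by
  obtain ⟨K, hK⟩ := hΦ.bounded
  have hc : Continuous fun z => Φ (-z) := hΦ.smooth.continuous.comp continuous_neg
  rw [sphericalTransform, sphericalTransform, sphericalTransform, ← mul_sub,
    ← integral_sub (integrable_trace_mul F hc fun z => hK (-z))
      (integrable_trace_mul F' hc fun z => hK (-z))]
  congr 2
  ext1 z
  rw [← Matrix.trace_sub, ← sub_mul]
  rfl

lemma isEquivariant_sub {n : ℕ} {F F' : C2 → EndV n} (hF : IsEquivariant n F)
    (hF' : IsEquivariant n F') : IsEquivariant n (F - F') := by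
  intro k z
  rw [Pi.sub_apply, hF k z, hF' k z, Pi.sub_apply, mul_sub, sub_mul]

/-- An equivariant Schwartz function is determined by its spherical transform. -/
lemma eq_of_hasSphericalTransform {n : ℕ} {F F' : EquivSchwartz n} {u : spectrumD n → ℂ}
    (hF : HasSphericalTransform n F.1 u) (hF' : HasSphericalTransform n F'.1 u) : F = F' := by
  refine Subtype.ext (sub_eq_zero.1 ?_)
  refine eq_zero_of_sphericalTransform (isEquivariant_sub F.2 F'.2) fun ξ Φ hΦ => ?_
  rw [sphericalTransform_sub _ _ hΦ, hF ⟨ξ, Φ, hΦ⟩ Φ hΦ, hF' ⟨ξ, Φ, hΦ⟩ Φ hΦ, sub_self]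

end MotionGroup

theorem mainTheorem5 (M : ℕ) :
    ∃ (N Q : ℕ) (A : ℝ), ∀ (n : ℕ) (g : 𝓢(MotionGroup.R2, ℂ)),
      (∃! F : MotionGroup.EquivSchwartz n,
        MotionGroup.HasSphericalTransform n F.1 ((MotionGroup.spectrumD n).domRestrict g)) ∧
      ∀ F : MotionGroup.EquivSchwartz n,
        MotionGroup.HasSphericalTransform n F.1 ((MotionGroup.spectrumD n).domRestrict g) →
        MotionGroup.schwartzNorm M F.1 ≤
          A * ((n : ℝ) + 1) ^ Q * MotionGroup.schwartzNorm N g := by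
  obtain ⟨N, Q, A, h⟩ := MotionGroup.exists_schwartzNorm_invTransform_le M
  refine ⟨N, Q, A, fun n g => ?_⟩
  let F₀ : MotionGroup.EquivSchwartz n :=
    ⟨MotionGroup.invTransform n g, MotionGroup.isEquivariant_invTransform n g⟩
  have hF₀ : MotionGroup.HasSphericalTransform n F₀.1 ((MotionGroup.spectrumD n).domRestrict g) :=
    MotionGroup.hasSphericalTransform_invTransform n g
  refine ⟨⟨F₀, hF₀, fun F hF => MotionGroup.eq_of_hasSphericalTransform hF hF₀⟩, fun F hF => ?_⟩
  rw [MotionGroup.eq_of_hasSphericalTransform hF hF₀]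
  exact h n g
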